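/- Let $\sigma, w$ be weights, that is, non-negative locally finite Borel measures on $\mathbb R$. Let $K(x,y)$ be a real kernel, differentiable for $x\neq y$, with $$|x-y|\,|\nabla K(x,y)| + |K(x,y)| \le |x-y|^{-1},\qquad x\ne y .$$ For all $0<\alpha<\beta$ let $K_{\alpha,\beta}$ be a kernel that is differentiable for $0<|x-y|<2\beta$, agrees with $K$ where $\alpha<|x-y|<\beta$, and satisfies, with a constant $C_0$ independent of $\alpha,\beta$, $$(\alpha+|x-y|)\bigl\{|K_{\alpha,\beta}(x,y)| + |x-y|\,|\nabla K_{\alpha,\beta}(x,y)|\bigr\}\le C_0\,\mathbf 1_{|x-y|<2\beta}$$ (the gradient term being required only where $0<|x-y|<2\beta$). Put $T_{\alpha,\beta}(\sigma f)(x)=\int K_{\alpha,\beta}(x,y)f(y)\,\sigma(dy)$, and let $T^*_{\alpha,\beta}$ be the operator with kernel $K_{\alpha,\beta}(y,x)$. Intervals are bounded and nondegenerate. For an interval $I$ let $$P(\sigma,I)=\int_{\mathbb R}\frac{|I|}{(|I|+\operatorname{dist}(x,I))^2}\,\sigma(dx).$$ Define constants in $[0,\infty]$ as the best ones in the following inequalities.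 - $\mathcal N_T$: $\ \sup_{0<\alpha<\beta}\|T_{\alpha,\beta}(\sigma f)\|_{L^2(w)}\le \mathcal N_T\|f\|_{L^2(\sigma)}$ for all $f\in L^2(\sigma)$. - $\mathcal T_T$: for all intervals $I$ and all $0<\alpha<\beta$, $\ \int_I|T_{\alpha,\beta}(\sigma\mathbf 1_I)|^2\,dw\le\mathcal T_T^2\,\sigma(I)$ and $\int_I|T^*_{\alpha,\beta}(w\mathbf 1_I)|^2\,d\sigma\le\mathcal T_T^2\,w(I)$. - $\mathcal A_2$: $\ P(\sigma,I)\,P(w,I)\le\mathcal A_2$ for all intervals $I$. - $\mathcal P$: for every interval $I_0$ and every partition $\mathcal Q$ of $I_0$ into intervals such that neither $\sigma$ nor $w$ has a point mass at an endpoint of $I_0$ or of an interval of $\mathcal Q$, $\ \sum_{I\in\mathcal Q}P(\sigma\mathbf 1_{I_0},I)^2\,w(I)\le\mathcal P^2\,\sigma(I_0)$, and the same with the roles of $\sigma$ and $w$ exchanged. Theorem. If $\sigma$ and $w$ share no point mass ($\sigma(\{x\})\,w(\{x\})=0$ for all $x$), $\mathcal A_2<\infty$ and $\mathcal P<\infty$,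 then $$\mathcal N_T\le C\,\bigl(\mathcal T_T+\mathcal A_2^{1/2}+\mathcal P\bigr),$$ where $C$ depends only on $C_0$. -/

import Mathlib

open MeasureTheory Set
open scoped ENNReal NNReal

namespace TwoWeight

noncomputable section

/-- A (nondegenerate, bounded) interval of the real line; it may contain either, both or none of
its endpoints. Its endpoints are the points of `frontier I`. -/
def IsInterval (I : Set ℝ) : Prop :=
  I.OrdConnected ∧ Bornology.IsBounded I ∧ (interior I).Nonempty

/-- `P (σ, I) = ∫ |I| / (|I| + dist (x, I))² σ(dx)`, with values in `[0, ∞]`. -/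
def poisson (σ : Measure ℝ) (I : Set ℝ) : ℝ≥0∞ :=
  ∫⁻ x, ENNReal.ofReal (volume.real I / (volume.real I + Metric.infDist x I) ^ 2) ∂σ

/-- The best constant `𝒜₂` in `P (σ, I) P (w, I) ≤ 𝒜₂`, uniformly over intervals `I`. -/
def A2Const (σ w : Measure ℝ) : ℝ≥0∞ :=
  sInf {A | ∀ I, IsInterval I → poisson σ I * poisson w I ≤ A}

/-- `𝒬` is a partition of `I₀` into intervals. -/
def IsIntervalPartition (𝒬 : Set (Set ℝ)) (I₀ : Set ℝ) : Prop :=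
  (∀ I ∈ 𝒬, IsInterval I) ∧ 𝒬.PairwiseDisjoint id ∧ ⋃₀ 𝒬 = I₀

/-- Neither of the two measures has a point mass at an endpoint of `I`. -/
def NoEndpointMass (σ w : Measure ℝ) (I : Set ℝ) : Prop :=
  ∀ x ∈ frontier I, σ {x} = 0 ∧ w {x} = 0

/-- The (one-sided) pivotal inequality with constant `P`: for every interval `I₀` and every
partition of `I₀` into intervals, without point masses at the endpoints,
`∑ P (σ 1_{I₀}, I)² w(I) ≤ P² σ(I₀)`. -/
def PivotalIneq (σ w : Measure ℝ) (P : ℝ≥0∞) : Prop :=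
  ∀ (I₀ : Set ℝ) (𝒬 : Set (Set ℝ)), IsInterval I₀ → IsIntervalPartition 𝒬 I₀ →
    NoEndpointMass σ w I₀ → (∀ I ∈ 𝒬, NoEndpointMass σ w I) →
      ∑' I : 𝒬, poisson (σ.restrict I₀) (I : Set ℝ) ^ 2 * w (I : Set ℝ) ≤ P ^ 2 * σ I₀

/-- The best constant `𝒫` in the pivotal inequality and its dual. -/
def pivotalConst (σ w : Measure ℝ) : ℝ≥0∞ :=
  sInf {P | PivotalIneq σ w P ∧ PivotalIneq w σ P}

/-- The Euclidean length of the gradient in both variables, `|∇K(x, y)|`. -/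
def gradNorm (K : ℝ → ℝ → ℝ) (x y : ℝ) : ℝ :=
  √(deriv (fun s => K s y) x ^ 2 + deriv (fun t => K x t) y ^ 2)

/-- A kernel, differentiable off the diagonal, with the size and gradient conditions
`|x - y| |∇K(x, y)| + |K(x, y)| ≤ |x - y|⁻¹`. -/
def IsCZKernel (K : ℝ → ℝ → ℝ) : Prop :=
  ∀ x y, x ≠ y →
    DifferentiableAt ℝ (fun p : ℝ × ℝ => K p.1 p.2) (x, y) ∧
      |x - y| * gradNorm K x y + |K x y| ≤ |x - y|⁻¹

open Classical in
/-- `k` is a smooth truncation of `K` at the levels `α < β`, with constant `C`. It agrees with `K`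
where `α < |x - y| < β`, vanishes where `|x - y| ≥ 2β`, and is differentiable where
`0 < |x - y| < 2β`. (On the diagonal the gradient term has the factor `|x - y| = 0`; where
`|x - y| = 2β` no smoothness is required, so that a corner is allowed.) -/
def IsSmoothTruncation (C : ℝ) (K : ℝ → ℝ → ℝ) (α β : ℝ) (k : ℝ → ℝ → ℝ) : Prop :=
  (∀ x y, 0 < |x - y| → |x - y| < 2 * β →
    DifferentiableAt ℝ (fun p : ℝ × ℝ => k p.1 p.2) (x, y)) ∧
  (∀ x y, (α + |x - y|) * (|k x y| + |x - y| * gradNorm k x y) ≤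
    C * (if |x - y| < 2 * β then 1 else 0)) ∧
  (∀ x y, α < |x - y| → |x - y| < β → k x y = K x y)

/-- `T(σ f)(x) = ∫ k(x, y) f(y) σ(dy)`. -/
def integralOp (k : ℝ → ℝ → ℝ) (σ : Measure ℝ) (f : ℝ → ℝ) (x : ℝ) : ℝ :=
  ∫ y, k x y * f y ∂σ

/-- The kernel of the adjoint operator. -/
def adjointKernel (k : ℝ → ℝ → ℝ) (x y : ℝ) : ℝ := k y x

/-- The best constant `𝒩_T` in
`sup_{0 < α < β} ‖T_{α,β}(σ f)‖_{L²(w)} ≤ 𝒩_T ‖f‖_{L²(σ)}`, for all `f ∈ L²(σ)`, where `T_{α,β}` has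
the kernel `k α β`. -/
def normConst (k : ℝ → ℝ → ℝ → ℝ → ℝ) (σ w : Measure ℝ) : ℝ≥0∞ :=
  sInf {N | ∀ f : ℝ → ℝ, MemLp f 2 σ → ∀ α β, 0 < α → α < β →
    eLpNorm (integralOp (k α β) σ f) 2 w ≤ N * eLpNorm f 2 σ}

/-- The testing inequality `∫_I |T(σ 1_I)|² dw ≤ T² σ(I)`, for all intervals `I`. -/
def TestingIneq (k : ℝ → ℝ → ℝ) (σ w : Measure ℝ) (T : ℝ≥0∞) : Prop :=
  ∀ I, IsInterval I →
    ∫⁻ x in I, ‖integralOp k σ (I.indicator 1) x‖ₑ ^ 2 ∂w ≤ T ^ 2 * σ I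

/-- The best constant `𝒯_T` in the testing inequalities for `T_{α,β}` and for its adjoint, uniformly
over the truncation levels `0 < α < β`. -/
def testingConst (k : ℝ → ℝ → ℝ → ℝ → ℝ) (σ w : Measure ℝ) : ℝ≥0∞ :=
  sInf {T | ∀ α β, 0 < α → α < β →
    TestingIneq (k α β) σ w T ∧ TestingIneq (adjointKernel (k α β)) w σ T}

end

end TwoWeight

/-!
The number `X` below is any number above the sum of the testing constant, the square root of the
`A₂` constant and the pivotal constant; all estimates are linear in `X`.

*Truncation.* A kernel `k = K_{α,β}` is multiplied by a continuous cutoff that vanishes for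
`|x - y| ≤ α` and for `|x - y| ≥ 2β`, and is normalized (`cutKernel`). The error is at most
`C / α` on `|x - y| < 2α` plus `C / β` on `|x - y| < 2β`, the diagonal included, so it is an operator
dominated by averages over balls of a fixed radius. The `A₂` condition alone bounds these
(`lintegral_sq_average_le`), and therefore testing passes to the truncation and the norm inequality
passes back. The truncated kernel is continuous, bounded by `1 / |x - y|`, and satisfies a Lipschitz
estimate away from the diagonal: it is an `IsTestedKernel`.

*Discretization.* On a lattice that avoids the point masses the form `∫ T(σ f) g dw` becomes a matrix
indexed by cells. Testing, `A₂` and the pivotal condition are inherited by every dyadic tree of cells.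
So is weak boundedness, `|∫_J T(σ 1_I) dw| ≲ X √(σ(I) w(J))`: off the diagonal it is the two-weight
Hardy inequality `lintegral_inv_dist_le` for sets separated by a point, again a consequence of `A₂`.
These are the hypotheses `Ctrl` (`IsTestedKernel.ctrl`), and all that follows up to the last limit is
about finite sums.

*Good functions.* Both functions are expanded in martingale differences with respect to their own
weight. If all the nodes that occur are good, that is, far from the boundaries of their much larger
ancestors, then the form is bounded (`Ctrl.form_good_le`). Nodes of comparable size are treated by
weak boundedness when they are close and by the regularity of the kernel otherwise. Far pairs of very
different size gain a geometric factor from goodness, and are summed by the Schur test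
`Ctrl.matrix_le`, which is where `A₂` enters. When the small node lies in the large one, the
difference is constant around the small one, and its contribution is rearranged along stopping nodes.
A node stops when the average of `|f|` or the pivotal quantity `P(σ 1_S, I)² w(I) / σ(I)` has become
too large compared with the stopping node `S` above it. The pivotal condition limits the stopping of
the second kind, so that the stopping nodes satisfy a Carleson packing condition and the Carleson
embedding theorem holds. There remain the stopping form `Ctrl.stopping_le`, which is small because the
pivotal quantity does not exceed its threshold; the main part of the paraproduct, bounded by testing;
and the terms from the change of the stopping node, bounded by the pivotal condition.

*Bad functions.* Among the translations of the tree the bad nodes carry a small part of the norm on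
average, so some translation makes the bad parts of `f` and `g` small. Then any a-priori bound `N` for
the form on all windows of the lattice improves to `C X + N / 2` (`form_window_improve`), and
iteration gives `2 C X`. The truncated kernel is bounded with bounded range, and so an a-priori bound
exists by `A₂`.

*Limits.* Sampling continuous functions with compact support on finer and finer lattices gives the
inequality for them (`exists_pairing_le`), density gives it on `L²(σ)` (`exists_integralOp_le`), and
`normConst_le` translates it into a bound for the best constant.
-/

namespace TwoWeight

/-! ### Dyadic nodes -/

/-- The leaves below the node with height `k` and index `j` of the dyadic tree on `ℕ`. -/
def node (k j : ℕ) : Finset ℕ := Finset.Ico (j * 2 ^ k) ((j + 1) * 2 ^ k)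

theorem mem_node {k j l : ℕ} : l ∈ node k j ↔ l / 2 ^ k = j := by
  have h : 0 < 2 ^ k := by positivity
  rw [node, Finset.mem_Ico, Nat.div_eq_iff h]
  constructor
  · rintro ⟨h1, h2⟩
    refine ⟨h1, ?_⟩
    rw [add_mul, one_mul] at h2
    omega
  · rintro ⟨h1, h2⟩
    refine ⟨h1, ?_⟩
    rw [add_mul, one_mul]
    omega

theorem node_zero (j : ℕ) : node 0 j = {j} := by
  ext l; simp [mem_node]

theorem node_one (q : ℕ) : node 1 q = {2 * q, 2 * q + 1} := by
  ext l
  rw [mem_node, Finset.mem_insert, Finset.mem_singleton]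
  omega

theorem card_node (k j : ℕ) : (node k j).card = 2 ^ k := by
  rw [node, Nat.card_Ico, add_mul, one_mul, Nat.add_sub_cancel_left]

theorem range_eq_node (n : ℕ) : Finset.range (2 ^ n) = node n 0 := by
  rw [node, Finset.range_eq_Ico, zero_mul, zero_add, one_mul]

theorem div_pow_add (l k s : ℕ) : l / 2 ^ (k + s) = l / 2 ^ k / 2 ^ s := by
  rw [Nat.div_div_eq_div_mul, pow_add]

theorem div_pow_succ (l k : ℕ) : l / 2 ^ (k + 1) = l / 2 ^ k / 2 := by
  rw [div_pow_add, pow_one]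

theorem sum_node_add (φ : ℕ → ℝ) (k s q : ℕ) :
    ∑ l ∈ node (k + s) q, φ l = ∑ j ∈ node s q, ∑ l ∈ node k j, φ l := by
  rw [← Finset.sum_fiberwise_of_maps_to (s := node (k + s) q) (t := node s q)
    (g := fun l => l / 2 ^ k)]
  · refine Finset.sum_congr rfl fun j hj => Finset.sum_congr ?_ fun _ _ => rfl
    ext l
    simp only [Finset.mem_filter, mem_node, div_pow_add] at hj ⊢
    constructor
    · exact fun h => h.2
    · intro h; rw [h]; exact ⟨hj, rfl⟩
  · intro l hl
    simpa [mem_node, div_pow_add] using hl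

theorem sum_node_succ (φ : ℕ → ℝ) (k q : ℕ) :
    ∑ l ∈ node (k + 1) q, φ l
      = ∑ l ∈ node k (2 * q), φ l + ∑ l ∈ node k (2 * q + 1), φ l := by
  rw [sum_node_add, node_one, Finset.sum_pair (by omega)]

theorem sum_range_node (φ : ℕ → ℝ) {k n : ℕ} (hk : k ≤ n) :
    ∑ l ∈ Finset.range (2 ^ n), φ l
      = ∑ j ∈ Finset.range (2 ^ (n - k)), ∑ l ∈ node k j, φ l := by
  obtain ⟨s, rfl⟩ := Nat.exists_eq_add_of_le hk
  rw [range_eq_node, sum_node_add, Nat.add_sub_cancel_left, range_eq_node]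

theorem sum_range_two_mul (φ : ℕ → ℝ) (M : ℕ) :
    ∑ q ∈ Finset.range (2 * M), φ q = ∑ j ∈ Finset.range M, (φ (2 * j) + φ (2 * j + 1)) := by
  induction M with
  | zero => simp
  | succ M ih =>
    rw [Finset.sum_range_succ, ← ih, show 2 * (M + 1) = 2 * M + 1 + 1 by ring,
      Finset.sum_range_succ, Finset.sum_range_succ, add_assoc]

theorem sum_range_pow_children (φ : ℕ → ℝ) {k n : ℕ} (hk : k < n) :
    ∑ q ∈ Finset.range (2 ^ (n - k)), φ q
      = ∑ j ∈ Finset.range (2 ^ (n - (k + 1))), (φ (2 * j) + φ (2 * j + 1)) := by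
  rw [← sum_range_two_mul]
  congr 2
  rw [← pow_succ']
  congr 1
  omega

/-- The mass of a node. -/
def mass (s : ℕ → ℝ) (k j : ℕ) : ℝ := ∑ l ∈ node k j, s l

/-- The squared `ℓ²`-norm on the node with the weight `s`. -/
def nsq (s φ : ℕ → ℝ) (k j : ℕ) : ℝ := ∑ l ∈ node k j, φ l ^ 2 * s l

/-- The squared `ℓ²`-norm on the first `2 ^ n` leaves with the weight `s`. -/
def tsq (n : ℕ) (s φ : ℕ → ℝ) : ℝ := ∑ l ∈ Finset.range (2 ^ n), φ l ^ 2 * s l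

/-- The number of leaves strictly between the leaf `l` and the node `(k, j)`. -/
def gap (l k j : ℕ) : ℕ := (j * 2 ^ k - (l + 1)) + (l - (j + 1) * 2 ^ k)

/-- The discrete Poisson average over the node `(k, j)` of the weight `s` restricted to `S`. -/
noncomputable def pois (s : ℕ → ℝ) (S : Finset ℕ) (k j : ℕ) : ℝ :=
  ∑ l ∈ S, s l * (2 ^ k / (2 ^ k + (gap l k j : ℝ)) ^ 2)

theorem mass_nonneg {s : ℕ → ℝ} (hs : ∀ l, 0 ≤ s l) (k j : ℕ) : 0 ≤ mass s k j :=
  Finset.sum_nonneg fun l _ => hs l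

theorem nsq_nonneg {s : ℕ → ℝ} (hs : ∀ l, 0 ≤ s l) (φ : ℕ → ℝ) (k j : ℕ) : 0 ≤ nsq s φ k j :=
  Finset.sum_nonneg fun l _ => mul_nonneg (sq_nonneg _) (hs l)

theorem tsq_nonneg {s : ℕ → ℝ} (hs : ∀ l, 0 ≤ s l) (n : ℕ) (φ : ℕ → ℝ) : 0 ≤ tsq n s φ :=
  Finset.sum_nonneg fun l _ => mul_nonneg (sq_nonneg _) (hs l)

theorem pois_nonneg {s : ℕ → ℝ} (hs : ∀ l, 0 ≤ s l) (S : Finset ℕ) (k j : ℕ) :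
    0 ≤ pois s S k j :=
  Finset.sum_nonneg fun l _ => mul_nonneg (hs l) (by positivity)

theorem pois_mono {s : ℕ → ℝ} (hs : ∀ l, 0 ≤ s l) {S S' : Finset ℕ} (h : S ⊆ S') (k j : ℕ) :
    pois s S k j ≤ pois s S' k j :=
  Finset.sum_le_sum_of_subset_of_nonneg h fun l _ _ => mul_nonneg (hs l) (by positivity)

theorem tsq_eq_sum_nsq {k n : ℕ} (hk : k ≤ n) (s φ : ℕ → ℝ) :
    tsq n s φ = ∑ j ∈ Finset.range (2 ^ (n - k)), nsq s φ k j :=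
  sum_range_node _ hk

theorem mass_succ (s : ℕ → ℝ) (k j : ℕ) :
    mass s (k + 1) j = mass s k (2 * j) + mass s k (2 * j + 1) := sum_node_succ _ _ _

theorem div_lt_of_lt {l k n : ℕ} (hk : k ≤ n) (hl : l < 2 ^ n) : l / 2 ^ k < 2 ^ (n - k) := by
  rw [Nat.div_lt_iff_lt_mul (by positivity), ← pow_add, Nat.sub_add_cancel hk]
  exact hl

theorem lt_of_mem_node {l k n j : ℕ} (hk : k ≤ n) (hj : j < 2 ^ (n - k)) (hl : l ∈ node k j) :
    l < 2 ^ n := by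
  rw [mem_node] at hl
  rw [← Nat.sub_add_cancel hk, pow_add, ← Nat.div_lt_iff_lt_mul (by positivity), hl]
  exact hj

theorem abs_sub_mul_le_gap (l i q : ℕ) (h : l / 2 ^ i ≠ q) :
    |((l / 2 ^ i : ℕ) : ℝ) - q| * 2 ^ i ≤ 2 ^ i + (gap l i q : ℝ) := by
  set p := l / 2 ^ i with hp
  have h0 : 0 < 2 ^ i := by positivity
  have h1 : p * 2 ^ i ≤ l := Nat.div_mul_le_self l _
  have h2 : l < (p + 1) * 2 ^ i := by
    have := Nat.lt_div_mul_add (a := l) h0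
    rw [add_mul, one_mul]; exact this
  rcases lt_or_gt_of_ne h with hlt | hgt
  · have h3 : q * 2 ^ i ≤ 2 ^ i + gap l i q + p * 2 ^ i := by
      unfold gap
      rw [add_mul] at h2
      omega
    have h4 : ((q : ℝ) * 2 ^ i) ≤ 2 ^ i + gap l i q + p * 2 ^ i := by exact_mod_cast h3
    have : ((p : ℝ)) < q := by exact_mod_cast hlt
    rw [abs_of_neg (by linarith)]
    linarith
  · have h3 : p * 2 ^ i ≤ 2 ^ i + gap l i q + q * 2 ^ i := by
      unfold gap
      rw [add_mul q]
      omega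
    have h4 : ((p : ℝ) * 2 ^ i) ≤ 2 ^ i + gap l i q + q * 2 ^ i := by exact_mod_cast h3
    have : ((q : ℝ)) < p := by exact_mod_cast hgt
    rw [abs_of_pos (by linarith)]
    linarith

theorem gap_ancestor_le (l k s j : ℕ) : gap l (k + s) (j / 2 ^ s) ≤ gap l k j := by
  have h0 : 0 < 2 ^ s := by positivity
  have h1 : j / 2 ^ s * 2 ^ s ≤ j := Nat.div_mul_le_self j _
  have h2 : j < (j / 2 ^ s + 1) * 2 ^ s := by
    have := Nat.lt_div_mul_add (a := j) h0
    rw [add_mul, one_mul]; exact this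
  have h3 : j / 2 ^ s * 2 ^ (k + s) ≤ j * 2 ^ k := by
    rw [pow_add, mul_comm (2 ^ k), ← mul_assoc]; exact Nat.mul_le_mul_right _ h1
  have h4 : (j + 1) * 2 ^ k ≤ (j / 2 ^ s + 1) * 2 ^ (k + s) := by
    rw [pow_add, mul_comm (2 ^ k), ← mul_assoc]; exact Nat.mul_le_mul_right _ h2
  unfold gap
  omega

/-- A node with index `j` is good if, in each ancestor that is at least `r` and at most `M`
generations above, it keeps the distance `(3 / 2) ^ s` (in units of its own length) from the
boundary of the ancestor `s` generations above. -/
def Good (r M j : ℕ) : Prop :=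
  ∀ s, r ≤ s → s ≤ M →
    ((3 / 2 : ℝ) ^ s ≤ (j % 2 ^ s : ℕ) ∧ (3 / 2 : ℝ) ^ s + 1 + (j % 2 ^ s : ℕ) ≤ 2 ^ s)

/-- The distance from a good node to every point outside its ancestor `s` generations above is at least
`(3 / 4) ^ s` times the length of the ancestor. -/
theorem Good.le_gap {r M j : ℕ} (h : Good r M j) {s : ℕ} (hs : r ≤ s) (hM : s ≤ M) {l k : ℕ}
    (hl : l / 2 ^ (k + s) ≠ j / 2 ^ s) : (3 / 2 : ℝ) ^ s * 2 ^ k ≤ gap l k j := by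
  obtain ⟨h1, h2⟩ := h s hs hM
  have h0 : 0 < 2 ^ s := by positivity
  set q := j / 2 ^ s with hq
  set t := j % 2 ^ s with ht
  have hj : j = q * 2 ^ s + t := by
    rw [hq, ht, mul_comm]; exact (Nat.div_add_mod j (2 ^ s)).symm
  have h3 : l + 1 ≤ q * 2 ^ (k + s) ∨ (q + 1) * 2 ^ (k + s) ≤ l := by
    rcases lt_or_gt_of_ne hl with h' | h'
    · left; exact (Nat.div_lt_iff_lt_mul (by positivity)).1 h'
    · right; exact (Nat.le_div_iff_mul_le (by positivity)).1 h'
  have hk : (0 : ℝ) < 2 ^ k := by positivity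
  rcases h3 with h3 | h3
  · have h4 : t * 2 ^ k ≤ gap l k j := by
      have : j * 2 ^ k = q * 2 ^ (k + s) + t * 2 ^ k := by rw [hj, pow_add]; ring
      unfold gap; omega
    calc (3 / 2 : ℝ) ^ s * 2 ^ k ≤ (t : ℝ) * 2 ^ k := by gcongr
      _ ≤ gap l k j := by exact_mod_cast h4
  · have h4 : 2 ^ s * 2 ^ k ≤ gap l k j + (1 + t) * 2 ^ k := by
      have : (j + 1) * 2 ^ k = q * 2 ^ (k + s) + (1 + t) * 2 ^ k := by rw [hj, pow_add]; ring
      have h5 : (q + 1) * 2 ^ (k + s) = q * 2 ^ (k + s) + 2 ^ s * 2 ^ k := by rw [pow_add]; ring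
      unfold gap; omega
    have h5 : (2 : ℝ) ^ s * 2 ^ k ≤ gap l k j + (1 + t) * 2 ^ k := by exact_mod_cast h4
    nlinarith

/-! ### Cauchy–Schwarz -/

theorem sum_abs_mul_le {ι : Type*} (S : Finset ι) (φ v : ι → ℝ) (hv : ∀ i, 0 ≤ v i) :
    ∑ i ∈ S, |φ i| * v i ≤ √(∑ i ∈ S, v i) * √(∑ i ∈ S, φ i ^ 2 * v i) := by
  have := Real.sum_mul_le_sqrt_mul_sqrt S (fun i => √(v i)) (fun i => |φ i| * √(v i))
  refine le_trans (le_of_eq ?_) (this.trans (le_of_eq ?_))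
  · refine Finset.sum_congr rfl fun i _ => ?_
    rw [mul_left_comm, Real.mul_self_sqrt (hv i)]
  · congr 2
    · exact Finset.sum_congr rfl fun i _ => Real.sq_sqrt (hv i)
    · refine Finset.sum_congr rfl fun i _ => ?_
      rw [mul_pow, Real.sq_sqrt (hv i), sq_abs]

theorem sum_mul_mul_le {ι : Type*} (S : Finset ι) (x y c : ι → ℝ) (hc : ∀ i, 0 ≤ c i) :
    ∑ i ∈ S, c i * (x i * y i) ≤ √(∑ i ∈ S, c i * x i ^ 2) * √(∑ i ∈ S, c i * y i ^ 2) := by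
  have := Real.sum_mul_le_sqrt_mul_sqrt S (fun i => √(c i) * x i) (fun i => √(c i) * y i)
  refine le_trans (le_of_eq ?_) (this.trans (le_of_eq ?_))
  · refine Finset.sum_congr rfl fun i _ => ?_
    rw [mul_mul_mul_comm, Real.mul_self_sqrt (hc i)]
  · congr 2 <;>
    · refine Finset.sum_congr rfl fun i _ => ?_
      rw [mul_pow, Real.sq_sqrt (hc i)]

theorem sum_range_inv_sq_le (M : ℕ) : ∑ t ∈ Finset.range M, 1 / (1 + (t : ℝ)) ^ 2 ≤ 2 := by
  have : ∀ M : ℕ, ∑ t ∈ Finset.range (M + 1), 1 / (1 + (t : ℝ)) ^ 2 ≤ 2 - 1 / ((M : ℝ) + 1) := by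
    intro M
    induction M with
    | zero => norm_num
    | succ M ih =>
      rw [Finset.sum_range_succ]
      refine (add_le_add_left ih _).trans ?_
      push_cast
      have h1 : (0 : ℝ) < M + 1 := by positivity
      have : 1 / (1 + ((M : ℝ) + 1)) ^ 2 ≤ 1 / (M + 1) - 1 / (M + 1 + 1) := by
        rw [div_sub_div _ _ (by positivity) (by positivity),
          div_le_div_iff₀ (by positivity) (by positivity)]
        nlinarith
      linarith
  rcases M with _ | M
  · norm_num
  · refine (this M).trans ?_
    have : (0 : ℝ) ≤ 1 / ((M : ℝ) + 1) := by positivity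
    linarith

theorem sum_inv_sq_abs_le (M q : ℕ) :
    ∑ p ∈ Finset.range M, 1 / (1 + |(p : ℝ) - q|) ^ 2 ≤ 4 := by
  have h0 : ∑ p ∈ Finset.range M, 1 / (1 + |(p : ℝ) - q|) ^ 2
      ≤ ∑ p ∈ Finset.range (q + M), 1 / (1 + |(p : ℝ) - q|) ^ 2 :=
    Finset.sum_le_sum_of_subset_of_nonneg
      (Finset.range_subset_range.2 (Nat.le_add_left _ _)) fun _ _ _ => by positivity
  refine h0.trans ?_
  rw [Finset.sum_range_add]
  have h1 : ∑ p ∈ Finset.range q, 1 / (1 + |(p : ℝ) - q|) ^ 2 ≤ 2 := by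
    rw [← Finset.sum_range_reflect]
    refine le_trans (Finset.sum_le_sum fun t ht => ?_) (sum_range_inv_sq_le q)
    have ht' := Finset.mem_range.1 ht
    rw [Nat.cast_sub (by omega), Nat.cast_sub (by omega), abs_of_nonpos (by push_cast; linarith)]
    push_cast
    gcongr
    linarith
  have h2 : ∑ p ∈ Finset.range M, 1 / (1 + |((q + p : ℕ) : ℝ) - q|) ^ 2 ≤ 2 := by
    refine le_trans (le_of_eq ?_) (sum_range_inv_sq_le M)
    refine Finset.sum_congr rfl fun t _ => ?_
    push_cast
    rw [add_sub_cancel_left, abs_of_nonneg (by positivity)]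
  linarith

/-- A Schur test for kernels that decay geometrically away from a diagonal. -/
theorem sum_geom_schur (n r : ℕ) (x y : ℕ → ℝ) :
    ∑ e ∈ Finset.range n, ∑ i ∈ Finset.Ico (e + 1 + r) n, (8 / 9 : ℝ) ^ (i - e - 1) * (x i * y e)
      ≤ 9 * (√(∑ i ∈ Finset.range n, x i ^ 2) * √(∑ e ∈ Finset.range n, y e ^ 2)) := by
  have hgeo : ∀ K : ℕ, ∑ t ∈ Finset.range K, (8 / 9 : ℝ) ^ t ≤ 9 := by
    intro K
    rw [geom_sum_eq (by norm_num)]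
    have : (0 : ℝ) ≤ (8 / 9) ^ K := by positivity
    rw [div_le_iff_of_neg (by norm_num)]
    linarith
  rw [Finset.sum_sigma']
  refine (sum_mul_mul_le _ (fun p : (_ : ℕ) × ℕ => x p.2) (fun p => y p.1)
    (fun p => (8 / 9 : ℝ) ^ (p.2 - p.1 - 1)) fun _ => by positivity).trans ?_
  have h1 : ∑ p ∈ (Finset.range n).sigma fun e => Finset.Ico (e + 1 + r) n,
      (8 / 9 : ℝ) ^ (p.2 - p.1 - 1) * x p.2 ^ 2 ≤ 9 * ∑ i ∈ Finset.range n, x i ^ 2 := by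
    rw [Finset.sum_sigma]
    have : ∀ e ∈ Finset.range n, ∑ i ∈ Finset.Ico (e + 1 + r) n,
        (8 / 9 : ℝ) ^ (i - e - 1) * x i ^ 2 ≤ ∑ i ∈ Finset.range n,
          if e < i then (8 / 9 : ℝ) ^ (i - e - 1) * x i ^ 2 else 0 := by
      intro e _
      rw [← Finset.sum_filter]
      refine Finset.sum_le_sum_of_subset_of_nonneg ?_ fun _ _ _ => by positivity
      intro i hi
      simp only [Finset.mem_Ico, Finset.mem_filter, Finset.mem_range] at hi ⊢
      omega
    refine (Finset.sum_le_sum this).trans ?_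
    rw [Finset.sum_comm, Finset.mul_sum]
    refine Finset.sum_le_sum fun i hi => ?_
    rw [← Finset.sum_filter, ← Finset.sum_mul]
    refine mul_le_mul_of_nonneg_right ?_ (sq_nonneg _)
    have : (Finset.range n).filter (fun e => e < i) = Finset.range i := by
      ext e; simp only [Finset.mem_filter, Finset.mem_range] at hi ⊢; omega
    rw [this]
    refine le_trans (le_of_eq ?_) (hgeo i)
    rw [← Finset.sum_range_reflect]
    refine Finset.sum_congr rfl fun t ht => ?_
    have := Finset.mem_range.1 ht
    congr 1; omega
  have h2 : ∑ p ∈ (Finset.range n).sigma fun e => Finset.Ico (e + 1 + r) n,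
      (8 / 9 : ℝ) ^ (p.2 - p.1 - 1) * y p.1 ^ 2 ≤ 9 * ∑ e ∈ Finset.range n, y e ^ 2 := by
    rw [Finset.sum_sigma, Finset.mul_sum]
    refine Finset.sum_le_sum fun e _ => ?_
    simp only
    rw [← Finset.sum_mul]
    refine mul_le_mul_of_nonneg_right ?_ (sq_nonneg _)
    calc ∑ i ∈ Finset.Ico (e + 1 + r) n, (8 / 9 : ℝ) ^ (i - e - 1)
        ≤ ∑ i ∈ Finset.Ico (e + 1) (e + 1 + n), (8 / 9 : ℝ) ^ (i - e - 1) := by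
          refine Finset.sum_le_sum_of_subset_of_nonneg ?_ fun _ _ _ => by positivity
          intro i hi
          simp only [Finset.mem_Ico] at hi ⊢
          omega
      _ = ∑ t ∈ Finset.range n, (8 / 9 : ℝ) ^ t := by
          rw [Finset.sum_Ico_eq_sum_range]
          refine Finset.sum_congr (by simp) fun t _ => ?_
          congr 1; omega
      _ ≤ 9 := hgeo n
  calc _ ≤ √(9 * ∑ i ∈ Finset.range n, x i ^ 2) * √(9 * ∑ e ∈ Finset.range n, y e ^ 2) := by
        gcongr
    _ = _ := by
        rw [Real.sqrt_mul (by norm_num), Real.sqrt_mul (by norm_num), mul_mul_mul_comm,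
          Real.mul_self_sqrt (by norm_num)]

section

/-! ### Martingale differences -/

/-- A family of martingale differences for the weight `s`: `d k` is constant on the nodes of
height `k`, vanishes on those of them that are null, and has mean zero on the nodes of height
`k + 1`. -/
structure MartDiff (s : ℕ → ℝ) (d : ℕ → ℕ → ℝ) : Prop where
  const : ∀ k l l', l / 2 ^ k = l' / 2 ^ k → d k l = d k l'
  null : ∀ k l, mass s k (l / 2 ^ k) = 0 → d k l = 0
  mean : ∀ k j, ∑ l ∈ node (k + 1) j, d k l * s l = 0

theorem div_pow_eq_of_le {k i l l' : ℕ} (hki : k ≤ i) (h : l / 2 ^ k = l' / 2 ^ k) :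
    l / 2 ^ i = l' / 2 ^ i := by
  obtain ⟨t, rfl⟩ := Nat.exists_eq_add_of_le hki
  rw [div_pow_add, div_pow_add, h]

theorem div_rep (j k : ℕ) : j * 2 ^ k / 2 ^ k = j := Nat.mul_div_cancel _ (by positivity)

/-- Orthogonality of functions with mean zero at successive generations. -/
theorem tsq_sum_eq {s : ℕ → ℝ} {h : ℕ → ℕ → ℝ} {n : ℕ}
    (hc : ∀ k l l', l / 2 ^ k = l' / 2 ^ k → h k l = h k l')
    (hm : ∀ k < n, ∀ j, ∑ l ∈ node (k + 1) j, h k l * s l = 0) {m : ℕ} (hmn : m ≤ n) :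
    tsq n s (fun l => ∑ k ∈ Finset.range m, h k l) = ∑ k ∈ Finset.range m, tsq n s (h k) := by
  induction m with
  | zero => simp [tsq]
  | succ m ih =>
    rw [Finset.sum_range_succ, ← ih (by omega)]
    have hz : ∑ l ∈ Finset.range (2 ^ n), (∑ k ∈ Finset.range m, h k l) * h m l * s l = 0 := by
      simp_rw [Finset.sum_mul]
      rw [Finset.sum_comm]
      refine Finset.sum_eq_zero fun k hk => ?_
      rw [Finset.mem_range] at hk
      rw [sum_range_node _ (show k + 1 ≤ n by omega)]
      refine Finset.sum_eq_zero fun j _ => ?_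
      have : ∀ l ∈ node (k + 1) j, h k l * h m l * s l
          = h m (j * 2 ^ (k + 1)) * (h k l * s l) := by
        intro l hl
        rw [hc m l (j * 2 ^ (k + 1)) (div_pow_eq_of_le (show k + 1 ≤ m by omega) (by
          rw [mem_node.1 hl, div_rep]))]
        ring
      rw [Finset.sum_congr rfl this, ← Finset.mul_sum, hm k (by omega), mul_zero]
    have : ∀ l, (∑ k ∈ Finset.range (m + 1), h k l) ^ 2 * s l
        = (∑ k ∈ Finset.range m, h k l) ^ 2 * s l + h m l ^ 2 * s l
          + 2 * ((∑ k ∈ Finset.range m, h k l) * h m l * s l) := by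
      intro l; rw [Finset.sum_range_succ]; ring
    simp only [tsq, this, Finset.sum_add_distrib, ← Finset.mul_sum, hz, mul_zero, add_zero]

theorem MartDiff.tsq_eq {s : ℕ → ℝ} {d : ℕ → ℕ → ℝ} (hd : MartDiff s d) (n : ℕ) :
    tsq n s (fun l => ∑ k ∈ Finset.range n, d k l) = ∑ k ∈ Finset.range n, tsq n s (d k) :=
  tsq_sum_eq hd.const (fun k _ => hd.mean k) le_rfl

/-! ### Bilinear forms on a dyadic tree -/

/-- The hypotheses on a bilinear form with matrix `B` on the leaves of the dyadic tree, between the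
weights `s` and `v`, all with the same constant `X`: testing on nodes, weak boundedness on pairs of
nodes, regularity of the kernel, the `A₂` condition and the pivotal condition. The last four are
stated in units of the length of a leaf. -/
structure Ctrl (s v : ℕ → ℝ) (B : ℕ → ℕ → ℝ) (X : ℝ) : Prop where
  s_nonneg : ∀ l, 0 ≤ s l
  v_nonneg : ∀ l, 0 ≤ v l
  X_pos : 0 < X
  test : ∀ k j (ψ : ℕ → ℝ), |∑ m ∈ node k j, (∑ l ∈ node k j, B l m) * ψ m|
    ≤ X * √(mass s k j) * √(nsq v ψ k j)
  wb : ∀ i p k q, |∑ l ∈ node i p, ∑ m ∈ node k q, B l m| ≤ X * √(mass s i p) * √(mass v k q)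
  reg : ∀ k j l (ψ : ℕ → ℝ), 0 < gap l k j → ∑ m ∈ node k j, ψ m * v m = 0 →
    |∑ m ∈ node k j, B l m * ψ m|
      ≤ s l * (2 ^ k / (gap l k j : ℝ) ^ 2) * ∑ m ∈ node k j, |ψ m| * v m
  a2 : ∀ k (j : ℕ) (M : ℕ), (∑ q ∈ Finset.range M, mass v k q * (1 / (2 ^ k * (1 + |(j : ℝ) - q|) ^ 2)))
    * (mass s k j / 2 ^ k) ≤ X ^ 2
  piv : ∀ k j (𝒬 : Finset (ℕ × ℕ)), (∀ p ∈ 𝒬, node p.1 p.2 ⊆ node k j) →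
    (∀ p ∈ 𝒬, ∀ p' ∈ 𝒬, p ≠ p' → Disjoint (node p.1 p.2) (node p'.1 p'.2)) →
    ∑ p ∈ 𝒬, pois s (node k j) p.1 p.2 ^ 2 * mass v p.1 p.2 ≤ X ^ 2 * mass s k j

variable {s v : ℕ → ℝ} {B : ℕ → ℕ → ℝ} {X : ℝ}

/-- The matrix with entries `√s(I) √v(J) |I| / (|I| + dist (I, J))²`, for nodes `I` and `J` of the
same height, is bounded on `ℓ²` by the `A₂` condition. -/
theorem Ctrl.matrix_le (h : Ctrl s v B X) (i M : ℕ) (a b : ℕ → ℝ) (ha : ∀ p, 0 ≤ a p) :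
    ∑ p ∈ Finset.range M, ∑ q ∈ Finset.range M,
        1 / (2 ^ i * (1 + |(p : ℝ) - q|) ^ 2) * ((√(mass s i p) * a p) * (√(mass v i q) * b q))
      ≤ 2 * X * √(∑ p ∈ Finset.range M, a p ^ 2) * √(∑ q ∈ Finset.range M, b q ^ 2) := by
  set c : ℕ → ℕ → ℝ := fun p q => 1 / (2 ^ i * (1 + |(p : ℝ) - q|) ^ 2) with hc
  have hc0 : ∀ p q, 0 ≤ c p q := fun p q => by simp only [hc]; positivity
  set D : ℕ → ℝ := fun p => ∑ q ∈ Finset.range M, 1 / (1 + |(p : ℝ) - q|) ^ 2 * b q ^ 2 with hD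
  have hD0 : ∀ p, 0 ≤ D p := fun p => Finset.sum_nonneg fun q _ => by positivity
  have h1 : ∀ p ∈ Finset.range M, ∑ q ∈ Finset.range M,
      c p q * ((√(mass s i p) * a p) * (√(mass v i q) * b q)) ≤ X * (a p * √(D p)) := by
    intro p _
    have h2 := sum_mul_mul_le (Finset.range M) (fun q => √(mass v i q)) b (c p) (hc0 p)
    have h3 : ∑ q ∈ Finset.range M, c p q * √(mass v i q) ^ 2
        = ∑ q ∈ Finset.range M, mass v i q * (1 / (2 ^ i * (1 + |(p : ℝ) - q|) ^ 2)) := by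
      refine Finset.sum_congr rfl fun q _ => ?_
      rw [Real.sq_sqrt (mass_nonneg h.v_nonneg _ _), mul_comm]
    have h4 : ∑ q ∈ Finset.range M, c p q * b q ^ 2 = D p / 2 ^ i := by
      simp only [hD, Finset.sum_div, hc]
      refine Finset.sum_congr rfl fun q _ => ?_
      field_simp
    rw [h3, h4] at h2
    set V := ∑ q ∈ Finset.range M, mass v i q * (1 / (2 ^ i * (1 + |(p : ℝ) - q|) ^ 2)) with hV
    have h5 : √(mass s i p) * (√V * √(D p / 2 ^ i)) = √(V * (mass s i p / 2 ^ i)) * √(D p) := by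
      have hV0 : 0 ≤ V := Finset.sum_nonneg fun q _ =>
        mul_nonneg (mass_nonneg h.v_nonneg _ _) (by positivity)
      rw [← Real.sqrt_mul hV0, ← Real.sqrt_mul (mass_nonneg h.s_nonneg _ _),
        ← Real.sqrt_mul (mul_nonneg hV0 (div_nonneg (mass_nonneg h.s_nonneg _ _) (by positivity)))]
      congr 1; ring
    have h6 : √(V * (mass s i p / 2 ^ i)) ≤ X := by
      rw [Real.sqrt_le_left h.X_pos.le]; exact h.a2 i p M
    calc ∑ q ∈ Finset.range M, c p q * ((√(mass s i p) * a p) * (√(mass v i q) * b q))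
        = a p * (√(mass s i p) * ∑ q ∈ Finset.range M, c p q * (√(mass v i q) * b q)) := by
          rw [Finset.mul_sum, Finset.mul_sum]
          exact Finset.sum_congr rfl fun q _ => by ring
      _ ≤ a p * (√(mass s i p) * (√V * √(D p / 2 ^ i))) := by
          have := ha p
          gcongr
      _ = a p * (√(V * (mass s i p / 2 ^ i)) * √(D p)) := by rw [h5]
      _ ≤ a p * (X * √(D p)) := by have := ha p; gcongr
      _ = X * (a p * √(D p)) := by ring
  refine (Finset.sum_le_sum h1).trans ?_
  rw [← Finset.mul_sum]
  have h7 := Real.sum_mul_le_sqrt_mul_sqrt (Finset.range M) a (fun p => √(D p))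
  have h8 : ∑ p ∈ Finset.range M, √(D p) ^ 2 ≤ 2 ^ 2 * ∑ q ∈ Finset.range M, b q ^ 2 := by
    simp_rw [Real.sq_sqrt (hD0 _), hD]
    rw [Finset.sum_comm, Finset.mul_sum]
    refine Finset.sum_le_sum fun q _ => ?_
    rw [← Finset.sum_mul]
    refine mul_le_mul_of_nonneg_right ?_ (sq_nonneg _)
    exact (sum_inv_sq_abs_le M q).trans (by norm_num)
  have h9 : √(∑ p ∈ Finset.range M, √(D p) ^ 2) ≤ 2 * √(∑ q ∈ Finset.range M, b q ^ 2) := by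
    refine (Real.sqrt_le_sqrt h8).trans (le_of_eq ?_)
    rw [Real.sqrt_mul (by norm_num), Real.sqrt_sq (by norm_num)]
  calc X * ∑ p ∈ Finset.range M, a p * √(D p)
      ≤ X * (√(∑ p ∈ Finset.range M, a p ^ 2) * (2 * √(∑ q ∈ Finset.range M, b q ^ 2))) := by
        refine mul_le_mul_of_nonneg_left (h7.trans ?_) h.X_pos.le
        gcongr
    _ = _ := by ring

/-- Pairs of nodes of the same height with the decay of the Poisson kernel contribute a part
bounded by the `A₂` condition. -/
theorem Ctrl.offdiag_le (h : Ctrl s v B X) {i n : ℕ} (hi : i ≤ n) (φ ψ : ℕ → ℝ)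
    (far : ℕ → ℕ → Prop) [DecidableRel far] {c : ℝ} (hc : 0 ≤ c)
    (H : ∀ l < 2 ^ n, ∀ q < 2 ^ (n - i), far (l / 2 ^ i) q → |∑ m ∈ node i q, B l m * ψ m|
      ≤ c * (s l * (1 / (2 ^ i * (1 + |((l / 2 ^ i : ℕ) : ℝ) - q|) ^ 2)))
        * ∑ m ∈ node i q, |ψ m| * v m) :
    |∑ l ∈ Finset.range (2 ^ n), ∑ m ∈ Finset.range (2 ^ n),
        if far (l / 2 ^ i) (m / 2 ^ i) then B l m * φ l * ψ m else 0|
      ≤ 2 * c * X * √(tsq n s φ) * √(tsq n v ψ) := by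
  set E : ℕ → ℝ := fun q => ∑ m ∈ node i q, |ψ m| * v m with hE
  have hE0 : ∀ q, 0 ≤ E q := fun q =>
    Finset.sum_nonneg fun m _ => mul_nonneg (abs_nonneg _) (h.v_nonneg m)
  set K : ℕ → ℕ → ℝ := fun p q => 1 / (2 ^ i * (1 + |(p : ℝ) - q|) ^ 2) with hK
  have hK0 : ∀ p q, 0 ≤ K p q := fun p q => by simp only [hK]; positivity
  set R := Finset.range (2 ^ (n - i)) with hR
  have h1 : ∀ l ∈ Finset.range (2 ^ n), |∑ m ∈ Finset.range (2 ^ n),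
      if far (l / 2 ^ i) (m / 2 ^ i) then B l m * φ l * ψ m else 0|
      ≤ ∑ q ∈ R, c * (|φ l| * s l * (K (l / 2 ^ i) q * E q)) := by
    intro l hl
    rw [sum_range_node _ hi]
    refine (Finset.abs_sum_le_sum_abs _ _).trans (Finset.sum_le_sum fun q hq => ?_)
    have h2 : ∑ m ∈ node i q, (if far (l / 2 ^ i) (m / 2 ^ i) then B l m * φ l * ψ m else 0)
        = if far (l / 2 ^ i) q then φ l * ∑ m ∈ node i q, B l m * ψ m else 0 := by
      split_ifs with hf
      · rw [Finset.mul_sum]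
        refine Finset.sum_congr rfl fun m hm => ?_
        rw [mem_node.1 hm, if_pos hf]; ring
      · refine Finset.sum_eq_zero fun m hm => ?_
        rw [mem_node.1 hm, if_neg hf]
    rw [h2]
    split_ifs with hf
    · rw [abs_mul]
      refine (mul_le_mul_of_nonneg_left (H l (Finset.mem_range.1 hl) q (Finset.mem_range.1 hq) hf)
        (abs_nonneg _)).trans (le_of_eq ?_)
      simp only [hK, hE]; ring
    · rw [abs_zero]
      have := h.s_nonneg l
      have := hE0 q
      have := hK0 (l / 2 ^ i) q
      positivity
  refine (Finset.abs_sum_le_sum_abs _ _).trans ((Finset.sum_le_sum h1).trans ?_)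
  rw [sum_range_node _ hi]
  have h3 : ∀ p ∈ R, ∑ l ∈ node i p, ∑ q ∈ R, c * (|φ l| * s l * (K (l / 2 ^ i) q * E q))
      ≤ c * ∑ q ∈ R, K p q * ((√(mass s i p) * √(nsq s φ i p))
        * (√(mass v i q) * √(nsq v ψ i q))) := by
    intro p _
    rw [Finset.sum_comm, Finset.mul_sum]
    refine Finset.sum_le_sum fun q _ => ?_
    have : ∀ l ∈ node i p, c * (|φ l| * s l * (K (l / 2 ^ i) q * E q))
        = c * K p q * E q * (|φ l| * s l) := by
      intro l hl; rw [mem_node.1 hl]; ring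
    rw [Finset.sum_congr rfl this, ← Finset.mul_sum]
    have h4 := sum_abs_mul_le (node i p) φ s h.s_nonneg
    have h5 : E q ≤ √(mass v i q) * √(nsq v ψ i q) := sum_abs_mul_le (node i q) ψ v h.v_nonneg
    calc c * K p q * E q * ∑ l ∈ node i p, |φ l| * s l
        ≤ c * K p q * (√(mass v i q) * √(nsq v ψ i q)) * (√(mass s i p) * √(nsq s φ i p)) := by
          have := hK0 p q
          have := hE0 q
          refine mul_le_mul ?_ h4 ?_ ?_
          · gcongr
          · exact Finset.sum_nonneg fun m _ => mul_nonneg (abs_nonneg _) (h.s_nonneg m)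
          · positivity
      _ = _ := by ring
  refine (Finset.sum_le_sum h3).trans ?_
  rw [← Finset.mul_sum]
  have h6 := h.matrix_le i (2 ^ (n - i)) (fun p => √(nsq s φ i p)) (fun q => √(nsq v ψ i q))
    fun _ => Real.sqrt_nonneg _
  simp only [Real.sq_sqrt (nsq_nonneg h.s_nonneg _ _ _),
    Real.sq_sqrt (nsq_nonneg h.v_nonneg _ _ _)] at h6
  rw [← tsq_eq_sum_nsq hi, ← tsq_eq_sum_nsq hi] at h6
  calc _ ≤ c * (2 * X * √(tsq n s φ) * √(tsq n v ψ)) := mul_le_mul_of_nonneg_left h6 hc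
    _ = _ := by ring

/-! ### Pairs of comparable nodes -/

/-- Two indices are equal or adjacent. -/
def Near (p q : ℕ) : Prop := p ≤ q + 1 ∧ q ≤ p + 1

instance : DecidableRel Near := fun _ _ => inferInstanceAs (Decidable (_ ∧ _))

theorem Near.symm {p q : ℕ} (h : Near p q) : Near q p := ⟨h.2, h.1⟩

theorem sum_near_le (p b M : ℕ) :
    ∑ J ∈ Finset.range M, (if Near p (J / 2 ^ b) then (1 : ℝ) else 0) ≤ 3 * 2 ^ b := by
  rw [← Finset.sum_filter, Finset.sum_const, nsmul_eq_mul, mul_one]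
  have : (Finset.range M).filter (fun J => Near p (J / 2 ^ b))
      ⊆ node b (p - 1) ∪ node b p ∪ node b (p + 1) := by
    intro J hJ
    simp only [Finset.mem_filter, Finset.mem_union, mem_node] at hJ ⊢
    obtain ⟨_, h1, h2⟩ := hJ
    generalize J / 2 ^ b = q at *
    omega
  have h2 := (Finset.card_le_card this).trans (Finset.card_union_le _ _)
  have h3 := Finset.card_union_le (node b (p - 1)) (node b p)
  simp only [card_node] at h2 h3
  have : ((Finset.range M).filter (fun J => Near p (J / 2 ^ b))).card ≤ 3 * 2 ^ b := by omega
  exact_mod_cast this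

/-- Schur test for pairs of nodes of comparable size that are close to each other: each row and each
column has a bounded number of entries. -/
theorem sum_near_mul_le (a b M M' : ℕ) (x y : ℕ → ℝ) :
    ∑ I ∈ Finset.range M, ∑ J ∈ Finset.range M',
        (if Near (I / 2 ^ a) (J / 2 ^ b) then (1 : ℝ) else 0) * (x I * y J)
      ≤ √(3 * 2 ^ b) * √(3 * 2 ^ a) *
        (√(∑ I ∈ Finset.range M, x I ^ 2) * √(∑ J ∈ Finset.range M', y J ^ 2)) := by
  have h := sum_mul_mul_le (Finset.range M ×ˢ Finset.range M') (fun P => x P.1) (fun P => y P.2)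
    (fun P => if Near (P.1 / 2 ^ a) (P.2 / 2 ^ b) then (1 : ℝ) else 0)
    (fun P => by split_ifs <;> norm_num)
  rw [Finset.sum_product, Finset.sum_product, Finset.sum_product_right] at h
  refine h.trans ?_
  have h1 : ∑ I ∈ Finset.range M, ∑ J ∈ Finset.range M',
      (if Near (I / 2 ^ a) (J / 2 ^ b) then (1 : ℝ) else 0) * x I ^ 2
      ≤ 3 * 2 ^ b * ∑ I ∈ Finset.range M, x I ^ 2 := by
    rw [Finset.mul_sum]
    refine Finset.sum_le_sum fun I _ => ?_
    rw [← Finset.sum_mul]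
    exact mul_le_mul_of_nonneg_right (sum_near_le _ _ _) (sq_nonneg _)
  have h2 : ∑ J ∈ Finset.range M', ∑ I ∈ Finset.range M,
      (if Near (I / 2 ^ a) (J / 2 ^ b) then (1 : ℝ) else 0) * y J ^ 2
      ≤ 3 * 2 ^ a * ∑ J ∈ Finset.range M', y J ^ 2 := by
    rw [Finset.mul_sum]
    refine Finset.sum_le_sum fun J _ => ?_
    rw [← Finset.sum_mul]
    refine mul_le_mul_of_nonneg_right ?_ (sq_nonneg _)
    refine le_trans (le_of_eq ?_) (sum_near_le (J / 2 ^ b) a M)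
    refine Finset.sum_congr rfl fun I _ => ?_
    exact if_congr ⟨Near.symm, Near.symm⟩ rfl rfl
  calc _ ≤ √(3 * 2 ^ b * ∑ I ∈ Finset.range M, x I ^ 2)
        * √(3 * 2 ^ a * ∑ J ∈ Finset.range M', y J ^ 2) := by gcongr
    _ = _ := by
        rw [Real.sqrt_mul (by positivity : (0 : ℝ) ≤ 3 * 2 ^ b),
          Real.sqrt_mul (by positivity : (0 : ℝ) ≤ 3 * 2 ^ a)]
        ring

/-- The part of the form between martingale differences of given generations that comes from
adjacent or equal nodes is bounded by weak boundedness. -/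
theorem Ctrl.near_le (h : Ctrl s v B X) {i k n : ℕ} (hi : i + 1 ≤ n) (hk : k ≤ i + 1)
    {φ ψ : ℕ → ℝ} (hφ : ∀ l l', l / 2 ^ i = l' / 2 ^ i → φ l = φ l')
    (hψ : ∀ l l', l / 2 ^ k = l' / 2 ^ k → ψ l = ψ l') :
    |∑ l ∈ Finset.range (2 ^ n), ∑ m ∈ Finset.range (2 ^ n),
        if Near (l / 2 ^ (i + 1)) (m / 2 ^ (i + 1)) then B l m * φ l * ψ m else 0|
      ≤ √(3 * 2 ^ (i + 1 - k)) * √(3 * 2 ^ 1) * X * √(tsq n s φ) * √(tsq n v ψ) := by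
  have key : ∀ I J, ∑ l ∈ node i I, ∑ m ∈ node k J,
      (if Near (l / 2 ^ (i + 1)) (m / 2 ^ (i + 1)) then B l m * φ l * ψ m else 0)
      = (if Near (I / 2 ^ 1) (J / 2 ^ (i + 1 - k)) then (1 : ℝ) else 0) *
        (φ (I * 2 ^ i) * ψ (J * 2 ^ k) * ∑ l ∈ node i I, ∑ m ∈ node k J, B l m) := by
    intro I J
    simp_rw [Finset.mul_sum]
    refine Finset.sum_congr rfl fun l hl => Finset.sum_congr rfl fun m hm => ?_
    have e1 : l / 2 ^ (i + 1) = I / 2 ^ 1 := by rw [div_pow_add, mem_node.1 hl]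
    have e2 : m / 2 ^ (i + 1) = J / 2 ^ (i + 1 - k) := by
      obtain ⟨t, ht⟩ := Nat.exists_eq_add_of_le hk
      rw [ht, div_pow_add, mem_node.1 hm, Nat.add_sub_cancel_left]
    rw [e1, e2, hφ l (I * 2 ^ i) (by rw [mem_node.1 hl, div_rep]),
      hψ m (J * 2 ^ k) (by rw [mem_node.1 hm, div_rep])]
    split_ifs <;> ring
  have e0 : ∑ l ∈ Finset.range (2 ^ n), ∑ m ∈ Finset.range (2 ^ n),
        (if Near (l / 2 ^ (i + 1)) (m / 2 ^ (i + 1)) then B l m * φ l * ψ m else 0)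
      = ∑ I ∈ Finset.range (2 ^ (n - i)), ∑ J ∈ Finset.range (2 ^ (n - k)),
        (if Near (I / 2 ^ 1) (J / 2 ^ (i + 1 - k)) then (1 : ℝ) else 0) *
        (φ (I * 2 ^ i) * ψ (J * 2 ^ k) * ∑ l ∈ node i I, ∑ m ∈ node k J, B l m) := by
    rw [sum_range_node _ (show i ≤ n by omega)]
    refine Finset.sum_congr rfl fun I _ => ?_
    simp_rw [sum_range_node _ (show k ≤ n by omega)]
    rw [Finset.sum_comm]
    exact Finset.sum_congr rfl fun J _ => key I J
  have hx : ∀ I, |φ (I * 2 ^ i)| * √(mass s i I) = √(nsq s φ i I) := by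
    intro I
    have : nsq s φ i I = φ (I * 2 ^ i) ^ 2 * mass s i I := by
      rw [nsq, mass, Finset.mul_sum]
      refine Finset.sum_congr rfl fun l hl => ?_
      rw [hφ l (I * 2 ^ i) (by rw [mem_node.1 hl, div_rep])]
    rw [this, Real.sqrt_mul (sq_nonneg _), Real.sqrt_sq_eq_abs]
  have hy : ∀ J, |ψ (J * 2 ^ k)| * √(mass v k J) = √(nsq v ψ k J) := by
    intro J
    have : nsq v ψ k J = ψ (J * 2 ^ k) ^ 2 * mass v k J := by
      rw [nsq, mass, Finset.mul_sum]
      refine Finset.sum_congr rfl fun l hl => ?_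
      rw [hψ l (J * 2 ^ k) (by rw [mem_node.1 hl, div_rep])]
    rw [this, Real.sqrt_mul (sq_nonneg _), Real.sqrt_sq_eq_abs]
  rw [e0]
  calc _ ≤ ∑ I ∈ Finset.range (2 ^ (n - i)), ∑ J ∈ Finset.range (2 ^ (n - k)),
        X * ((if Near (I / 2 ^ 1) (J / 2 ^ (i + 1 - k)) then (1 : ℝ) else 0) *
        (√(nsq s φ i I) * √(nsq v ψ k J))) := by
        refine (Finset.abs_sum_le_sum_abs _ _).trans (Finset.sum_le_sum fun I _ => ?_)
        refine (Finset.abs_sum_le_sum_abs _ _).trans (Finset.sum_le_sum fun J _ => ?_)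
        have h0 : (0 : ℝ) ≤ if Near (I / 2 ^ 1) (J / 2 ^ (i + 1 - k)) then (1 : ℝ) else 0 := by
          split_ifs <;> norm_num
        rw [abs_mul, abs_of_nonneg h0, abs_mul, abs_mul, ← hx, ← hy]
        calc _ ≤ (if Near (I / 2 ^ 1) (J / 2 ^ (i + 1 - k)) then (1 : ℝ) else 0) *
              (|φ (I * 2 ^ i)| * |ψ (J * 2 ^ k)| * (X * √(mass s i I) * √(mass v k J))) := by
              gcongr
              exact h.wb i I k J
          _ = _ := by ring
    _ = X * ∑ I ∈ Finset.range (2 ^ (n - i)), ∑ J ∈ Finset.range (2 ^ (n - k)),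
        (if Near (I / 2 ^ 1) (J / 2 ^ (i + 1 - k)) then (1 : ℝ) else 0) *
        (√(nsq s φ i I) * √(nsq v ψ k J)) := by simp_rw [Finset.mul_sum]
    _ ≤ X * (√(3 * 2 ^ (i + 1 - k)) * √(3 * 2 ^ 1) * (√(tsq n s φ) * √(tsq n v ψ))) := by
        refine mul_le_mul_of_nonneg_left ?_ h.X_pos.le
        refine (sum_near_mul_le _ _ _ _ _ _).trans (le_of_eq ?_)
        simp only [Real.sq_sqrt (nsq_nonneg h.s_nonneg _ _ _),
          Real.sq_sqrt (nsq_nonneg h.v_nonneg _ _ _)]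
        rw [← tsq_eq_sum_nsq (show i ≤ n by omega), ← tsq_eq_sum_nsq (show k ≤ n by omega)]
    _ = _ := by ring

/-- Regularity of the kernel on a node, when the function has mean zero on the subnodes of a fixed
height. -/
theorem Ctrl.abs_sum_node_le (h : Ctrl s v B X) {k t q l : ℕ} {ψ : ℕ → ℝ} {G : ℝ}
    (H : ∀ j ∈ node t q, (∀ m ∈ node k j, ψ m = 0) ∨ (0 < gap l k j ∧
      ∑ m ∈ node k j, ψ m * v m = 0 ∧ 2 ^ k / (gap l k j : ℝ) ^ 2 ≤ G)) :
    |∑ m ∈ node (k + t) q, B l m * ψ m|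
      ≤ s l * G * ∑ m ∈ node (k + t) q, |ψ m| * v m := by
  rw [sum_node_add, sum_node_add, Finset.mul_sum]
  refine (Finset.abs_sum_le_sum_abs _ _).trans (Finset.sum_le_sum fun j hj => ?_)
  have h0 : 0 ≤ ∑ m ∈ node k j, |ψ m| * v m :=
    Finset.sum_nonneg fun m _ => mul_nonneg (abs_nonneg _) (h.v_nonneg m)
  rcases H j hj with h1 | ⟨h1, h2, h3⟩
  · rw [Finset.sum_eq_zero fun m hm => by rw [h1 m hm, mul_zero], abs_zero,
      Finset.sum_eq_zero fun m hm => by rw [h1 m hm, abs_zero, zero_mul], mul_zero]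
  · refine (h.reg k j l ψ h1 h2).trans ?_
    have := h.s_nonneg l
    gcongr

/-- Martingale differences of comparable generations. -/
theorem Ctrl.comparable_le (h : Ctrl s v B X) {d e : ℕ → ℕ → ℝ} (hd : MartDiff s d)
    (he : MartDiff v e) {i k n : ℕ} (hi : i + 1 ≤ n) (hk : k ≤ i) :
    |∑ l ∈ Finset.range (2 ^ n), ∑ m ∈ Finset.range (2 ^ n), B l m * d i l * e k m|
      ≤ (√(3 * 2 ^ (i + 1 - k)) * √(3 * 2 ^ 1) + 18) * X
        * √(tsq n s (d i)) * √(tsq n v (e k)) := by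
  have h1 := h.near_le hi (show k ≤ i + 1 by omega) (hd.const i) (he.const k)
  have h2 := h.offdiag_le (c := 9) hi (d i) (e k) (fun p q => ¬ Near p q) (by norm_num) (by
    intro l _ q _ hf
    obtain ⟨t, rfl⟩ := Nat.exists_eq_add_of_le hk
    have hgap : |((l / 2 ^ (k + t + 1) : ℕ) : ℝ) - q| * 2 ^ (k + t + 1)
        ≤ 2 ^ (k + t + 1) + gap l (k + t + 1) q :=
      abs_sub_mul_le_gap _ _ _ fun h => hf (h ▸ ⟨by omega, by omega⟩)
    have h2 : (2 : ℝ) ≤ |((l / 2 ^ (k + t + 1) : ℕ) : ℝ) - q| := by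
      rcases not_and_or.1 hf with h' | h'
      · have : ((q + 2 : ℕ) : ℝ) ≤ ((l / 2 ^ (k + t + 1) : ℕ) : ℝ) := by
          exact_mod_cast (by omega : q + 2 ≤ l / 2 ^ (k + t + 1))
        push_cast at this ⊢
        exact le_trans (by linarith) (le_abs_self _)
      · have : ((l / 2 ^ (k + t + 1) + 2 : ℕ) : ℝ) ≤ q := by
          exact_mod_cast (by omega : l / 2 ^ (k + t + 1) + 2 ≤ q)
        push_cast at this ⊢
        exact le_trans (by linarith) (neg_le_abs _)
    set D := |((l / 2 ^ (k + t + 1) : ℕ) : ℝ) - q| with hD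
    have := h.abs_sum_node_le (k := k + 1) (t := t) (q := q) (l := l) (ψ := e k)
      (G := 9 * (1 / (2 ^ (k + t + 1) * (1 + D) ^ 2))) (by
        intro j hj
        right
        have hg := gap_ancestor_le l (k + 1) t j
        rw [mem_node.1 hj, show k + 1 + t = k + t + 1 by ring] at hg
        have hg' : (gap l (k + t + 1) q : ℝ) ≤ gap l (k + 1) j := by exact_mod_cast hg
        have hp : (0 : ℝ) < 2 ^ (k + t + 1) := by positivity
        have h3 : (1 + D) / 3 * 2 ^ (k + t + 1) ≤ gap l (k + 1) j := by nlinarith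
        have h4 : (0 : ℝ) < (1 + D) / 3 * 2 ^ (k + t + 1) := by positivity
        refine ⟨by exact_mod_cast h4.trans_le h3, he.mean k j, ?_⟩
        calc (2 : ℝ) ^ (k + 1) / (gap l (k + 1) j : ℝ) ^ 2
            ≤ 2 ^ (k + t + 1) / ((1 + D) / 3 * 2 ^ (k + t + 1)) ^ 2 := by
              gcongr
              · norm_num
          _ = _ := by field_simp; norm_num)
    rw [show k + 1 + t = k + t + 1 by ring] at this
    refine this.trans (le_of_eq ?_)
    ring)
  have e : ∑ l ∈ Finset.range (2 ^ n), ∑ m ∈ Finset.range (2 ^ n), B l m * d i l * e k m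
      = (∑ l ∈ Finset.range (2 ^ n), ∑ m ∈ Finset.range (2 ^ n),
        if Near (l / 2 ^ (i + 1)) (m / 2 ^ (i + 1)) then B l m * d i l * e k m else 0)
      + ∑ l ∈ Finset.range (2 ^ n), ∑ m ∈ Finset.range (2 ^ n),
        if ¬ Near (l / 2 ^ (i + 1)) (m / 2 ^ (i + 1)) then B l m * d i l * e k m else 0 := by
    rw [← Finset.sum_add_distrib]
    refine Finset.sum_congr rfl fun l _ => ?_
    rw [← Finset.sum_add_distrib]
    refine Finset.sum_congr rfl fun m _ => ?_
    split_ifs <;> simp_all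
  rw [e]
  refine (abs_add_le _ _).trans ((add_le_add h1 h2).trans (le_of_eq ?_))
  ring

end

/-! ### Stopping nodes -/

theorem node_nonempty (k j : ℕ) : (node k j).Nonempty := by
  rw [← Finset.card_pos, card_node]; positivity

theorem node_disjoint {k j j' : ℕ} (h : j ≠ j') : Disjoint (node k j) (node k j') :=
  Finset.disjoint_left.2 fun _ h1 h2 => h ((mem_node.1 h1).symm.trans (mem_node.1 h2))

theorem node_subset_parent (k j : ℕ) : node k j ⊆ node (k + 1) (j / 2) := by
  intro l hl
  rw [mem_node] at hl ⊢
  rw [div_pow_succ, hl]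

theorem down_induction {P : ℕ → Prop} {n : ℕ} (h0 : P n) (hs : ∀ k < n, P (k + 1) → P k) :
    ∀ k ≤ n, P k := by
  intro k hk
  obtain ⟨m, hm⟩ := Nat.exists_eq_add_of_le hk
  induction m generalizing k with
  | zero => rw [add_zero] at hm; exact hm ▸ h0
  | succ m ih => exact hs k (by omega) (ih (k + 1) (by omega) (by omega))

/-- The `s`-integral of `|f|` on a node. -/
def absInt (s f : ℕ → ℝ) (k j : ℕ) : ℝ := ∑ l ∈ node k j, |f l| * s l

/-- The `s`-average of `|f|` on the node `S = (k, j)`; it is `0` on null nodes. -/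
noncomputable def absAvg (s f : ℕ → ℝ) (S : ℕ × ℕ) : ℝ := absInt s f S.1 S.2 / mass s S.1 S.2

/-- The condition for a node below the stopping node `S` to be a stopping node itself: the average
of `|f|` is large in comparison with that on `S`, or the pivotal quantity is large. -/
def StopCond (s v f : ℕ → ℝ) (X : ℝ) (S : ℕ × ℕ) (k j : ℕ) : Prop :=
  0 < mass s k j ∧ (4 * absAvg s f S * mass s k j < absInt s f k j ∨
    4 * X ^ 2 * mass s k j < pois s (node S.1 S.2) k j ^ 2 * mass v k j)

open Classical in
/-- The minimal stopping node above the node that has the index `j` and lies `m` generations below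
the root generation `n`. -/
noncomputable def stopTopAux (n : ℕ) (s v f : ℕ → ℝ) (X : ℝ) : ℕ → ℕ → ℕ × ℕ
  | 0, j => (n, j)
  | m + 1, j => if StopCond s v f X (stopTopAux n s v f X m (j / 2)) (n - (m + 1)) j
      then (n - (m + 1), j) else stopTopAux n s v f X m (j / 2)

/-- The minimal stopping node that contains the node `(k, j)`. -/
noncomputable def stopTop (n : ℕ) (s v f : ℕ → ℝ) (X : ℝ) (k j : ℕ) : ℕ × ℕ :=
  stopTopAux n s v f X (n - k) j

/-- The node `(k, j)` is a stopping node. -/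
def IsStop (n : ℕ) (s v f : ℕ → ℝ) (X : ℝ) (k j : ℕ) : Prop := stopTop n s v f X k j = (k, j)

section Stop

variable {n : ℕ} {s v f : ℕ → ℝ} {B : ℕ → ℕ → ℝ} {X : ℝ}

theorem stopTop_root (j : ℕ) : stopTop n s v f X n j = (n, j) := by
  simp [stopTop, stopTopAux]

theorem isStop_root (j : ℕ) : IsStop n s v f X n j := stopTop_root j

open Classical in
theorem stopTop_of_lt {k : ℕ} (hk : k < n) (j : ℕ) : stopTop n s v f X k j =
    if StopCond s v f X (stopTop n s v f X (k + 1) (j / 2)) k j then (k, j)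
      else stopTop n s v f X (k + 1) (j / 2) := by
  obtain ⟨m, rfl⟩ : ∃ m, n = k + (m + 1) := ⟨n - k - 1, by omega⟩
  unfold stopTop
  rw [show k + (m + 1) - k = m + 1 by omega, show k + (m + 1) - (k + 1) = m by omega, stopTopAux,
    show k + (m + 1) - (m + 1) = k by omega]

theorem le_stopTop_fst : ∀ k ≤ n, ∀ j, k ≤ (stopTop n s v f X k j).1 := by
  refine down_induction (fun j => by rw [stopTop_root]) fun k hk ih j => ?_
  rw [stopTop_of_lt hk]
  split_ifs
  · exact le_rfl
  · have := ih (j / 2); omega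

theorem stopTop_fst_le : ∀ k ≤ n, ∀ j, (stopTop n s v f X k j).1 ≤ n := by
  refine down_induction (fun j => by rw [stopTop_root]) fun k hk ih j => ?_
  rw [stopTop_of_lt hk]
  split_ifs
  · exact hk.le
  · exact ih (j / 2)

theorem isStop_iff {k : ℕ} (hk : k < n) (j : ℕ) : IsStop n s v f X k j ↔
    StopCond s v f X (stopTop n s v f X (k + 1) (j / 2)) k j := by
  unfold IsStop
  rw [stopTop_of_lt hk]
  split_ifs with h
  · simp [h]
  · refine iff_of_false (fun h' => ?_) h
    have := le_stopTop_fst (n := n) (s := s) (v := v) (f := f) (X := X) (k + 1) hk (j / 2)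
    rw [h'] at this
    simp at this

theorem stopTop_of_not_isStop {k : ℕ} (hk : k < n) {j : ℕ} (h : ¬ IsStop n s v f X k j) :
    stopTop n s v f X k j = stopTop n s v f X (k + 1) (j / 2) := by
  rw [isStop_iff hk] at h
  rw [stopTop_of_lt hk, if_neg h]

theorem node_subset_stopTop : ∀ k ≤ n, ∀ j,
    node k j ⊆ node (stopTop n s v f X k j).1 (stopTop n s v f X k j).2 := by
  refine down_induction (fun j => by rw [stopTop_root]) fun k hk ih j => ?_
  rw [stopTop_of_lt hk]
  split_ifs
  · exact Finset.Subset.refl _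
  · exact (node_subset_parent k j).trans (ih (j / 2))

theorem isStop_stopTop : ∀ k ≤ n, ∀ j,
    IsStop n s v f X (stopTop n s v f X k j).1 (stopTop n s v f X k j).2 := by
  refine down_induction (fun j => by rw [stopTop_root]; exact isStop_root j) fun k hk ih j => ?_
  by_cases h : IsStop n s v f X k j
  · rw [show stopTop n s v f X k j = (k, j) from h]; exact h
  · rw [stopTop_of_not_isStop hk h]; exact ih (j / 2)

open Classical in
/-- The maximal stopping nodes strictly below the node `(k, j)`. -/
noncomputable def stopChildren (n : ℕ) (s v f : ℕ → ℝ) (X : ℝ) : ℕ → ℕ → Finset (ℕ × ℕ)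
  | 0, _ => ∅
  | k + 1, j =>
    (if IsStop n s v f X k (2 * j) then {(k, 2 * j)} else stopChildren n s v f X k (2 * j)) ∪
    (if IsStop n s v f X k (2 * j + 1) then {(k, 2 * j + 1)}
      else stopChildren n s v f X k (2 * j + 1))

theorem node_subset_of_mem_stopChildren {k j : ℕ} {p : ℕ × ℕ}
    (hp : p ∈ stopChildren n s v f X k j) : node p.1 p.2 ⊆ node k j := by
  induction k generalizing j with
  | zero => simp [stopChildren] at hp
  | succ k ih =>
    have h1 : node k (2 * j) ⊆ node (k + 1) j := by
      have := node_subset_parent k (2 * j); rwa [show 2 * j / 2 = j by omega] at this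
    have h2 : node k (2 * j + 1) ⊆ node (k + 1) j := by
      have := node_subset_parent k (2 * j + 1); rwa [show (2 * j + 1) / 2 = j by omega] at this
    rw [stopChildren, Finset.mem_union] at hp
    rcases hp with hp | hp <;> split_ifs at hp
    · rw [Finset.mem_singleton.1 hp]; exact h1
    · exact (ih hp).trans h1
    · rw [Finset.mem_singleton.1 hp]; exact h2
    · exact (ih hp).trans h2

open Classical in
theorem node_subset_of_mem_ite {k q : ℕ} {p : ℕ × ℕ}
    (hp : p ∈ if IsStop n s v f X k q then {(k, q)} else stopChildren n s v f X k q) :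
    node p.1 p.2 ⊆ node k q := by
  split_ifs at hp
  · rw [Finset.mem_singleton.1 hp]
  · exact node_subset_of_mem_stopChildren hp

theorem disjoint_of_mem_stopChildren {k j : ℕ} {p p' : ℕ × ℕ}
    (hp : p ∈ stopChildren n s v f X k j) (hp' : p' ∈ stopChildren n s v f X k j) (hne : p ≠ p') :
    Disjoint (node p.1 p.2) (node p'.1 p'.2) := by
  classical
  induction k generalizing j with
  | zero => simp [stopChildren] at hp
  | succ k ih =>
    have key : ∀ q, p ∈ (if IsStop n s v f X k q then {(k, q)} else stopChildren n s v f X k q) →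
        p' ∈ (if IsStop n s v f X k q then {(k, q)} else stopChildren n s v f X k q) →
        Disjoint (node p.1 p.2) (node p'.1 p'.2) := by
      intro q h1 h2
      split_ifs at h1 h2
      · exact absurd ((Finset.mem_singleton.1 h1).trans (Finset.mem_singleton.1 h2).symm) hne
      · exact ih h1 h2
    rw [stopChildren, Finset.mem_union] at hp hp'
    rcases hp with hp | hp <;> rcases hp' with hp' | hp'
    · exact key _ hp hp'
    · exact Disjoint.mono (node_subset_of_mem_ite hp) (node_subset_of_mem_ite hp')
        (node_disjoint (by omega))
    · exact Disjoint.mono (node_subset_of_mem_ite hp) (node_subset_of_mem_ite hp')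
        (node_disjoint (by omega))
    · exact key _ hp hp'

theorem stopCond_of_mem_stopChildren {k j : ℕ} (hk : k ≤ n) {p : ℕ × ℕ}
    (hp : p ∈ stopChildren n s v f X k j) :
    StopCond s v f X (stopTop n s v f X k j) p.1 p.2 := by
  classical
  induction k generalizing j with
  | zero => simp [stopChildren] at hp
  | succ k ih =>
    have key : ∀ q, q / 2 = j →
        p ∈ (if IsStop n s v f X k q then {(k, q)} else stopChildren n s v f X k q) →
        StopCond s v f X (stopTop n s v f X (k + 1) j) p.1 p.2 := by
      intro q hq h1
      split_ifs at h1 with hs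
      · rw [Finset.mem_singleton.1 h1, ← hq]
        exact (isStop_iff hk q).1 hs
      · have := ih (by omega) h1
        rwa [stopTop_of_not_isStop hk hs, hq] at this
    rw [stopChildren, Finset.mem_union] at hp
    rcases hp with hp | hp
    · exact key _ (by omega) hp
    · exact key _ (by omega) hp

open Classical in
theorem sum_stopChildren_succ (ω : ℕ × ℕ → ℝ) (k j : ℕ) :
    ∑ p ∈ stopChildren n s v f X (k + 1) j, ω p
      = (if IsStop n s v f X k (2 * j) then ω (k, 2 * j)
          else ∑ p ∈ stopChildren n s v f X k (2 * j), ω p)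
        + (if IsStop n s v f X k (2 * j + 1) then ω (k, 2 * j + 1)
          else ∑ p ∈ stopChildren n s v f X k (2 * j + 1), ω p) := by
  rw [stopChildren, Finset.sum_union]
  · split_ifs <;> simp
  · rw [Finset.disjoint_left]
    intro p h1 h2
    obtain ⟨l, hl⟩ := node_nonempty p.1 p.2
    exact Finset.disjoint_left.1 (node_disjoint (k := k) (show 2 * j ≠ 2 * j + 1 by omega))
      (node_subset_of_mem_ite h1 hl) (node_subset_of_mem_ite h2 hl)

theorem sum_stopChildren_le {φ : ℕ → ℝ} (hφ : ∀ l, 0 ≤ φ l) (k j : ℕ) :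
    ∑ p ∈ stopChildren n s v f X k j, ∑ l ∈ node p.1 p.2, φ l ≤ ∑ l ∈ node k j, φ l := by
  rw [← Finset.sum_biUnion]
  · refine Finset.sum_le_sum_of_subset_of_nonneg ?_ fun l _ _ => hφ l
    exact Finset.biUnion_subset.2 fun p hp => node_subset_of_mem_stopChildren hp
  · exact fun p hp p' hp' hne => disjoint_of_mem_stopChildren hp hp' hne

theorem absInt_nonneg (hs : ∀ l, 0 ≤ s l) (k j : ℕ) : 0 ≤ absInt s f k j :=
  Finset.sum_nonneg fun l _ => mul_nonneg (abs_nonneg _) (hs l)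

theorem absAvg_nonneg (hs : ∀ l, 0 ≤ s l) (S : ℕ × ℕ) : 0 ≤ absAvg s f S :=
  div_nonneg (absInt_nonneg hs _ _) (mass_nonneg hs _ _)

theorem absInt_sq_le (hs : ∀ l, 0 ≤ s l) (k j : ℕ) :
    absInt s f k j ^ 2 ≤ nsq s f k j * mass s k j := by
  have h := sum_abs_mul_le (node k j) f s hs
  have h0 := absInt_nonneg (f := f) hs k j
  calc absInt s f k j ^ 2 ≤ (√(mass s k j) * √(nsq s f k j)) ^ 2 := by gcongr; exact h
    _ = _ := by
      rw [mul_pow, Real.sq_sqrt (mass_nonneg hs _ _), Real.sq_sqrt (nsq_nonneg hs _ _ _), mul_comm]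

/-- The stopping children of a stopping node carry at most half of its mass: a quarter each for the
two alternatives in the stopping condition. -/
theorem sum_mass_stopChildren_le (h : Ctrl s v B X) {k j : ℕ} (hk : k ≤ n)
    (hst : IsStop n s v f X k j) :
    ∑ p ∈ stopChildren n s v f X k j, mass s p.1 p.2 ≤ mass s k j / 2 := by
  set α := absAvg s f (k, j) with hα
  have hα0 : 0 ≤ α := absAvg_nonneg h.s_nonneg _
  have hX := h.X_pos
  have hpt : ∀ p ∈ stopChildren n s v f X k j, mass s p.1 p.2 ≤
      absInt s f p.1 p.2 / (4 * α)
        + pois s (node k j) p.1 p.2 ^ 2 * mass v p.1 p.2 / (4 * X ^ 2) := by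
    intro p hp
    have hc := stopCond_of_mem_stopChildren hk hp
    rw [show stopTop n s v f X k j = (k, j) from hst] at hc
    obtain ⟨hm, hc⟩ := hc
    have e1 : 0 ≤ absInt s f p.1 p.2 / (4 * α) :=
      div_nonneg (absInt_nonneg h.s_nonneg _ _) (by positivity)
    have e2 : 0 ≤ pois s (node k j) p.1 p.2 ^ 2 * mass v p.1 p.2 / (4 * X ^ 2) :=
      div_nonneg (mul_nonneg (sq_nonneg _) (mass_nonneg h.v_nonneg _ _)) (by positivity)
    rcases hc with hc | hc
    · have hsub := node_subset_of_mem_stopChildren hp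
      have hu : absInt s f p.1 p.2 ≤ absInt s f k j :=
        Finset.sum_le_sum_of_subset_of_nonneg hsub fun l _ _ =>
          mul_nonneg (abs_nonneg _) (h.s_nonneg l)
      have hms : mass s p.1 p.2 ≤ mass s k j :=
        Finset.sum_le_sum_of_subset_of_nonneg hsub fun l _ _ => h.s_nonneg l
      have hαpos : 0 < α := by
        refine div_pos ?_ (hm.trans_le hms)
        refine lt_of_lt_of_le (lt_of_le_of_lt ?_ hc) hu
        have := absAvg_nonneg (f := f) h.s_nonneg (k, j)
        positivity
      have : mass s p.1 p.2 ≤ absInt s f p.1 p.2 / (4 * α) := by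
        rw [le_div_iff₀ (by positivity), mul_comm]; exact hc.le
      linarith
    · have : mass s p.1 p.2 ≤ pois s (node k j) p.1 p.2 ^ 2 * mass v p.1 p.2 / (4 * X ^ 2) := by
        rw [le_div_iff₀ (by positivity), mul_comm]; exact hc.le
      linarith
  refine (Finset.sum_le_sum hpt).trans ?_
  rw [Finset.sum_add_distrib, ← Finset.sum_div, ← Finset.sum_div]
  have h1 : ∑ p ∈ stopChildren n s v f X k j, absInt s f p.1 p.2 ≤ absInt s f k j :=
    sum_stopChildren_le (fun l => mul_nonneg (abs_nonneg _) (h.s_nonneg l)) k j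
  have h2 := h.piv k j (stopChildren n s v f X k j)
    (fun p hp => node_subset_of_mem_stopChildren hp)
    (fun p hp p' hp' hne => disjoint_of_mem_stopChildren hp hp' hne)
  have h3 : (∑ p ∈ stopChildren n s v f X k j, absInt s f p.1 p.2) / (4 * α)
      ≤ mass s k j / 4 := by
    rcases hα0.eq_or_lt with h0 | h0
    · have := mass_nonneg h.s_nonneg k j
      rw [← h0, mul_zero, div_zero]; positivity
    · rw [div_le_iff₀ (by positivity)]
      refine h1.trans (le_of_eq ?_)
      have hm : mass s k j ≠ 0 := by
        intro h00
        rw [hα, absAvg, h00, div_zero] at h0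
        exact lt_irrefl _ h0
      rw [hα, absAvg]; field_simp
  have h4 : (∑ p ∈ stopChildren n s v f X k j,
      pois s (node k j) p.1 p.2 ^ 2 * mass v p.1 p.2) / (4 * X ^ 2) ≤ mass s k j / 4 := by
    rw [div_le_iff₀ (by positivity)]
    refine h2.trans (le_of_eq ?_)
    ring
  linarith

open Classical in
/-- The total mass of the stopping nodes strictly below the node `(k, j)`. -/
noncomputable def stopMass (n : ℕ) (s v f : ℕ → ℝ) (X : ℝ) : ℕ → ℕ → ℝ
  | 0, _ => 0
  | k + 1, j =>
    ((if IsStop n s v f X k (2 * j) then mass s k (2 * j) else 0)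
      + stopMass n s v f X k (2 * j)) +
    ((if IsStop n s v f X k (2 * j + 1) then mass s k (2 * j + 1) else 0)
      + stopMass n s v f X k (2 * j + 1))

theorem stopMass_nonneg (hs : ∀ l, 0 ≤ s l) (k j : ℕ) : 0 ≤ stopMass n s v f X k j := by
  induction k generalizing j with
  | zero => simp [stopMass]
  | succ k ih =>
    have h1 := ih (2 * j)
    have h2 := ih (2 * j + 1)
    have h3 := mass_nonneg hs k (2 * j)
    have h4 := mass_nonneg hs k (2 * j + 1)
    rw [stopMass]
    split_ifs <;> linarith

/-- Since the mass of the stopping children is at most half of that of their parent, the generations of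
stopping nodes have a geometric total mass. -/
theorem stopMass_le (h : Ctrl s v B X) {k : ℕ} (hk : k ≤ n) (j : ℕ) :
    stopMass n s v f X k j ≤ 2 * ∑ p ∈ stopChildren n s v f X k j, mass s p.1 p.2 := by
  induction k generalizing j with
  | zero => simp [stopMass, stopChildren]
  | succ k ih =>
    classical
    rw [stopMass, sum_stopChildren_succ (fun p => mass s p.1 p.2), mul_add]
    have key : ∀ q, (if IsStop n s v f X k q then mass s k q else 0) + stopMass n s v f X k q
        ≤ 2 * (if IsStop n s v f X k q then mass s k q
          else ∑ p ∈ stopChildren n s v f X k q, mass s p.1 p.2) := by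
      intro q
      have h1 := ih (by omega) q
      split_ifs with hst
      · have := sum_mass_stopChildren_le h (show k ≤ n by omega) hst
        linarith
      · linarith
    exact add_le_add (key _) (key _)

open Classical in
/-- The Carleson packing condition of the stopping nodes. -/
theorem stopMass_add_le (h : Ctrl s v B X) {k : ℕ} (hk : k ≤ n) (j : ℕ) :
    (if IsStop n s v f X k j then mass s k j else 0) + stopMass n s v f X k j
      ≤ 2 * mass s k j := by
  have h1 := stopMass_le (f := f) h hk j
  split_ifs with hst
  · have := sum_mass_stopChildren_le h hk hst
    linarith
  · have : ∑ p ∈ stopChildren n s v f X k j, mass s p.1 p.2 ≤ mass s k j :=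
      sum_stopChildren_le h.s_nonneg k j
    linarith

theorem add_sq_div_add_le {u₁ u₂ y₁ y₂ : ℝ} (h₁ : 0 ≤ y₁) (h₂ : 0 ≤ y₂) (hu₁ : y₁ = 0 → u₁ = 0)
    (hu₂ : y₂ = 0 → u₂ = 0) : (u₁ + u₂) ^ 2 / (y₁ + y₂) ≤ u₁ ^ 2 / y₁ + u₂ ^ 2 / y₂ := by
  rcases h₁.eq_or_lt with h | h
  · rw [hu₁ h.symm, ← h]; simp
  rcases h₂.eq_or_lt with h' | h'
  · rw [hu₂ h'.symm, ← h']; simp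
  rw [div_add_div _ _ h.ne' h'.ne', div_le_div_iff₀ (by positivity) (by positivity)]
  nlinarith [mul_nonneg h.le h'.le, sq_nonneg (u₁ * y₂ - u₂ * y₁), mul_pos h h']

/-- The concavity property of the Bellman function `F - u² / (x + a)` of the Carleson embedding
theorem, where `a` grows by `c`. -/
theorem bellman_step {u x b c : ℝ} (hx : 0 ≤ x) (hb : 0 ≤ b) (hc : 0 ≤ c) (hbc : b + c ≤ x)
    (hu : x = 0 → u = 0) :
    c * (u / x) ^ 2 / 4 + u ^ 2 / (x + b + c) ≤ u ^ 2 / (x + b) := by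
  rcases hx.eq_or_lt with h | h
  · rw [hu h.symm]; simp
  have h1 : u ^ 2 / (x + b) - u ^ 2 / (x + b + c) = c * u ^ 2 / ((x + b) * (x + b + c)) := by
    rw [div_sub_div _ _ (by positivity) (by positivity)]; ring
  have h2 : c * (u / x) ^ 2 / 4 = c * u ^ 2 / (4 * x ^ 2) := by field_simp
  have h3 : c * u ^ 2 / (4 * x ^ 2) ≤ c * u ^ 2 / ((x + b) * (x + b + c)) := by
    have : (x + b) * (x + b + c) ≤ 4 * x ^ 2 := by nlinarith
    gcongr
  linarith

open Classical in
/-- The Carleson embedding theorem for the stopping nodes. -/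
theorem sum_absAvg_sq_le (h : Ctrl s v B X) :
    ∑ i ∈ Finset.range (n + 1), ∑ j ∈ Finset.range (2 ^ (n - i)),
      (if IsStop n s v f X i j then absAvg s f (i, j) ^ 2 * mass s i j else 0)
      ≤ 8 * tsq n s f := by
  set st : ℕ → ℕ → ℝ := fun i j => if IsStop n s v f X i j then mass s i j else 0 with hst
  set a : ℕ → ℕ → ℝ := fun i j => (st i j + stopMass n s v f X i j) / 2 with ha
  set Φ : ℕ → ℕ → ℝ := fun i j =>
    8 * (nsq s f i j - absInt s f i j ^ 2 / (mass s i j + a i j)) with hΦ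
  have hst0 : ∀ i j, 0 ≤ st i j := fun i j => by
    simp only [hst]; split_ifs
    · exact mass_nonneg h.s_nonneg _ _
    · exact le_rfl
  have hx0 := fun i j => mass_nonneg h.s_nonneg i j
  have hW0 := fun i j => stopMass_nonneg (n := n) (v := v) (f := f) (X := X) h.s_nonneg i j
  have ha0 : ∀ i j, 0 ≤ a i j := fun i j => by
    have := hst0 i j; have := hW0 i j; simp only [ha]; linarith
  have hax : ∀ i ≤ n, ∀ j, a i j ≤ mass s i j := fun i hi j => by
    have := stopMass_add_le (f := f) h hi j; simp only [ha, hst]; linarith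
  have hu0 : ∀ i j, mass s i j = 0 → absInt s f i j = 0 := fun i j h0 => by
    have := absInt_sq_le (f := f) h.s_nonneg i j
    rw [h0, mul_zero] at this
    exact pow_eq_zero_iff (two_ne_zero) |>.1 (le_antisymm this (sq_nonneg _))
  have hterm : ∀ i j, (if IsStop n s v f X i j then absAvg s f (i, j) ^ 2 * mass s i j else 0)
      = st i j * (absInt s f i j / mass s i j) ^ 2 := fun i j => by
    simp only [hst, absAvg]; split_ifs <;> ring
  have hCS : ∀ i j, absInt s f i j ^ 2 / mass s i j ≤ nsq s f i j := fun i j => by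
    rcases (hx0 i j).eq_or_lt with h0 | h0
    · rw [← h0, div_zero]; exact nsq_nonneg h.s_nonneg _ _ _
    · rw [div_le_iff₀ h0]; exact absInt_sq_le h.s_nonneg i j
  have hbase : ∀ j, st 0 j * (absInt s f 0 j / mass s 0 j) ^ 2 ≤ Φ 0 j := by
    intro j
    have e : a 0 j = st 0 j / 2 := by simp [ha, stopMass]
    have h1 := bellman_step (hx0 0 j) le_rfl (c := st 0 j / 2) (by have := hst0 0 j; linarith)
      (by have := hax 0 (Nat.zero_le _) j; rw [e] at this; linarith) (hu0 0 j)
    have h2 := hCS 0 j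
    simp only [hΦ, e]
    rw [add_zero] at h1
    linarith
  have hstep : ∀ i < n, ∀ j, st (i + 1) j * (absInt s f (i + 1) j / mass s (i + 1) j) ^ 2
      + (Φ i (2 * j) + Φ i (2 * j + 1)) ≤ Φ (i + 1) j := by
    intro i hi j
    have e1 : mass s (i + 1) j = mass s i (2 * j) + mass s i (2 * j + 1) := mass_succ _ _ _
    have e2 : absInt s f (i + 1) j = absInt s f i (2 * j) + absInt s f i (2 * j + 1) :=
      sum_node_succ _ _ _
    have e3 : nsq s f (i + 1) j = nsq s f i (2 * j) + nsq s f i (2 * j + 1) := sum_node_succ _ _ _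
    have e4 : a (i + 1) j = a i (2 * j) + a i (2 * j + 1) + st (i + 1) j / 2 := by
      simp only [ha, hst, stopMass]; ring
    have h1 := bellman_step (u := absInt s f (i + 1) j) (hx0 (i + 1) j)
      (b := a i (2 * j) + a i (2 * j + 1)) (add_nonneg (ha0 _ _) (ha0 _ _)) (c := st (i + 1) j / 2)
      (by have := hst0 (i + 1) j; linarith)
      (by have := hax (i + 1) hi j; rw [e4] at this; linarith) (hu0 (i + 1) j)
    have hz : ∀ q, mass s i q + a i q = 0 → absInt s f i q = 0 := fun q h0 =>
      hu0 i q (by have := hx0 i q; have := ha0 i q; linarith)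
    have h2 := add_sq_div_add_le (add_nonneg (hx0 i (2 * j)) (ha0 i (2 * j)))
      (add_nonneg (hx0 i (2 * j + 1)) (ha0 i (2 * j + 1))) (hz _) (hz _)
    rw [← e2, show mass s i (2 * j) + a i (2 * j) + (mass s i (2 * j + 1) + a i (2 * j + 1))
      = mass s (i + 1) j + (a i (2 * j) + a i (2 * j + 1)) by rw [e1]; ring] at h2
    simp only [hΦ]
    rw [e4, e3, ← add_assoc (mass s (i + 1) j)]
    linarith
  have hsum : ∀ k ≤ n, ∑ i ∈ Finset.range (k + 1), ∑ j ∈ Finset.range (2 ^ (n - i)),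
      st i j * (absInt s f i j / mass s i j) ^ 2 ≤ ∑ j ∈ Finset.range (2 ^ (n - k)), Φ k j := by
    intro k
    induction k with
    | zero =>
      intro _
      rw [zero_add, Finset.sum_range_one]
      exact Finset.sum_le_sum fun j _ => hbase j
    | succ k ih =>
      intro hk
      rw [Finset.sum_range_succ]
      have h1 := ih (by omega)
      rw [sum_range_pow_children _ (show k < n by omega)] at h1
      have h2 := Finset.sum_le_sum fun j (_ : j ∈ Finset.range (2 ^ (n - (k + 1)))) =>
        hstep k hk j
      rw [Finset.sum_add_distrib] at h2
      linarith
  simp_rw [hterm]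
  refine (hsum n le_rfl).trans ?_
  rw [tsq_eq_sum_nsq le_rfl, Finset.mul_sum]
  refine Finset.sum_le_sum fun j _ => ?_
  have : 0 ≤ absInt s f n j ^ 2 / (mass s n j + a n j) :=
    div_nonneg (sq_nonneg _) (add_nonneg (hx0 _ _) (ha0 _ _))
  simp only [hΦ]
  linarith

open Classical in
/-- The pivotal quantities of the stopping nodes relative to their stopping parents satisfy a
Carleson embedding. -/
theorem sum_pivotal_le (h : Ctrl s v B X) :
    ∑ i ∈ Finset.range n, ∑ q ∈ Finset.range (2 ^ (n - i)),
      (if IsStop n s v f X i q then absAvg s f (stopTop n s v f X (i + 1) (q / 2)) ^ 2 *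
        (pois s (node (stopTop n s v f X (i + 1) (q / 2)).1
          (stopTop n s v f X (i + 1) (q / 2)).2) i q ^ 2 * mass v i q) else 0)
      ≤ X ^ 2 * (8 * tsq n s f) := by
  set top := stopTop n s v f X with htop
  set ω : ℕ × ℕ → ℕ × ℕ → ℝ := fun S p => absAvg s f S ^ 2 *
    (pois s (node S.1 S.2) p.1 p.2 ^ 2 * mass v p.1 p.2) with hω
  set Ψ : ℕ → ℕ → ℝ := fun k j => ∑ p ∈ stopChildren n s v f X k j, ω (top k j) p with hΨ
  set A : ℕ → ℕ → ℝ := fun i j =>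
    if IsStop n s v f X i j then absAvg s f (i, j) ^ 2 * mass s i j else 0 with hA
  have hΨstop : ∀ k ≤ n, ∀ j, IsStop n s v f X k j → Ψ k j ≤ X ^ 2 * A k j := by
    intro k hk j hst
    have e : top k j = (k, j) := hst
    simp only [hΨ, hA, hω, e, if_pos hst]
    rw [← Finset.mul_sum]
    have := h.piv k j (stopChildren n s v f X k j)
      (fun p hp => node_subset_of_mem_stopChildren hp)
      (fun p hp p' hp' hne => disjoint_of_mem_stopChildren hp hp' hne)
    calc _ ≤ absAvg s f (k, j) ^ 2 * (X ^ 2 * mass s k j) := by gcongr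
      _ = _ := by ring
  have hstep : ∀ k < n, ∀ j, ∀ q, q / 2 = j →
      (if IsStop n s v f X k q then ω (top (k + 1) (q / 2)) (k, q) else 0) + Ψ k q
      ≤ (if IsStop n s v f X k q then ω (top (k + 1) j) (k, q)
          else ∑ p ∈ stopChildren n s v f X k q, ω (top (k + 1) j) p) + X ^ 2 * A k q := by
    intro k hk j q hq
    rw [hq]
    split_ifs with hst
    · have := hΨstop k hk.le q hst
      linarith
    · simp only [hΨ, hA, if_neg hst, htop, stopTop_of_not_isStop hk hst, hq]
      linarith
  have hsum : ∀ k ≤ n, ∑ i ∈ Finset.range k, ∑ q ∈ Finset.range (2 ^ (n - i)),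
      (if IsStop n s v f X i q then ω (top (i + 1) (q / 2)) (i, q) else 0)
      ≤ ∑ j ∈ Finset.range (2 ^ (n - k)), Ψ k j
        + X ^ 2 * ∑ i ∈ Finset.range k, ∑ q ∈ Finset.range (2 ^ (n - i)), A i q := by
    intro k
    induction k with
    | zero => intro _; simp [hΨ, stopChildren]
    | succ k ih =>
      intro hk
      rw [Finset.sum_range_succ, Finset.sum_range_succ]
      have h1 := ih (by omega)
      have h2 : ∑ q ∈ Finset.range (2 ^ (n - k)),
          (if IsStop n s v f X k q then ω (top (k + 1) (q / 2)) (k, q) else 0)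
          + ∑ q ∈ Finset.range (2 ^ (n - k)), Ψ k q
          ≤ ∑ j ∈ Finset.range (2 ^ (n - (k + 1))), Ψ (k + 1) j
            + X ^ 2 * ∑ q ∈ Finset.range (2 ^ (n - k)), A k q := by
        rw [← Finset.sum_add_distrib, sum_range_pow_children _ (show k < n by omega),
          sum_range_pow_children (A k) (show k < n by omega), Finset.mul_sum,
          ← Finset.sum_add_distrib]
        refine Finset.sum_le_sum fun j _ => ?_
        have e := sum_stopChildren_succ (n := n) (s := s) (v := v) (f := f) (X := X)
          (ω (top (k + 1) j)) k j
        have e1 := hstep k hk j (2 * j) (by omega)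
        have e2 := hstep k hk j (2 * j + 1) (by omega)
        simp only [hΨ] at e1 e2 ⊢
        rw [e]
        linarith
      linarith
  refine (hsum n le_rfl).trans ?_
  have h1 := sum_absAvg_sq_le (n := n) (f := f) h
  have h2 : ∑ j ∈ Finset.range (2 ^ (n - n)), Ψ n j
      ≤ X ^ 2 * ∑ j ∈ Finset.range (2 ^ (n - n)), A n j := by
    rw [Finset.mul_sum]
    exact Finset.sum_le_sum fun j _ => hΨstop n le_rfl j (isStop_root j)
  rw [Finset.sum_range_succ] at h1
  have h3 := mul_le_mul_of_nonneg_left h1 (sq_nonneg X)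
  rw [mul_add] at h3
  linarith

end Stop

/-! ### Pairs of nodes of different generations -/

/-- The sum of the martingale differences from the generation `k` upwards. On non-null nodes of
height `k` it is the average of the whole sum. -/
noncomputable def partialSum (n : ℕ) (d : ℕ → ℕ → ℝ) (k l : ℕ) : ℝ := ∑ i ∈ Finset.Ico k n, d i l

section

variable {n r : ℕ} {s v : ℕ → ℝ} {B : ℕ → ℕ → ℝ} {X : ℝ} {d e : ℕ → ℕ → ℝ}

theorem partialSum_of_le {k : ℕ} (hk : n ≤ k) (l : ℕ) : partialSum n d k l = 0 := by
  simp [partialSum, Finset.Ico_eq_empty_of_le hk]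

theorem partialSum_succ {k : ℕ} (hk : k < n) (l : ℕ) :
    partialSum n d k l = d k l + partialSum n d (k + 1) l := by
  rw [partialSum, Finset.sum_eq_sum_Ico_succ_bot hk, partialSum]

theorem partialSum_const (hd : MartDiff s d) {k l l' : ℕ} (h : l / 2 ^ k = l' / 2 ^ k) :
    partialSum n d k l = partialSum n d k l' :=
  Finset.sum_congr rfl fun i hi => hd.const i _ _ (div_pow_eq_of_le (Finset.mem_Ico.1 hi).1 h)

theorem sum_node_eq_zero (hd : MartDiff s d) {i k : ℕ} (hik : i < k) (j : ℕ) :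
    ∑ l ∈ node k j, d i l * s l = 0 := by
  obtain ⟨t, rfl⟩ := Nat.exists_eq_add_of_le (Nat.succ_le_of_lt hik)
  rw [sum_node_add]
  exact Finset.sum_eq_zero fun j _ => hd.mean i j

/-- The partial sums are controlled by the average over the stopping node. -/
theorem abs_partialSum_le (h : Ctrl s v B X) (hd : MartDiff s d) : ∀ k ≤ n, ∀ l,
    |partialSum n d k l| ≤ 4 * absAvg s (fun l => ∑ i ∈ Finset.range n, d i l)
      (stopTop n s v (fun l => ∑ i ∈ Finset.range n, d i l) X k (l / 2 ^ k)) := by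
  set f : ℕ → ℝ := fun l => ∑ i ∈ Finset.range n, d i l with hf
  refine down_induction (fun l => ?_) fun k hk ih l => ?_
  · rw [partialSum_of_le le_rfl, abs_zero]
    have := absAvg_nonneg (f := f) h.s_nonneg (stopTop n s v f X n (l / 2 ^ n))
    positivity
  set j := l / 2 ^ k with hj
  have ih' := ih l
  rw [div_pow_succ, ← hj] at ih'
  rcases (mass_nonneg h.s_nonneg k j).eq_or_lt with h0 | h0
  · have hns : ¬ IsStop n s v f X k j := by
      rw [isStop_iff hk]
      exact fun hc => h0.not_lt hc.1
    rw [partialSum_succ hk, hd.null k l h0.symm, zero_add, stopTop_of_not_isStop hk hns]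
    exact ih'
  · have hsum : ∑ m ∈ node k j, f m * s m = partialSum n d k l * mass s k j := by
      have : ∀ m ∈ node k j, f m * s m
          = ∑ i ∈ Finset.range k, d i m * s m + partialSum n d k l * s m := by
        intro m hm
        rw [partialSum_const hd (show l / 2 ^ k = m / 2 ^ k by rw [mem_node.1 hm]), ← Finset.sum_mul,
          ← add_mul, partialSum, Finset.sum_range_add_sum_Ico _ hk.le]
      rw [Finset.sum_congr rfl this, Finset.sum_add_distrib, Finset.sum_comm,
        Finset.sum_eq_zero fun i hi => sum_node_eq_zero hd (Finset.mem_range.1 hi) j, zero_add,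
        mass, Finset.mul_sum]
    have habs : |partialSum n d k l| * mass s k j ≤ absInt s f k j := by
      rw [← abs_of_pos h0, ← abs_mul, ← hsum]
      refine (Finset.abs_sum_le_sum_abs _ _).trans (le_of_eq ?_)
      exact Finset.sum_congr rfl fun m _ => by rw [abs_mul, abs_of_nonneg (h.s_nonneg m)]
    by_cases hst : IsStop n s v f X k j
    · rw [show stopTop n s v f X k j = (k, j) from hst]
      have h1 : |partialSum n d k l| ≤ absAvg s f (k, j) := by
        rw [absAvg, le_div_iff₀ h0]; exact habs
      have := absAvg_nonneg (f := f) h.s_nonneg (k, j)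
      linarith
    · rw [stopTop_of_not_isStop hk hst]
      rw [isStop_iff hk] at hst
      have h1 : absInt s f k j
          ≤ 4 * absAvg s f (stopTop n s v f X (k + 1) (j / 2)) * mass s k j := by
        by_contra hc
        exact hst ⟨h0, Or.inl (not_le.1 hc)⟩
      exact le_of_mul_le_mul_right (habs.trans h1) h0

/-- The decay gained from goodness, when a good function with mean zero on nodes of height `k + 1`
is paired with a leaf outside an ancestor. -/
theorem Ctrl.good_le (h : Ctrl s v B X) (he : MartDiff v e) {k t q l : ℕ}
    (hgood : ∀ l, e k l ≠ 0 → Good r (n - (k + 1)) (l / 2 ^ (k + 1))) (hrt : r ≤ t)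
    (htn : k + 1 + t ≤ n) (hl : l / 2 ^ (k + 1 + t) ≠ q) :
    |∑ m ∈ node (k + 1 + t) q, B l m * e k m|
      ≤ 4 * (8 / 9 : ℝ) ^ t * (s l *
        (2 ^ (k + 1 + t) / (2 ^ (k + 1 + t) + (gap l (k + 1 + t) q : ℝ)) ^ 2))
        * ∑ m ∈ node (k + 1 + t) q, |e k m| * v m := by
  refine (h.abs_sum_node_le (G := 4 * (8 / 9 : ℝ) ^ t *
        (2 ^ (k + 1 + t) / (2 ^ (k + 1 + t) + (gap l (k + 1 + t) q : ℝ)) ^ 2)) ?_).trans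
    (le_of_eq (by ring))
  intro j hj
  by_cases hz : ∀ m ∈ node (k + 1) j, e k m = 0
  · exact Or.inl hz
  right
  push Not at hz
  obtain ⟨m, hm, hm0⟩ := hz
  have hg := hgood m hm0
  rw [mem_node.1 hm] at hg
  have h1 := hg.le_gap hrt (show t ≤ n - (k + 1) by omega) (l := l) (k := k + 1)
    (by rw [mem_node.1 hj]; exact hl)
  have h2 := gap_ancestor_le l (k + 1) t j
  rw [mem_node.1 hj] at h2
  have h2' : (gap l (k + 1 + t) q : ℝ) ≤ gap l (k + 1) j := by exact_mod_cast h2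
  have h3 : (0 : ℝ) < (3 / 2 : ℝ) ^ t * 2 ^ (k + 1) := by positivity
  have hg0 : (0 : ℝ) < gap l (k + 1) j := h3.trans_le h1
  refine ⟨by exact_mod_cast hg0, he.mean k j, ?_⟩
  set g : ℝ := (gap l (k + 1) j : ℝ)
  set G : ℝ := (gap l (k + 1 + t) q : ℝ)
  have hG0 : 0 ≤ G := Nat.cast_nonneg _
  have h4 : (2 : ℝ) ^ (k + 1 + t) ≤ (4 / 3 : ℝ) ^ t * g := by
    calc (2 : ℝ) ^ (k + 1 + t) = (4 / 3 : ℝ) ^ t * ((3 / 2 : ℝ) ^ t * 2 ^ (k + 1)) := by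
          rw [← mul_assoc, ← mul_pow, pow_add, mul_comm]; norm_num
      _ ≤ _ := by gcongr
  have h5 : (1 : ℝ) ≤ (4 / 3 : ℝ) ^ t := one_le_pow₀ (by norm_num)
  have h6 : (2 : ℝ) ^ (k + 1 + t) + G ≤ 2 * (4 / 3 : ℝ) ^ t * g := by nlinarith
  have h7 : (0 : ℝ) < 2 ^ (k + 1 + t) + G := by positivity
  rw [← mul_div_assoc, div_le_div_iff₀ (by positivity) (by positivity)]
  calc (2 : ℝ) ^ (k + 1) * (2 ^ (k + 1 + t) + G) ^ 2
      ≤ 2 ^ (k + 1) * (2 * (4 / 3 : ℝ) ^ t * g) ^ 2 := by gcongr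
    _ = 4 * (8 / 9 : ℝ) ^ t * 2 ^ (k + 1 + t) * g ^ 2 := by
        have : ((4 / 3 : ℝ) ^ t) ^ 2 = (8 / 9) ^ t * 2 ^ t := by
          rw [← pow_mul, mul_comm t 2, pow_mul, ← mul_pow]; norm_num
        rw [mul_pow, mul_pow, this, pow_add]; ring

/-- Disjoint nodes, one much smaller than the other. -/
theorem Ctrl.longRange_le (h : Ctrl s v B X) (he : MartDiff v e) {k t : ℕ}
    (hgood : ∀ l, e k l ≠ 0 → Good r (n - (k + 1)) (l / 2 ^ (k + 1))) (hrt : r ≤ t)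
    (htn : k + 1 + t ≤ n) (φ : ℕ → ℝ) :
    |∑ l ∈ Finset.range (2 ^ n), ∑ m ∈ Finset.range (2 ^ n),
        if l / 2 ^ (k + 1 + t) ≠ m / 2 ^ (k + 1 + t) then B l m * φ l * e k m else 0|
      ≤ 32 * (8 / 9 : ℝ) ^ t * X * √(tsq n s φ) * √(tsq n v (e k)) := by
  refine (h.offdiag_le (c := 16 * (8 / 9 : ℝ) ^ t) htn φ (e k) (fun p q => p ≠ q) (by positivity)
    ?_).trans (le_of_eq (by ring))
  intro l _ q _ hlq
  refine (h.good_le he hgood hrt htn hlq).trans ?_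
  set i := k + 1 + t
  set D := |((l / 2 ^ i : ℕ) : ℝ) - q| with hD
  have hD1 : 1 ≤ D := by
    rcases lt_or_gt_of_ne hlq with h' | h'
    · have : ((l / 2 ^ i : ℕ) : ℝ) + 1 ≤ q := by exact_mod_cast h'
      exact le_trans (by linarith) (neg_le_abs _)
    · have : (q : ℝ) + 1 ≤ ((l / 2 ^ i : ℕ) : ℝ) := by exact_mod_cast h'
      exact le_trans (by linarith) (le_abs_self _)
  have hg := abs_sub_mul_le_gap l i q hlq
  rw [← hD] at hg
  have hp : (0 : ℝ) < 2 ^ i := by positivity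
  have h1 : (1 + D) * 2 ^ i ≤ 2 * (2 ^ i + (gap l i q : ℝ)) := by nlinarith
  have h2 : (2 : ℝ) ^ i / (2 ^ i + (gap l i q : ℝ)) ^ 2 ≤ 4 * (1 / (2 ^ i * (1 + D) ^ 2)) := by
    rw [← mul_div_assoc, mul_one, div_le_div_iff₀ (by positivity) (by positivity)]
    calc (2 : ℝ) ^ i * (2 ^ i * (1 + D) ^ 2) = ((1 + D) * 2 ^ i) ^ 2 := by ring
      _ ≤ (2 * (2 ^ i + (gap l i q : ℝ))) ^ 2 := by gcongr
      _ = _ := by ring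
  have hE : 0 ≤ ∑ m ∈ node i q, |e k m| * v m :=
    Finset.sum_nonneg fun m _ => mul_nonneg (abs_nonneg _) (h.v_nonneg m)
  have := h.s_nonneg l
  calc _ ≤ 4 * (8 / 9 : ℝ) ^ t * (s l * (4 * (1 / (2 ^ i * (1 + D) ^ 2))))
        * ∑ m ∈ node i q, |e k m| * v m := by gcongr
    _ = _ := by ring

/-- The decay gained from goodness, summed over the leaves outside a node. -/
theorem Ctrl.good_sdiff_le (h : Ctrl s v B X) (he : MartDiff v e) {k t : ℕ}
    (hgood : ∀ l, e k l ≠ 0 → Good r (n - (k + 1)) (l / 2 ^ (k + 1))) (hrt : r ≤ t)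
    (htn : k + 1 + t ≤ n) (S : Finset ℕ) (q : ℕ) :
    |∑ m ∈ node (k + 1 + t) q, e k m * ∑ l ∈ S \ node (k + 1 + t) q, B l m|
      ≤ 4 * (8 / 9 : ℝ) ^ t * (pois s S (k + 1 + t) q * √(mass v (k + 1 + t) q)
        * √(nsq v (e k) (k + 1 + t) q)) := by
  set i := k + 1 + t
  set E := ∑ m ∈ node i q, |e k m| * v m with hE
  have hE0 : 0 ≤ E := Finset.sum_nonneg fun m _ => mul_nonneg (abs_nonneg _) (h.v_nonneg m)
  have hE1 : E ≤ √(mass v i q) * √(nsq v (e k) i q) := sum_abs_mul_le _ _ _ h.v_nonneg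
  have e1 : ∑ m ∈ node i q, e k m * ∑ l ∈ S \ node i q, B l m
      = ∑ l ∈ S \ node i q, ∑ m ∈ node i q, B l m * e k m := by
    simp_rw [Finset.mul_sum]
    rw [Finset.sum_comm]
    exact Finset.sum_congr rfl fun l _ => Finset.sum_congr rfl fun m _ => mul_comm _ _
  rw [e1]
  calc _ ≤ ∑ l ∈ S \ node i q, 4 * (8 / 9 : ℝ) ^ t * (s l *
        (2 ^ i / (2 ^ i + (gap l i q : ℝ)) ^ 2)) * E := by
        refine (Finset.abs_sum_le_sum_abs _ _).trans (Finset.sum_le_sum fun l hl => ?_)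
        rw [Finset.mem_sdiff, mem_node] at hl
        exact h.good_le he hgood hrt htn hl.2
    _ = 4 * (8 / 9 : ℝ) ^ t * pois s (S \ node i q) i q * E := by
        rw [← Finset.sum_mul, ← Finset.mul_sum, pois]
    _ ≤ 4 * (8 / 9 : ℝ) ^ t * pois s S i q * (√(mass v i q) * √(nsq v (e k) i q)) := by
        have := pois_nonneg h.s_nonneg S i q
        have := pois_mono h.s_nonneg (Finset.sdiff_subset (s := S) (t := node i q)) i q
        gcongr
    _ = _ := by ring

/-- A sum over the leaves is a sum over nodes, for a function that has a factor constant on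
nodes and a factor that depends on the node. -/
theorem sum_range_eq_sum_node {i : ℕ} (hi : i ≤ n) {c : ℕ → ℝ}
    (hc : ∀ m m', m / 2 ^ i = m' / 2 ^ i → c m = c m') (g : ℕ → ℝ) (V : ℕ → ℕ → ℝ) :
    ∑ m ∈ Finset.range (2 ^ n), g m * (c m * V (m / 2 ^ i) m)
      = ∑ q ∈ Finset.range (2 ^ (n - i)), c (q * 2 ^ i) * ∑ m ∈ node i q, g m * V q m := by
  rw [sum_range_node _ hi]
  refine Finset.sum_congr rfl fun q _ => ?_
  rw [Finset.mul_sum]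
  refine Finset.sum_congr rfl fun m hm => ?_
  rw [hc m (q * 2 ^ i) (by rw [mem_node.1 hm, div_rep]), mem_node.1 hm]
  ring

theorem sum_sqrt_nsq_le {i : ℕ} (hi : i ≤ n) {s v : ℕ → ℝ} (hs : ∀ l, 0 ≤ s l)
    (hv : ∀ l, 0 ≤ v l) (φ ψ : ℕ → ℝ) :
    ∑ q ∈ Finset.range (2 ^ (n - i)), √(nsq s φ i q) * √(nsq v ψ i q)
      ≤ √(tsq n s φ) * √(tsq n v ψ) := by
  rw [tsq_eq_sum_nsq hi, tsq_eq_sum_nsq hi]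
  exact Real.sum_sqrt_mul_sqrt_le _ (fun q => nsq_nonneg hs _ _ _) fun q => nsq_nonneg hv _ _ _

variable {f : ℕ → ℝ}

/-- The integral of the kernel over the stopping node above the node of height `i`
that contains `m`. -/
noncomputable def stopKer (n : ℕ) (s v f : ℕ → ℝ) (X : ℝ) (B : ℕ → ℕ → ℝ) (i m : ℕ) : ℝ :=
  ∑ l ∈ node (stopTop n s v f X i (m / 2 ^ i)).1 (stopTop n s v f X i (m / 2 ^ i)).2, B l m

theorem abs_mul_sqrt_mass {φ : ℕ → ℝ} {i : ℕ} (hφ : ∀ m m', m / 2 ^ i = m' / 2 ^ i → φ m = φ m')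
    (q : ℕ) : |φ (q * 2 ^ i)| * √(mass s i q) = √(nsq s φ i q) := by
  have : nsq s φ i q = φ (q * 2 ^ i) ^ 2 * mass s i q := by
    rw [nsq, mass, Finset.mul_sum]
    refine Finset.sum_congr rfl fun l hl => ?_
    rw [hφ l (q * 2 ^ i) (by rw [mem_node.1 hl, div_rep])]
  rw [this, Real.sqrt_mul (sq_nonneg _), Real.sqrt_sq_eq_abs]

/-- The stopping form. -/
theorem Ctrl.stopping_le (h : Ctrl s v B X) (hd : MartDiff s d) (he : MartDiff v e) {k t : ℕ}
    (hgood : ∀ l, e k l ≠ 0 → Good r (n - (k + 1)) (l / 2 ^ (k + 1))) (hrt : r ≤ t)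
    (htn : k + 1 + t < n) :
    |∑ m ∈ Finset.range (2 ^ n), e k m * (d (k + 1 + t) m *
        (stopKer n s v f X B (k + 1 + t) m
          - ∑ l ∈ node (k + 1 + t) (m / 2 ^ (k + 1 + t)), B l m))|
      ≤ 8 * (8 / 9 : ℝ) ^ t * X * √(tsq n s (d (k + 1 + t))) * √(tsq n v (e k)) := by
  set i := k + 1 + t with hi
  have e1 := sum_range_eq_sum_node (n := n) htn.le (hd.const i) (e k)
    (fun q m => ∑ l ∈ node (stopTop n s v f X i q).1 (stopTop n s v f X i q).2, B l m
      - ∑ l ∈ node i q, B l m)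
  unfold stopKer
  rw [e1]
  have hX := h.X_pos
  calc _ ≤ ∑ q ∈ Finset.range (2 ^ (n - i)), 8 * (8 / 9 : ℝ) ^ t * X *
        (√(nsq s (d i) i q) * √(nsq v (e k) i q)) := by
        refine (Finset.abs_sum_le_sum_abs _ _).trans (Finset.sum_le_sum fun q _ => ?_)
        set S := node (stopTop n s v f X i q).1 (stopTop n s v f X i q).2 with hS
        have hsub : node i q ⊆ S := node_subset_stopTop i htn.le q
        have e2 : ∀ m, ∑ l ∈ S, B l m - ∑ l ∈ node i q, B l m = ∑ l ∈ S \ node i q, B l m :=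
          fun m => by rw [← Finset.sum_sdiff hsub]; ring
        simp_rw [e2]
        rw [abs_mul]
        by_cases hst : IsStop n s v f X i q
        · have : S = node i q := by rw [hS, show stopTop n s v f X i q = (i, q) from hst]
          rw [this, Finset.sdiff_self]
          simp only [Finset.sum_empty, mul_zero, Finset.sum_const_zero, abs_zero]
          positivity
        rcases (mass_nonneg h.s_nonneg i q).eq_or_lt with h0 | h0
        · rw [hd.null i (q * 2 ^ i) (by rw [div_rep]; exact h0.symm), abs_zero, zero_mul]
          positivity
        have h1 := h.good_sdiff_le he hgood hrt htn.le S q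
        have h2 : pois s S i q * √(mass v i q) ≤ 2 * X * √(mass s i q) := by
          have h3 : pois s S i q ^ 2 * mass v i q ≤ 4 * X ^ 2 * mass s i q := by
            by_contra hc
            refine hst ((isStop_iff htn q).2 ⟨h0, Or.inr ?_⟩)
            rw [← stopTop_of_not_isStop htn hst]
            exact not_le.1 hc
          refine le_of_sq_le_sq ?_ (by positivity)
          rw [mul_pow, mul_pow, Real.sq_sqrt (mass_nonneg h.v_nonneg _ _), Real.sq_sqrt h0.le]
          linarith
        calc _ ≤ |d i (q * 2 ^ i)| * (4 * (8 / 9 : ℝ) ^ t *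
              ((2 * X * √(mass s i q)) * √(nsq v (e k) i q))) := by
              refine mul_le_mul_of_nonneg_left (h1.trans ?_) (abs_nonneg _)
              gcongr
          _ = 8 * (8 / 9 : ℝ) ^ t * X * ((|d i (q * 2 ^ i)| * √(mass s i q))
              * √(nsq v (e k) i q)) := by ring
          _ = _ := by rw [abs_mul_sqrt_mass (hd.const i)]
    _ ≤ 8 * (8 / 9 : ℝ) ^ t * X * (√(tsq n s (d i)) * √(tsq n v (e k))) := by
        rw [← Finset.mul_sum]
        refine mul_le_mul_of_nonneg_left ?_ (by positivity)
        exact sum_sqrt_nsq_le htn.le h.s_nonneg h.v_nonneg _ _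
    _ = _ := by ring

open Classical in
/-- The pivotal quantities of the stopping nodes of height `i`, with the averages of `|f|` over
their stopping parents. -/
noncomputable def pivotalSum (n : ℕ) (s v f : ℕ → ℝ) (X : ℝ) (i : ℕ) : ℝ :=
  ∑ q ∈ Finset.range (2 ^ (n - i)),
    if IsStop n s v f X i q then absAvg s f (stopTop n s v f X (i + 1) (q / 2)) ^ 2 *
      (pois s (node (stopTop n s v f X (i + 1) (q / 2)).1
        (stopTop n s v f X (i + 1) (q / 2)).2) i q ^ 2 * mass v i q) else 0

theorem pivotalSum_nonneg (h : Ctrl s v B X) (i : ℕ) : 0 ≤ pivotalSum n s v f X i := by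
  refine Finset.sum_nonneg fun q _ => ?_
  split_ifs
  · have := mass_nonneg h.v_nonneg i q
    positivity
  · exact le_rfl

/-- The part of the paraproduct that comes from the changes of the stopping node. -/
theorem Ctrl.jump_le (h : Ctrl s v B X) (hd : MartDiff s d) (he : MartDiff v e) {k t : ℕ}
    (hgood : ∀ l, e k l ≠ 0 → Good r (n - (k + 1)) (l / 2 ^ (k + 1))) (hrt : r ≤ t)
    (htn : k + 1 + t < n) (hf : f = fun l => ∑ i ∈ Finset.range n, d i l) :
    |∑ m ∈ Finset.range (2 ^ n), e k m * (partialSum n d (k + 1 + t + 1) m *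
        (stopKer n s v f X B (k + 1 + t) m - stopKer n s v f X B (k + 1 + t + 1) m))|
      ≤ 16 * (8 / 9 : ℝ) ^ t * √(pivotalSum n s v f X (k + 1 + t)) * √(tsq n v (e k)) := by
  classical
  set i := k + 1 + t with hi
  have e1 := sum_range_eq_sum_node (n := n) (c := partialSum n d (i + 1)) htn.le
    (fun m m' hmm => partialSum_const hd (div_pow_eq_of_le (Nat.le_succ i) hmm)) (e k)
    (fun q m => ∑ l ∈ node (stopTop n s v f X i q).1 (stopTop n s v f X i q).2, B l m
      - ∑ l ∈ node (stopTop n s v f X (i + 1) (q / 2)).1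
        (stopTop n s v f X (i + 1) (q / 2)).2, B l m)
  unfold stopKer
  simp_rw [div_pow_succ _ i]
  rw [e1]
  set w : ℕ → ℝ := fun q =>
    if IsStop n s v f X i q then absAvg s f (stopTop n s v f X (i + 1) (q / 2)) ^ 2 *
      (pois s (node (stopTop n s v f X (i + 1) (q / 2)).1
        (stopTop n s v f X (i + 1) (q / 2)).2) i q ^ 2 * mass v i q) else 0 with hw
  have hw0 : ∀ q, 0 ≤ w q := fun q => by
    have := mass_nonneg h.v_nonneg i q
    simp only [hw]; split_ifs <;> positivity
  calc _ ≤ ∑ q ∈ Finset.range (2 ^ (n - i)), 16 * (8 / 9 : ℝ) ^ t *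
        (√(w q) * √(nsq v (e k) i q)) := by
        refine (Finset.abs_sum_le_sum_abs _ _).trans (Finset.sum_le_sum fun q _ => ?_)
        by_cases hst : IsStop n s v f X i q
        swap
        · rw [stopTop_of_not_isStop htn hst]
          simp only [sub_self, mul_zero, Finset.sum_const_zero, abs_zero]
          positivity
        rw [show stopTop n s v f X i q = (i, q) from hst]
        set P := stopTop n s v f X (i + 1) (q / 2) with hP
        set S := node P.1 P.2 with hS
        have hsub : node i q ⊆ S :=
          (node_subset_parent i q).trans (node_subset_stopTop (i + 1) htn (q / 2))
        have e2 : ∀ m, ∑ l ∈ node i q, B l m - ∑ l ∈ S, B l m = - ∑ l ∈ S \ node i q, B l m :=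
          fun m => by rw [← Finset.sum_sdiff hsub]; ring
        simp_rw [e2, mul_neg]
        rw [Finset.sum_neg_distrib, mul_neg, abs_neg, abs_mul]
        have h1 := h.good_sdiff_le he hgood hrt htn.le S q
        have h2 : |partialSum n d (i + 1) (q * 2 ^ i)| ≤ 4 * absAvg s f P := by
          have := abs_partialSum_le (n := n) h hd (i + 1) htn (q * 2 ^ i)
          rwa [← hf, div_pow_succ, div_rep] at this
        have hα := absAvg_nonneg (f := f) h.s_nonneg P
        have hp := pois_nonneg h.s_nonneg S i q
        have h3 : √(w q) = absAvg s f P * (pois s S i q * √(mass v i q)) := by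
          simp only [hw, if_pos hst]
          rw [Real.sqrt_mul (sq_nonneg _), Real.sqrt_mul (sq_nonneg _), Real.sqrt_sq hα,
            Real.sqrt_sq hp]
        rw [h3]
        calc _ ≤ (4 * absAvg s f P) * (4 * (8 / 9 : ℝ) ^ t * (pois s S i q * √(mass v i q)
              * √(nsq v (e k) i q))) := by
              refine mul_le_mul h2 h1 (abs_nonneg _) (by positivity)
          _ = _ := by ring
    _ ≤ 16 * (8 / 9 : ℝ) ^ t * (√(pivotalSum n s v f X i) * √(tsq n v (e k))) := by
        rw [← Finset.mul_sum, tsq_eq_sum_nsq htn.le]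
        refine mul_le_mul_of_nonneg_left ?_ (by positivity)
        exact Real.sum_sqrt_mul_sqrt_le _ hw0 fun q => nsq_nonneg h.v_nonneg _ _ _
    _ = _ := by ring

/-- The main part of the paraproduct: on each stopping node the testing inequality applies, and the
stopping nodes are summed by the Carleson embedding theorem. -/
theorem Ctrl.paraproduct_le (h : Ctrl s v B X) (hd : MartDiff s d) (he : MartDiff v e)
    (hf : f = fun l => ∑ i ∈ Finset.range n, d i l) :
    |∑ k ∈ Finset.range n, ∑ m ∈ Finset.range (2 ^ n), e k m *
        (partialSum n d (k + 1 + r) m * stopKer n s v f X B (k + 1 + r) m)|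
      ≤ 12 * X * √(tsq n s f) * √(∑ k ∈ Finset.range n, tsq n v (e k)) := by
  classical
  set N : Finset ((_ : ℕ) × ℕ) :=
    (Finset.range (n + 1)).sigma fun i => Finset.range (2 ^ (n - i)) with hN
  set tp : ℕ → ℕ → ℕ × ℕ := fun k m => stopTop n s v f X (k + 1 + r) (m / 2 ^ (k + 1 + r)) with htp
  set ψ : (_ : ℕ) × ℕ → ℕ → ℕ → ℝ := fun p k m =>
    if tp k m = (p.1, p.2) then e k m * partialSum n d (k + 1 + r) m else 0 with hψ
  set A : (_ : ℕ) × ℕ → ℝ := fun p =>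
    if IsStop n s v f X p.1 p.2 then absAvg s f (p.1, p.2) ^ 2 * mass s p.1 p.2 else 0 with hA
  set E : (_ : ℕ) × ℕ → ℝ := fun p => ∑ k ∈ Finset.range n, ∑ m ∈ Finset.range (2 ^ n),
    if tp k m = (p.1, p.2) then e k m ^ 2 * v m else 0 with hE
  have hX := h.X_pos
  have hA0 : ∀ p, 0 ≤ A p := fun p => by
    have := mass_nonneg h.s_nonneg p.1 p.2
    simp only [hA]; split_ifs <;> positivity
  have hE0 : ∀ p, 0 ≤ E p := fun p => Finset.sum_nonneg fun k _ => Finset.sum_nonneg fun m _ => by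
    have := h.v_nonneg m
    split_ifs <;> positivity
  have hmemN : ∀ k m, k + 1 + r ≤ n → m < 2 ^ n →
      (⟨(tp k m).1, (tp k m).2⟩ : (_ : ℕ) × ℕ) ∈ N ∧ m ∈ node (tp k m).1 (tp k m).2 := by
    intro k m hk hm
    have h1 : m ∈ node (tp k m).1 (tp k m).2 :=
      node_subset_stopTop (k + 1 + r) hk _ (mem_node.2 rfl)
    have h2 : (tp k m).1 ≤ n := stopTop_fst_le (k + 1 + r) hk _
    refine ⟨?_, h1⟩
    rw [hN, Finset.mem_sigma, Finset.mem_range, Finset.mem_range]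
    refine ⟨by simp only; omega, ?_⟩
    simp only
    rw [← mem_node.1 h1]
    exact div_lt_of_lt h2 hm
  -- Group the leaves according to the stopping node above them.
  have e1 : ∑ k ∈ Finset.range n, ∑ m ∈ Finset.range (2 ^ n), e k m *
        (partialSum n d (k + 1 + r) m * stopKer n s v f X B (k + 1 + r) m)
      = ∑ p ∈ N, ∑ m ∈ node p.1 p.2, (∑ l ∈ node p.1 p.2, B l m) *
        ∑ k ∈ Finset.range n, ψ p k m := by
    have e2 : ∀ k ∈ Finset.range n, ∀ m ∈ Finset.range (2 ^ n), e k m *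
        (partialSum n d (k + 1 + r) m * stopKer n s v f X B (k + 1 + r) m)
        = ∑ p ∈ N, (∑ l ∈ node p.1 p.2, B l m) * ψ p k m := by
      intro k _ m hm
      by_cases hk : k + 1 + r ≤ n
      · rw [Finset.sum_eq_single_of_mem _ (hmemN k m hk (Finset.mem_range.1 hm)).1]
        · simp only [hψ, if_true]
          rw [show stopKer n s v f X B (k + 1 + r) m
            = ∑ l ∈ node (tp k m).1 (tp k m).2, B l m from rfl]
          ring
        · intro p _ hp
          simp only [hψ]
          rw [if_neg, mul_zero]
          intro h'
          exact hp (by rw [h'])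
      · have h0 : partialSum n d (k + 1 + r) m = 0 := partialSum_of_le (by omega) m
        simp [hψ, h0]
    rw [Finset.sum_congr rfl fun k hk => Finset.sum_congr rfl (e2 k hk)]
    have e3 : ∀ p ∈ N, ∑ m ∈ node p.1 p.2, (∑ l ∈ node p.1 p.2, B l m) *
        ∑ k ∈ Finset.range n, ψ p k m = ∑ k ∈ Finset.range n, ∑ m ∈ Finset.range (2 ^ n),
          (∑ l ∈ node p.1 p.2, B l m) * ψ p k m := by
      intro p hp
      rw [hN, Finset.mem_sigma, Finset.mem_range, Finset.mem_range] at hp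
      simp_rw [Finset.mul_sum]
      rw [Finset.sum_comm]
      refine Finset.sum_congr rfl fun k _ => ?_
      refine Finset.sum_subset (fun m hm =>
        Finset.mem_range.2 (lt_of_mem_node (by omega) hp.2 hm)) fun m hm hm' => ?_
      have : ψ p k m = 0 := by
        by_cases hk : k + 1 + r ≤ n
        · simp only [hψ]
          rw [if_neg]
          intro h'
          have := (hmemN k m hk (Finset.mem_range.1 hm)).2
          rw [h'] at this
          exact hm' this
        · simp [hψ, partialSum_of_le (n := n) (d := d) (show n ≤ k + 1 + r by omega) m]
      rw [this, mul_zero]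
    rw [Finset.sum_congr rfl e3, Finset.sum_comm]
    conv_rhs => rw [Finset.sum_comm]
    simp_rw [Finset.sum_comm (s := N)]
    rw [Finset.sum_comm]
  rw [e1]
  have hterm : ∀ p ∈ N, |∑ m ∈ node p.1 p.2, (∑ l ∈ node p.1 p.2, B l m) *
      ∑ k ∈ Finset.range n, ψ p k m| ≤ 4 * X * (√(A p) * √(E p)) := by
    intro p hp
    rw [hN, Finset.mem_sigma, Finset.mem_range, Finset.mem_range] at hp
    by_cases hst : IsStop n s v f X p.1 p.2
    swap
    · have : ∀ k m, ψ p k m = 0 := by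
        intro k m
        by_cases hk : k + 1 + r ≤ n
        · simp only [hψ]
          rw [if_neg]
          intro h'
          have := isStop_stopTop (n := n) (s := s) (v := v) (f := f) (X := X) (k + 1 + r) hk
            (m / 2 ^ (k + 1 + r))
          rw [show stopTop n s v f X (k + 1 + r) (m / 2 ^ (k + 1 + r)) = (p.1, p.2) from h'] at this
          exact hst this
        · simp [hψ, partialSum_of_le (n := n) (d := d) (show n ≤ k + 1 + r by omega) m]
      simp only [this, Finset.sum_const_zero, mul_zero, abs_zero]
      positivity
    have hα := absAvg_nonneg (f := f) h.s_nonneg (p.1, p.2)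
    refine (h.test p.1 p.2 fun m => ∑ k ∈ Finset.range n, ψ p k m).trans ?_
    have h1 : nsq v (fun m => ∑ k ∈ Finset.range n, ψ p k m) p.1 p.2
        ≤ (4 * absAvg s f (p.1, p.2)) ^ 2 * E p := by
      have hc : ∀ k m m', m / 2 ^ k = m' / 2 ^ k → ψ p k m = ψ p k m' := by
        intro k m m' hmm
        have hmm' : m / 2 ^ (k + 1 + r) = m' / 2 ^ (k + 1 + r) :=
          div_pow_eq_of_le (by omega) hmm
        simp only [hψ, htp, hmm', he.const k m m' hmm, partialSum_const hd hmm']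
      have hm : ∀ k < n, ∀ j, ∑ m ∈ node (k + 1) j, ψ p k m * v m = 0 := by
        intro k _ j
        have : ∀ m ∈ node (k + 1) j, ψ p k m * v m =
            (if tp k (j * 2 ^ (k + 1)) = (p.1, p.2) then
              partialSum n d (k + 1 + r) (j * 2 ^ (k + 1)) else 0) * (e k m * v m) := by
          intro m hm
          have hmm' : m / 2 ^ (k + 1 + r) = j * 2 ^ (k + 1) / 2 ^ (k + 1 + r) :=
            div_pow_eq_of_le (show k + 1 ≤ k + 1 + r by omega) (by rw [mem_node.1 hm, div_rep])
          simp only [hψ, htp, hmm', partialSum_const hd hmm']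
          split_ifs <;> ring
        rw [Finset.sum_congr rfl this, ← Finset.mul_sum, he.mean, mul_zero]
      calc nsq v (fun m => ∑ k ∈ Finset.range n, ψ p k m) p.1 p.2
          ≤ tsq n v (fun m => ∑ k ∈ Finset.range n, ψ p k m) :=
            Finset.sum_le_sum_of_subset_of_nonneg (fun m hm =>
              Finset.mem_range.2 (lt_of_mem_node (by omega) hp.2 hm))
              fun m _ _ => mul_nonneg (sq_nonneg _) (h.v_nonneg m)
        _ = ∑ k ∈ Finset.range n, tsq n v (ψ p k) := tsq_sum_eq hc hm le_rfl
        _ ≤ (4 * absAvg s f (p.1, p.2)) ^ 2 * E p := by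
            rw [hE, Finset.mul_sum]
            refine Finset.sum_le_sum fun k _ => ?_
            rw [tsq, Finset.mul_sum]
            refine Finset.sum_le_sum fun m _ => ?_
            simp only [hψ]
            split_ifs with htop
            · by_cases hk : k + 1 + r ≤ n
              · have h2 := abs_partialSum_le (n := n) h hd (k + 1 + r) hk m
                rw [← hf, show stopTop n s v f X (k + 1 + r) (m / 2 ^ (k + 1 + r)) = (p.1, p.2)
                  from htop] at h2
                have h3 : partialSum n d (k + 1 + r) m ^ 2 ≤ (4 * absAvg s f (p.1, p.2)) ^ 2 := by
                  rw [← sq_abs]; gcongr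
                have := mul_nonneg (sq_nonneg (e k m)) (h.v_nonneg m)
                calc (e k m * partialSum n d (k + 1 + r) m) ^ 2 * v m
                    = partialSum n d (k + 1 + r) m ^ 2 * (e k m ^ 2 * v m) := by ring
                  _ ≤ _ := by gcongr
              · rw [partialSum_of_le (by omega)]
                have := h.v_nonneg m
                simp only [mul_zero, ne_eq, OfNat.ofNat_ne_zero, not_false_eq_true, zero_pow,
                  zero_mul]
                positivity
            · simp
    have h2 : √(nsq v (fun m => ∑ k ∈ Finset.range n, ψ p k m) p.1 p.2)
        ≤ 4 * absAvg s f (p.1, p.2) * √(E p) := by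
      refine (Real.sqrt_le_sqrt h1).trans (le_of_eq ?_)
      rw [Real.sqrt_mul (sq_nonneg _), Real.sqrt_sq (by positivity)]
    have h3 : √(A p) = absAvg s f (p.1, p.2) * √(mass s p.1 p.2) := by
      simp only [hA, if_pos hst]
      rw [Real.sqrt_mul (sq_nonneg _), Real.sqrt_sq hα]
    rw [h3]
    calc _ ≤ X * √(mass s p.1 p.2) * (4 * absAvg s f (p.1, p.2) * √(E p)) := by gcongr
      _ = _ := by ring
  refine (Finset.abs_sum_le_sum_abs _ _).trans ((Finset.sum_le_sum hterm).trans ?_)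
  rw [← Finset.mul_sum]
  have h4 := Real.sum_sqrt_mul_sqrt_le N hA0 hE0
  have h5 : ∑ p ∈ N, A p ≤ 3 ^ 2 * tsq n s f := by
    rw [hN, Finset.sum_sigma]
    refine (sum_absAvg_sq_le (n := n) (f := f) h).trans ?_
    have := tsq_nonneg h.s_nonneg n f
    linarith
  have h6 : ∑ p ∈ N, E p ≤ ∑ k ∈ Finset.range n, tsq n v (e k) := by
    rw [hE, Finset.sum_comm]
    refine Finset.sum_le_sum fun k _ => ?_
    rw [Finset.sum_comm]
    refine Finset.sum_le_sum fun m _ => ?_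
    have hv := mul_nonneg (sq_nonneg (e k m)) (h.v_nonneg m)
    by_cases hmem : (⟨(tp k m).1, (tp k m).2⟩ : (_ : ℕ) × ℕ) ∈ N
    · rw [Finset.sum_eq_single_of_mem _ hmem]
      · simp
      · intro p _ hp
        rw [if_neg]
        intro h'
        exact hp (by rw [h'])
    · rw [Finset.sum_eq_zero]
      · exact hv
      · intro p hp
        rw [if_neg]
        intro h'
        exact hmem (by rw [h']; exact hp)
  calc 4 * X * ∑ p ∈ N, √(A p) * √(E p)
      ≤ 4 * X * (√(3 ^ 2 * tsq n s f) * √(∑ k ∈ Finset.range n, tsq n v (e k))) := by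
        refine mul_le_mul_of_nonneg_left (h4.trans ?_) (by positivity)
        gcongr
    _ = _ := by
        rw [Real.sqrt_mul (by positivity), Real.sqrt_sq (by norm_num)]; ring

end

/-! ### The form on good functions -/

/-- The bilinear form with the matrix `B` on functions on the first `2 ^ n` leaves. -/
def form (n : ℕ) (B : ℕ → ℕ → ℝ) (φ ψ : ℕ → ℝ) : ℝ :=
  ∑ l ∈ Finset.range (2 ^ n), ∑ m ∈ Finset.range (2 ^ n), B l m * φ l * ψ m

theorem form_add_left (n : ℕ) (B : ℕ → ℕ → ℝ) (φ φ' ψ : ℕ → ℝ) :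
    form n B (fun l => φ l + φ' l) ψ = form n B φ ψ + form n B φ' ψ := by
  simp only [form, ← Finset.sum_add_distrib, mul_add, add_mul]

theorem form_add_right (n : ℕ) (B : ℕ → ℕ → ℝ) (φ ψ ψ' : ℕ → ℝ) :
    form n B φ (fun l => ψ l + ψ' l) = form n B φ ψ + form n B φ ψ' := by
  simp only [form, ← Finset.sum_add_distrib, mul_add]

theorem form_swap (n : ℕ) (B : ℕ → ℕ → ℝ) (φ ψ : ℕ → ℝ) :
    form n B φ ψ = form n (fun l m => B m l) ψ φ := by
  rw [form, form, Finset.sum_comm]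
  exact Finset.sum_congr rfl fun _ _ => Finset.sum_congr rfl fun _ _ => by ring

theorem form_sum (n : ℕ) (B : ℕ → ℕ → ℝ) (d e : ℕ → ℕ → ℝ) (K : Finset ℕ) :
    form n B (fun l => ∑ i ∈ K, d i l) (fun m => ∑ k ∈ K, e k m)
      = ∑ i ∈ K, ∑ k ∈ K, form n B (d i) (e k) := by
  have h : ∀ l m, B l m * (∑ i ∈ K, d i l) * (∑ k ∈ K, e k m)
      = ∑ i ∈ K, ∑ k ∈ K, B l m * d i l * e k m := fun l m => by
    rw [mul_assoc, Finset.sum_mul_sum, Finset.mul_sum]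
    refine Finset.sum_congr rfl fun i _ => ?_
    rw [Finset.mul_sum]
    exact Finset.sum_congr rfl fun k _ => (mul_assoc _ _ _).symm
  simp only [form, h]
  rw [Finset.sum_congr rfl fun l _ => Finset.sum_comm, Finset.sum_comm]
  refine Finset.sum_congr rfl fun i _ => ?_
  rw [Finset.sum_congr rfl fun l _ => Finset.sum_comm, Finset.sum_comm]

theorem sum_Ico_telescope (g : ℕ → ℝ) {a b : ℕ} (h : a ≤ b) :
    ∑ i ∈ Finset.Ico a b, (g i - g (i + 1)) = g a - g b := by
  induction b, h using Nat.le_induction with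
  | base => simp
  | succ b hb ih => rw [Finset.sum_Ico_succ_top hb, ih]; ring

section

variable {n r : ℕ} {s v : ℕ → ℝ} {B : ℕ → ℕ → ℝ} {X : ℝ} {d e : ℕ → ℕ → ℝ}

/-- The decomposition of the contribution of the nodes that contain the smaller one into
paraproduct and stopping form. -/
theorem sum_mul_node_eq (f : ℕ → ℝ) {a : ℕ} (han : a ≤ n) (m : ℕ) :
    ∑ i ∈ Finset.Ico a n, d i m * ∑ l ∈ node i (m / 2 ^ i), B l m
      = partialSum n d a m * stopKer n s v f X B a m
        - ∑ i ∈ Finset.Ico a n, partialSum n d (i + 1) m *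
          (stopKer n s v f X B i m - stopKer n s v f X B (i + 1) m)
        - ∑ i ∈ Finset.Ico a n, d i m *
          (stopKer n s v f X B i m - ∑ l ∈ node i (m / 2 ^ i), B l m) := by
  have h1 := sum_Ico_telescope (fun i => partialSum n d i m * stopKer n s v f X B i m) han
  simp only [partialSum_of_le le_rfl, zero_mul, sub_zero] at h1
  rw [← h1, ← Finset.sum_sub_distrib, ← Finset.sum_sub_distrib]
  refine Finset.sum_congr rfl fun i hi => ?_
  rw [partialSum_succ (Finset.mem_Ico.1 hi).2]
  ring

/-- The part of the form where the node of the second function is much smaller. -/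
theorem Ctrl.below_le (h : Ctrl s v B X) (hd : MartDiff s d) (he : MartDiff v e)
    (hgood : ∀ k < n, ∀ l, e k l ≠ 0 → Good r (n - (k + 1)) (l / 2 ^ (k + 1))) :
    |∑ k ∈ Finset.range n, ∑ i ∈ Finset.Ico (k + 1 + r) n, form n B (d i) (e k)|
      ≤ 1000 * X * √(∑ i ∈ Finset.range n, tsq n s (d i))
        * √(∑ k ∈ Finset.range n, tsq n v (e k)) := by
  set f : ℕ → ℝ := fun l => ∑ i ∈ Finset.range n, d i l with hf
  set D := √(∑ i ∈ Finset.range n, tsq n s (d i)) with hD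
  set E := √(∑ k ∈ Finset.range n, tsq n v (e k)) with hE
  have hX := h.X_pos
  have hDf : √(tsq n s f) = D := by rw [hD, hf, hd.tsq_eq n]
  set U := stopKer n s v f X B with hU
  set LR : ℕ → ℕ → ℝ := fun i k => ∑ l ∈ Finset.range (2 ^ n), ∑ m ∈ Finset.range (2 ^ n),
    if l / 2 ^ i ≠ m / 2 ^ i then B l m * d i l * e k m else 0 with hLR
  set ST : ℕ → ℕ → ℝ := fun i k => ∑ m ∈ Finset.range (2 ^ n), e k m * (d i m *
    (U i m - ∑ l ∈ node i (m / 2 ^ i), B l m)) with hST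
  set JP : ℕ → ℕ → ℝ := fun i k => ∑ m ∈ Finset.range (2 ^ n), e k m * (partialSum n d (i + 1) m *
    (U i m - U (i + 1) m)) with hJP
  set PP : ℕ → ℝ := fun k => ∑ m ∈ Finset.range (2 ^ n), e k m *
    (partialSum n d (k + 1 + r) m * U (k + 1 + r) m) with hPP
  have hdiag : ∀ i < n, ∀ k, form n B (d i) (e k) = LR i k + ∑ m ∈ Finset.range (2 ^ n),
      e k m * (d i m * ∑ l ∈ node i (m / 2 ^ i), B l m) := by
    intro i hi k
    have h1 : ∀ m ∈ Finset.range (2 ^ n), e k m * (d i m * ∑ l ∈ node i (m / 2 ^ i), B l m)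
        = ∑ l ∈ Finset.range (2 ^ n),
          if l / 2 ^ i = m / 2 ^ i then B l m * d i l * e k m else 0 := by
      intro m hm
      have hsub : node i (m / 2 ^ i) ⊆ Finset.range (2 ^ n) := fun l hl => Finset.mem_range.2
        (lt_of_mem_node hi.le (div_lt_of_lt hi.le (Finset.mem_range.1 hm)) hl)
      rw [Finset.mul_sum, Finset.mul_sum, ← Finset.sum_subset hsub]
      · refine Finset.sum_congr rfl fun l hl => ?_
        rw [if_pos (mem_node.1 hl), hd.const i l m (mem_node.1 hl)]; ring
      · intro l _ hl
        rw [if_neg fun h' => hl (mem_node.2 h')]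
    rw [Finset.sum_congr rfl h1, Finset.sum_comm, hLR, form, ← Finset.sum_add_distrib]
    refine Finset.sum_congr rfl fun l _ => ?_
    rw [← Finset.sum_add_distrib]
    refine Finset.sum_congr rfl fun m _ => ?_
    by_cases hlm : l / 2 ^ i = m / 2 ^ i <;> simp [hlm]
  have hk : ∀ k ∈ Finset.range n, ∑ i ∈ Finset.Ico (k + 1 + r) n, form n B (d i) (e k)
      = ∑ i ∈ Finset.Ico (k + 1 + r) n, (LR i k - JP i k - ST i k) + PP k := by
    intro k _
    by_cases hkn : k + 1 + r ≤ n
    · have h1 : ∑ i ∈ Finset.Ico (k + 1 + r) n, form n B (d i) (e k)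
          = ∑ i ∈ Finset.Ico (k + 1 + r) n, LR i k + ∑ m ∈ Finset.range (2 ^ n),
            e k m * ∑ i ∈ Finset.Ico (k + 1 + r) n,
              d i m * ∑ l ∈ node i (m / 2 ^ i), B l m := by
        rw [Finset.sum_congr rfl fun i hi => hdiag i (Finset.mem_Ico.1 hi).2 k,
          Finset.sum_add_distrib]
        congr 1
        rw [Finset.sum_comm]
        exact Finset.sum_congr rfl fun m _ => (Finset.mul_sum _ _ _).symm
      have h2 : ∀ a : ℕ → ℕ → ℝ, ∑ m ∈ Finset.range (2 ^ n),
          e k m * ∑ i ∈ Finset.Ico (k + 1 + r) n, a i m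
          = ∑ i ∈ Finset.Ico (k + 1 + r) n, ∑ m ∈ Finset.range (2 ^ n), e k m * a i m := by
        intro a
        rw [Finset.sum_comm]
        exact Finset.sum_congr rfl fun m _ => Finset.mul_sum _ _ _
      rw [h1]
      simp_rw [sum_mul_node_eq (s := s) (v := v) (X := X) f hkn, mul_sub]
      rw [Finset.sum_sub_distrib, Finset.sum_sub_distrib, Finset.sum_sub_distrib,
        Finset.sum_sub_distrib]
      simp_rw [← mul_sub]
      rw [h2, h2]
      simp only [hPP, hJP, hST, hU]
      ring
    · rw [Finset.Ico_eq_empty_of_le (by omega)]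
      simp [hPP, partialSum_of_le (n := n) (d := d) (show n ≤ k + 1 + r by omega)]
  rw [Finset.sum_congr rfl hk, Finset.sum_add_distrib]
  have hpp : |∑ k ∈ Finset.range n, PP k| ≤ 12 * X * D * E := by
    rw [← hDf]; exact h.paraproduct_le hd he hf
  set x : ℕ → ℝ := fun i => √(tsq n s (d i)) with hx
  set y : ℕ → ℝ := fun k => √(tsq n v (e k)) with hy
  set z : ℕ → ℝ := fun i => √(pivotalSum n s v f X i) with hz
  have hterm : ∀ k ∈ Finset.range n, ∀ i ∈ Finset.Ico (k + 1 + r) n,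
      |LR i k - JP i k - ST i k| ≤ (8 / 9 : ℝ) ^ (i - k - 1) * ((40 * X * x i + 16 * z i) * y k) := by
    intro k hk' i hi
    rw [Finset.mem_Ico] at hi
    obtain ⟨t, rfl⟩ := Nat.exists_eq_add_of_le (show k + 1 ≤ i by omega)
    have hrt : r ≤ t := by omega
    have hg := hgood k (Finset.mem_range.1 hk')
    have h1 := h.longRange_le he hg hrt hi.2.le (d (k + 1 + t))
    have h2 := h.jump_le hd he hg hrt hi.2 hf
    have h3 := h.stopping_le (f := f) hd he hg hrt hi.2
    rw [show k + 1 + t - k - 1 = t by omega]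
    have h4 := abs_sub (LR (k + 1 + t) k - JP (k + 1 + t) k) (ST (k + 1 + t) k)
    have h5 := abs_sub (LR (k + 1 + t) k) (JP (k + 1 + t) k)
    have : (8 / 9 : ℝ) ^ t * ((40 * X * x (k + 1 + t) + 16 * z (k + 1 + t)) * y k)
        = 32 * (8 / 9 : ℝ) ^ t * X * x (k + 1 + t) * y k
          + 16 * (8 / 9 : ℝ) ^ t * z (k + 1 + t) * y k
          + 8 * (8 / 9 : ℝ) ^ t * X * x (k + 1 + t) * y k := by ring
    rw [this]
    linarith
  have hmain : |∑ k ∈ Finset.range n, ∑ i ∈ Finset.Ico (k + 1 + r) n,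
      (LR i k - JP i k - ST i k)| ≤ 40 * X * (9 * (D * E)) + 16 * (9 * ((3 * X * D) * E)) := by
    have hyy : ∑ k ∈ Finset.range n, y k ^ 2 = ∑ k ∈ Finset.range n, tsq n v (e k) :=
      Finset.sum_congr rfl fun k _ => Real.sq_sqrt (tsq_nonneg h.v_nonneg _ _)
    have hxx : ∑ k ∈ Finset.range n, x k ^ 2 = ∑ k ∈ Finset.range n, tsq n s (d k) :=
      Finset.sum_congr rfl fun k _ => Real.sq_sqrt (tsq_nonneg h.s_nonneg _ _)
    have hzz : √(∑ k ∈ Finset.range n, z k ^ 2) ≤ 3 * X * D := by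
      rw [← hDf, Real.sqrt_le_left (by positivity)]
      have h1 : ∑ k ∈ Finset.range n, z k ^ 2
          = ∑ k ∈ Finset.range n, pivotalSum n s v f X k :=
        Finset.sum_congr rfl fun k _ => Real.sq_sqrt (pivotalSum_nonneg h _)
      have h2 : ∑ k ∈ Finset.range n, pivotalSum n s v f X k ≤ X ^ 2 * (8 * tsq n s f) :=
        sum_pivotal_le h
      have h3 := tsq_nonneg h.s_nonneg n f
      rw [h1, mul_pow, Real.sq_sqrt h3]
      nlinarith [mul_nonneg (sq_nonneg X) h3]
    calc _ ≤ ∑ k ∈ Finset.range n, ∑ i ∈ Finset.Ico (k + 1 + r) n,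
          (8 / 9 : ℝ) ^ (i - k - 1) * ((40 * X * x i + 16 * z i) * y k) := by
          refine (Finset.abs_sum_le_sum_abs _ _).trans (Finset.sum_le_sum fun k hk' => ?_)
          exact (Finset.abs_sum_le_sum_abs _ _).trans (Finset.sum_le_sum (hterm k hk'))
      _ = 40 * X * ∑ k ∈ Finset.range n, ∑ i ∈ Finset.Ico (k + 1 + r) n,
          (8 / 9 : ℝ) ^ (i - k - 1) * (x i * y k)
          + 16 * ∑ k ∈ Finset.range n, ∑ i ∈ Finset.Ico (k + 1 + r) n,
          (8 / 9 : ℝ) ^ (i - k - 1) * (z i * y k) := by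
          simp_rw [Finset.mul_sum, ← Finset.sum_add_distrib]
          refine Finset.sum_congr rfl fun k _ => Finset.sum_congr rfl fun i _ => ?_
          ring
      _ ≤ _ := by
          have h1 := sum_geom_schur n r x y
          have h2 := sum_geom_schur n r z y
          rw [hxx, hyy] at h1
          rw [hyy] at h2
          refine add_le_add ?_ ?_
          · gcongr
          · refine mul_le_mul_of_nonneg_left (h2.trans ?_) (by norm_num)
            gcongr
  refine (abs_add_le _ _).trans ((add_le_add hmain hpp).trans ?_)
  have : 0 ≤ X * D * E := by positivity
  nlinarith

/-- The form on good functions. -/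
theorem Ctrl.form_good_le (h : Ctrl s v B X) (h' : Ctrl v s (fun l m => B m l) X)
    (hd : MartDiff s d) (he : MartDiff v e)
    (hgd : ∀ k < n, ∀ l, d k l ≠ 0 → Good r (n - (k + 1)) (l / 2 ^ (k + 1)))
    (hge : ∀ k < n, ∀ l, e k l ≠ 0 → Good r (n - (k + 1)) (l / 2 ^ (k + 1))) :
    |form n B (fun l => ∑ i ∈ Finset.range n, d i l) (fun m => ∑ k ∈ Finset.range n, e k m)|
      ≤ (2000 + (2 * r + 1) * (√(3 * 2 ^ (r + 1)) * √(3 * 2 ^ 1) + 18)) * X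
        * √(∑ i ∈ Finset.range n, tsq n s (d i)) * √(∑ k ∈ Finset.range n, tsq n v (e k)) := by
  set D := √(∑ i ∈ Finset.range n, tsq n s (d i)) with hD
  set E := √(∑ k ∈ Finset.range n, tsq n v (e k)) with hE
  set c : ℝ := √(3 * 2 ^ (r + 1)) * √(3 * 2 ^ 1) + 18 with hc
  have hX := h.X_pos
  have h1 := h.below_le hd he hge
  have h2 := h'.below_le he hd hgd
  have h2' : ∑ i ∈ Finset.range n, ∑ k ∈ Finset.Ico (i + 1 + r) n,
      form n (fun l m => B m l) (e k) (d i)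
      = ∑ i ∈ Finset.range n, ∑ k ∈ Finset.Ico (i + 1 + r) n, form n B (d i) (e k) :=
    Finset.sum_congr rfl fun i _ => Finset.sum_congr rfl fun k _ => (form_swap n B _ _).symm
  rw [h2'] at h2
  set cl : ℕ × ℕ → ℝ := fun p => if p.1 ≤ p.2 + r ∧ p.2 ≤ p.1 + r then 1 else 0 with hcl
  have hcl0 : ∀ p, 0 ≤ cl p := fun p => by simp only [hcl]; split_ifs <;> norm_num
  have hcount : ∀ i, ∑ k ∈ Finset.range n, cl (i, k) ≤ 2 * r + 1 := by
    intro i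
    simp only [hcl]
    rw [← Finset.sum_filter, Finset.sum_const, nsmul_eq_mul, mul_one]
    have : (Finset.range n).filter (fun k => i ≤ k + r ∧ k ≤ i + r)
        ⊆ Finset.Ico (i - r) (i + r + 1) := by
      intro k hk
      simp only [Finset.mem_filter, Finset.mem_Ico] at hk ⊢
      omega
    have h3 := Finset.card_le_card this
    rw [Nat.card_Ico] at h3
    have h4 : ((Finset.range n).filter (fun k => i ≤ k + r ∧ k ≤ i + r)).card ≤ 2 * r + 1 := by
      omega
    exact_mod_cast h4
  have hsymm : ∀ i k, cl (i, k) = cl (k, i) := fun i k => by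
    simp only [hcl]; exact if_congr and_comm rfl rfl
  have h3 : |∑ i ∈ Finset.range n, ∑ k ∈ Finset.range n, cl (i, k) * form n B (d i) (e k)|
      ≤ (2 * r + 1) * c * X * D * E := by
    have hmono : ∀ a ≤ r + 1, √(3 * 2 ^ a) * √(3 * 2 ^ 1) + 18 ≤ c := by
      intro a ha
      simp only [hc]
      gcongr
      norm_num
    have hterm : ∀ p ∈ Finset.range n ×ˢ Finset.range n, |cl p * form n B (d p.1) (e p.2)|
        ≤ c * X * (cl p * (√(tsq n s (d p.1)) * √(tsq n v (e p.2)))) := by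
      rintro ⟨i, k⟩ hp
      rw [Finset.mem_product, Finset.mem_range, Finset.mem_range] at hp
      simp only at hp ⊢
      by_cases hcase : i ≤ k + r ∧ k ≤ i + r
      · have : cl (i, k) = 1 := if_pos hcase
        rw [this, one_mul, one_mul]
        rcases le_total k i with hki | hki
        · refine (h.comparable_le hd he hp.1 hki).trans ?_
          have := hmono (i + 1 - k) (by omega)
          rw [mul_assoc]
          gcongr
        · rw [form_swap]
          refine (h'.comparable_le he hd hp.2 hki).trans ?_
          have := hmono (k + 1 - i) (by omega)
          rw [mul_assoc, mul_comm √(tsq n v (e k))]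
          gcongr
      · have : cl (i, k) = 0 := if_neg hcase
        rw [this]; simp
    rw [← Finset.sum_product (f := fun p : ℕ × ℕ => cl p * form n B (d p.1) (e p.2))]
    refine (Finset.abs_sum_le_sum_abs _ _).trans ((Finset.sum_le_sum hterm).trans ?_)
    rw [← Finset.mul_sum]
    have h4 := sum_mul_mul_le (Finset.range n ×ˢ Finset.range n)
      (fun p => √(tsq n s (d p.1))) (fun p => √(tsq n v (e p.2))) cl hcl0
    simp only [Real.sq_sqrt (tsq_nonneg h.s_nonneg _ _),
      Real.sq_sqrt (tsq_nonneg h.v_nonneg _ _)] at h4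
    have h5 : ∑ p ∈ Finset.range n ×ˢ Finset.range n, cl p * tsq n s (d p.1)
        ≤ (2 * r + 1) * ∑ i ∈ Finset.range n, tsq n s (d i) := by
      rw [Finset.sum_product, Finset.mul_sum]
      refine Finset.sum_le_sum fun i _ => ?_
      dsimp only
      rw [← Finset.sum_mul]
      exact mul_le_mul_of_nonneg_right (hcount i) (tsq_nonneg h.s_nonneg _ _)
    have h6 : ∑ p ∈ Finset.range n ×ˢ Finset.range n, cl p * tsq n v (e p.2)
        ≤ (2 * r + 1) * ∑ i ∈ Finset.range n, tsq n v (e i) := by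
      rw [Finset.sum_product_right, Finset.mul_sum]
      refine Finset.sum_le_sum fun i _ => ?_
      dsimp only
      simp_rw [hsymm _ i]
      rw [← Finset.sum_mul]
      exact mul_le_mul_of_nonneg_right (hcount i) (tsq_nonneg h.v_nonneg _ _)
    calc _ ≤ c * X * (√((2 * r + 1) * ∑ i ∈ Finset.range n, tsq n s (d i))
          * √((2 * r + 1) * ∑ i ∈ Finset.range n, tsq n v (e i))) := by
          refine mul_le_mul_of_nonneg_left (h4.trans ?_) (by positivity)
          gcongr
      _ = c * X * ((√(2 * r + 1) * √(2 * r + 1)) * (D * E)) := by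
          rw [Real.sqrt_mul (by positivity), Real.sqrt_mul (by positivity)]; ring
      _ = _ := by rw [Real.mul_self_sqrt (by positivity)]; ring
  have hsplit : form n B (fun l => ∑ i ∈ Finset.range n, d i l) (fun m => ∑ k ∈ Finset.range n, e k m)
      = ∑ k ∈ Finset.range n, ∑ i ∈ Finset.Ico (k + 1 + r) n, form n B (d i) (e k)
      + ∑ i ∈ Finset.range n, ∑ k ∈ Finset.Ico (i + 1 + r) n, form n B (d i) (e k)
      + ∑ i ∈ Finset.range n, ∑ k ∈ Finset.range n, cl (i, k) * form n B (d i) (e k) := by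
    have hI : ∀ a : ℕ, ∀ φ : ℕ → ℝ, ∑ i ∈ Finset.Ico (a + 1 + r) n, φ i
        = ∑ i ∈ Finset.range n, if a + 1 + r ≤ i then φ i else 0 := by
      intro a φ
      rw [← Finset.sum_filter]
      refine Finset.sum_congr ?_ fun _ _ => rfl
      ext i
      simp only [Finset.mem_Ico, Finset.mem_filter, Finset.mem_range]
      omega
    simp_rw [hI]
    rw [form_sum, Finset.sum_comm (s := Finset.range n) (t := Finset.range n)
      (f := fun k i => if k + 1 + r ≤ i then form n B (d i) (e k) else 0),
      ← Finset.sum_add_distrib, ← Finset.sum_add_distrib]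
    refine Finset.sum_congr rfl fun i _ => ?_
    rw [← Finset.sum_add_distrib, ← Finset.sum_add_distrib]
    refine Finset.sum_congr rfl fun k _ => ?_
    simp only [hcl]
    split_ifs <;> first | omega | ring
  rw [hsplit]
  refine (abs_add_le _ _).trans ((add_le_add ((abs_add_le _ _).trans (add_le_add h1 h2)) h3).trans
    (le_of_eq ?_))
  ring

end

/-! ### Bad nodes -/

/-- The average of `φ` on a node; it is `0` on null nodes. -/
noncomputable def nodeAvg (s φ : ℕ → ℝ) (k j : ℕ) : ℝ :=
  (∑ l ∈ node k j, φ l * s l) / mass s k j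

open Classical in
/-- The martingale difference of `φ` between the generations `k` and `k + 1`, which is set to be `0`
on null nodes of height `k`. -/
noncomputable def mdiff (s φ : ℕ → ℝ) (k l : ℕ) : ℝ :=
  if mass s k (l / 2 ^ k) = 0 then 0
  else nodeAvg s φ k (l / 2 ^ k) - nodeAvg s φ (k + 1) (l / 2 ^ (k + 1))

open Classical in
/-- The part of the squared norm of `φ` that is carried by the bad nodes. -/
noncomputable def badSq (n r : ℕ) (s φ : ℕ → ℝ) : ℝ :=
  ∑ k ∈ Finset.range n, ∑ l ∈ Finset.range (2 ^ n),
    if Good r (n - (k + 1)) (l / 2 ^ (k + 1)) then 0 else mdiff s φ k l ^ 2 * s l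

section

variable {n r : ℕ} {s v φ : ℕ → ℝ} {B : ℕ → ℕ → ℝ} {X N : ℝ}

theorem sum_mul_eq_zero_of_mass (hs : ∀ l, 0 ≤ s l) {k j : ℕ} (h : mass s k j = 0) (φ : ℕ → ℝ) :
    ∑ l ∈ node k j, φ l * s l = 0 := by
  have := (Finset.sum_eq_zero_iff_of_nonneg fun l _ => hs l).1 h
  exact Finset.sum_eq_zero fun l hl => by rw [this l hl, mul_zero]

theorem nodeAvg_mul_mass (hs : ∀ l, 0 ≤ s l) (φ : ℕ → ℝ) (k j : ℕ) :
    nodeAvg s φ k j * mass s k j = ∑ l ∈ node k j, φ l * s l := by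
  by_cases h : mass s k j = 0
  · rw [h, mul_zero, sum_mul_eq_zero_of_mass hs h]
  · rw [nodeAvg, div_mul_cancel₀ _ h]

theorem martDiff_mdiff (hs : ∀ l, 0 ≤ s l) (φ : ℕ → ℝ) : MartDiff s (mdiff s φ) where
  const k l l' h := by
    unfold mdiff
    rw [h, div_pow_eq_of_le (Nat.le_succ k) h]
  null k l h := by unfold mdiff; rw [if_pos h]
  mean k j := by
    have key : ∀ q, q / 2 = j → ∑ l ∈ node k q, mdiff s φ k l * s l
        = ∑ l ∈ node k q, φ l * s l - nodeAvg s φ (k + 1) j * mass s k q := by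
      intro q hq
      by_cases h : mass s k q = 0
      · rw [sum_mul_eq_zero_of_mass hs h, sum_mul_eq_zero_of_mass hs h, h]; ring
      · have : ∀ l ∈ node k q, mdiff s φ k l * s l
            = (nodeAvg s φ k q - nodeAvg s φ (k + 1) j) * s l := by
          intro l hl
          unfold mdiff
          rw [div_pow_succ, mem_node.1 hl, if_neg h, hq]
        rw [Finset.sum_congr rfl this, ← Finset.mul_sum, ← nodeAvg_mul_mass hs]
        rw [mass]; ring
    rw [sum_node_succ, key _ (by omega), key _ (by omega)]
    have h1 := nodeAvg_mul_mass hs φ (k + 1) j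
    rw [mass_succ, sum_node_succ (fun l => φ l * s l)] at h1
    linarith

theorem MartDiff.mask {d : ℕ → ℕ → ℝ} (hd : MartDiff s d) (P : ℕ → ℕ → Prop)
    [∀ k j, Decidable (P k j)] :
    MartDiff s (fun k l => if P k (l / 2 ^ (k + 1)) then d k l else 0) where
  const k l l' h := by
    simp only [div_pow_eq_of_le (Nat.le_succ k) h, hd.const k l l' h]
  null k l h := by
    simp only [hd.null k l h, ite_self]
  mean k j := by
    have : ∀ l ∈ node (k + 1) j, (if P k (l / 2 ^ (k + 1)) then d k l else 0) * s l
        = (if P k j then 1 else 0) * (d k l * s l) := by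
      intro l hl
      rw [mem_node.1 hl]; split_ifs <;> ring
    rw [Finset.sum_congr rfl this, ← Finset.mul_sum, hd.mean, mul_zero]

/-- The telescoping sum of the martingale differences. A leaf of mass `0` has to be excluded, because
the averages on null nodes have the junk value `0`. -/
theorem eq_nodeAvg_add_sum (hs : ∀ l, 0 ≤ s l) {l : ℕ} (hl : s l ≠ 0) (n : ℕ) :
    φ l = nodeAvg s φ n (l / 2 ^ n) + ∑ k ∈ Finset.range n, mdiff s φ k l := by
  have hm : ∀ k, mass s k (l / 2 ^ k) ≠ 0 := fun k h =>
    hl ((Finset.sum_eq_zero_iff_of_nonneg fun l _ => hs l).1 h l (mem_node.2 rfl))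
  induction n with
  | zero => simp [nodeAvg, mass, node_zero, hl]
  | succ n ih =>
    rw [Finset.sum_range_succ, ih, mdiff, if_neg (hm n)]
    ring

/-- The squared norm is the sum of the squared norms of the mean and of the martingale differences. -/
theorem tsq_eq_add (hs : ∀ l, 0 ≤ s l) (n : ℕ) (φ : ℕ → ℝ) :
    tsq n s φ = nodeAvg s φ n 0 ^ 2 * mass s n 0 + ∑ k ∈ Finset.range n, tsq n s (mdiff s φ k) := by
  have hd := martDiff_mdiff hs φ
  rw [← hd.tsq_eq n]
  have hz : ∑ l ∈ Finset.range (2 ^ n), (∑ k ∈ Finset.range n, mdiff s φ k l) * s l = 0 := by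
    simp_rw [Finset.sum_mul]
    rw [Finset.sum_comm]
    refine Finset.sum_eq_zero fun k hk => ?_
    rw [range_eq_node]
    exact sum_node_eq_zero hd (Finset.mem_range.1 hk) 0
  have : ∀ l ∈ Finset.range (2 ^ n), φ l ^ 2 * s l
      = nodeAvg s φ n 0 ^ 2 * s l + (∑ k ∈ Finset.range n, mdiff s φ k l) ^ 2 * s l
        + 2 * nodeAvg s φ n 0 * ((∑ k ∈ Finset.range n, mdiff s φ k l) * s l) := by
    intro l hl
    by_cases h0 : s l = 0
    · simp [h0]
    · rw [eq_nodeAvg_add_sum (φ := φ) hs h0 n, Nat.div_eq_of_lt (Finset.mem_range.1 hl)]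
      ring
  rw [tsq, Finset.sum_congr rfl this, Finset.sum_add_distrib, Finset.sum_add_distrib,
    ← Finset.mul_sum, ← Finset.mul_sum, hz, mul_zero, add_zero, mass, range_eq_node, tsq,
    range_eq_node]

/-- Every function is the sum of its mean, a good part, a bad part and a null function. -/
theorem exists_good_decomposition (hs : ∀ l, 0 ≤ s l) (n r : ℕ) (φ : ℕ → ℝ) :
    ∃ (c : ℝ) (d : ℕ → ℕ → ℝ) (b u : ℕ → ℝ),
      (∀ l < 2 ^ n, φ l = c + ∑ k ∈ Finset.range n, d k l + b l + u l) ∧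
      c ^ 2 * mass s n 0 ≤ tsq n s φ ∧ MartDiff s d ∧
      (∀ k < n, ∀ l, d k l ≠ 0 → Good r (n - (k + 1)) (l / 2 ^ (k + 1))) ∧
      ∑ k ∈ Finset.range n, tsq n s (d k) ≤ tsq n s φ ∧ tsq n s b ≤ badSq n r s φ ∧
      tsq n s u = 0 := by
  classical
  have hd := martDiff_mdiff hs φ
  set dg : ℕ → ℕ → ℝ := fun k l =>
    if Good r (n - (k + 1)) (l / 2 ^ (k + 1)) then mdiff s φ k l else 0 with hdg
  set db : ℕ → ℕ → ℝ := fun k l =>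
    if ¬ Good r (n - (k + 1)) (l / 2 ^ (k + 1)) then mdiff s φ k l else 0 with hdb
  have hdg' : MartDiff s dg := hd.mask fun k j => Good r (n - (k + 1)) j
  have hdb' : MartDiff s db := hd.mask fun k j => ¬ Good r (n - (k + 1)) j
  have htsq := tsq_eq_add hs n φ
  have hm0 := mass_nonneg hs n 0
  refine ⟨nodeAvg s φ n 0, dg, fun l => ∑ k ∈ Finset.range n, db k l,
    fun l => if s l = 0 then φ l - (nodeAvg s φ n 0 + ∑ k ∈ Finset.range n, dg k l
      + ∑ k ∈ Finset.range n, db k l) else 0, ?_, ?_, hdg', ?_, ?_, ?_, ?_⟩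
  · intro l hl
    by_cases h0 : s l = 0
    · simp [h0]
    · simp only [h0, if_false, add_zero]
      have h1 := eq_nodeAvg_add_sum (φ := φ) hs h0 n
      rw [Nat.div_eq_of_lt hl] at h1
      rw [add_assoc, ← Finset.sum_add_distrib]
      refine h1.trans (congrArg _ (Finset.sum_congr rfl fun k _ => ?_))
      simp only [hdg, hdb]
      split_ifs <;> simp
  · have : 0 ≤ ∑ k ∈ Finset.range n, tsq n s (mdiff s φ k) :=
      Finset.sum_nonneg fun k _ => tsq_nonneg hs _ _
    linarith
  · intro k _ l hl
    by_contra hc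
    exact hl (if_neg hc)
  · have h1 : ∑ k ∈ Finset.range n, tsq n s (dg k) ≤ ∑ k ∈ Finset.range n, tsq n s (mdiff s φ k) :=
      Finset.sum_le_sum fun k _ => Finset.sum_le_sum fun l _ => by
        have := hs l
        simp only [hdg]
        split_ifs
        · exact le_rfl
        · have := mul_nonneg (sq_nonneg (mdiff s φ k l)) (hs l)
          simpa using this
    have : 0 ≤ nodeAvg s φ n 0 ^ 2 * mass s n 0 := by positivity
    linarith
  · rw [hdb'.tsq_eq n]
    refine le_of_eq (Finset.sum_congr rfl fun k _ => Finset.sum_congr rfl fun l _ => ?_)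
    simp only [hdb]
    split_ifs <;> simp_all
  · refine Finset.sum_eq_zero fun l _ => ?_
    by_cases h0 : s l = 0 <;> simp [h0]

theorem form_congr {B : ℕ → ℕ → ℝ} {φ φ' ψ ψ' : ℕ → ℝ} (h : ∀ l < 2 ^ n, φ l = φ' l)
    (h' : ∀ l < 2 ^ n, ψ l = ψ' l) : form n B φ ψ = form n B φ' ψ' :=
  Finset.sum_congr rfl fun l hl => Finset.sum_congr rfl fun m hm => by
    rw [h l (Finset.mem_range.1 hl), h' m (Finset.mem_range.1 hm)]

theorem Ctrl.form_const_le (h : Ctrl s v B X) (n : ℕ) (c : ℝ) (ψ : ℕ → ℝ) :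
    |form n B (fun _ => c) ψ| ≤ X * √(c ^ 2 * mass s n 0) * √(tsq n v ψ) := by
  have h1 := h.test n 0 ψ
  have e : form n B (fun _ => c) ψ = c * ∑ m ∈ node n 0, (∑ l ∈ node n 0, B l m) * ψ m := by
    rw [form, Finset.sum_comm, range_eq_node, Finset.mul_sum]
    refine Finset.sum_congr rfl fun m _ => ?_
    rw [Finset.sum_mul, Finset.mul_sum]
    exact Finset.sum_congr rfl fun l _ => by ring
  rw [e, abs_mul, Real.sqrt_mul (sq_nonneg _), Real.sqrt_sq_eq_abs]
  have e2 : tsq n v ψ = nsq v ψ n 0 := by rw [tsq, nsq, range_eq_node]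
  rw [e2]
  calc _ ≤ |c| * (X * √(mass s n 0) * √(nsq v ψ n 0)) := by gcongr
    _ = _ := by ring

/-- The form on arbitrary functions, up to an error from the bad nodes that is controlled by an
a-priori bound `N` of the form. -/
theorem Ctrl.form_le (h : Ctrl s v B X) (h' : Ctrl v s (fun l m => B m l) X) (hN0 : 0 ≤ N)
    (hN : ∀ φ ψ, |form n B φ ψ| ≤ N * √(tsq n s φ) * √(tsq n v ψ)) (f g : ℕ → ℝ) :
    |form n B f g| ≤
      (2002 + (2 * r + 1) * (√(3 * 2 ^ (r + 1)) * √(3 * 2 ^ 1) + 18)) * X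
          * √(tsq n s f) * √(tsq n v g)
        + N * (√(badSq n r s f) * √(tsq n v g) + √(tsq n s f) * √(badSq n r v g)) := by
  obtain ⟨c, d, b, u, hf, hc, hd, hgd, hdF, hb, hu⟩ :=
    exists_good_decomposition h.s_nonneg n r f
  obtain ⟨c', e, b', u', hg, hc', he, hge, heG, hb', hu'⟩ :=
    exists_good_decomposition h.v_nonneg n r g
  set F := tsq n s f
  set G := tsq n v g
  have hX := h.X_pos
  set fg : ℕ → ℝ := fun l => ∑ k ∈ Finset.range n, d k l with hfg
  set gg : ℕ → ℝ := fun l => ∑ k ∈ Finset.range n, e k l with hgg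
  have hfgF : tsq n s fg ≤ F := by rw [hfg, hd.tsq_eq n]; exact hdF
  have e1 : form n B f g = form n B (fun _ => c) g + form n B fg g + form n B b g
      + form n B u g := by
    rw [← form_add_left, ← form_add_left, ← form_add_left]
    exact form_congr hf fun _ _ => rfl
  have e2 : form n B fg g = form n B fg (fun _ => c') + form n B fg gg + form n B fg b'
      + form n B fg u' := by
    rw [← form_add_right, ← form_add_right, ← form_add_right]
    exact form_congr (fun _ _ => rfl) hg
  have b1 : |form n B (fun _ => c) g| ≤ X * √F * √G :=
    (h.form_const_le n c g).trans (by gcongr)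
  have b2 : |form n B fg (fun _ => c')| ≤ X * √F * √G := by
    rw [form_swap]
    refine (h'.form_const_le n c' fg).trans ?_
    calc _ ≤ X * √G * √F := by gcongr
      _ = _ := by ring
  have b3 : |form n B fg gg| ≤ (2000 + (2 * r + 1) * (√(3 * 2 ^ (r + 1)) * √(3 * 2 ^ 1) + 18)) * X
      * √F * √G := (h.form_good_le h' hd he hgd hge).trans (by gcongr)
  have b4 : |form n B b g| ≤ N * (√(badSq n r s f) * √G) := by
    refine (hN b g).trans ?_
    rw [mul_assoc]; gcongr
  have b5 : |form n B fg b'| ≤ N * (√F * √(badSq n r v g)) := by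
    refine (hN fg b').trans ?_
    rw [mul_assoc]; gcongr
  have b6 : form n B u g = 0 := by
    have := hN u g
    rw [hu, Real.sqrt_zero, mul_zero, zero_mul] at this
    exact abs_eq_zero.1 (le_antisymm this (abs_nonneg _))
  have b7 : form n B fg u' = 0 := by
    have := hN fg u'
    rw [hu', Real.sqrt_zero, mul_zero] at this
    exact abs_eq_zero.1 (le_antisymm this (abs_nonneg _))
  rw [e1, e2, b6, b7, add_zero, add_zero]
  have t1 := abs_add_le (form n B (fun _ => c) g + (form n B fg (fun _ => c') + form n B fg gg
    + form n B fg b')) (form n B b g)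
  have t2 := abs_add_le (form n B (fun _ => c) g) (form n B fg (fun _ => c') + form n B fg gg
    + form n B fg b')
  have t3 := abs_add_le (form n B fg (fun _ => c') + form n B fg gg) (form n B fg b')
  have t4 := abs_add_le (form n B fg (fun _ => c')) (form n B fg gg)
  linarith

end

/-! ### Bad nodes are rare -/

theorem sum_range_mod (φ : ℕ → ℝ) {t M : ℕ} (ht : t ≤ M) :
    ∑ j ∈ Finset.range (2 ^ M), φ (j % 2 ^ t)
      = 2 ^ (M - t) * ∑ j ∈ Finset.range (2 ^ t), φ j := by
  rw [sum_range_node _ ht]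
  have : ∀ q ∈ Finset.range (2 ^ (M - t)), ∑ l ∈ node t q, φ (l % 2 ^ t)
      = ∑ j ∈ Finset.range (2 ^ t), φ j := by
    intro q _
    rw [node, Finset.sum_Ico_eq_sum_range, add_mul, one_mul, Nat.add_sub_cancel_left]
    refine Finset.sum_congr rfl fun j hj => ?_
    rw [Nat.mul_add_mod_self_right, Nat.mod_eq_of_lt (Finset.mem_range.1 hj)]
  rw [Finset.sum_congr rfl this, Finset.sum_const, Finset.card_range, nsmul_eq_mul]
  push_cast
  rfl

theorem sum_range_lt_le (K : ℕ) {a : ℝ} (ha : 1 ≤ a) :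
    ∑ j ∈ Finset.range K, (if (j : ℝ) < a then (1 : ℝ) else 0) ≤ 2 * a := by
  rw [← Finset.sum_filter, Finset.sum_const, nsmul_eq_mul, mul_one]
  have : (Finset.range K).filter (fun j : ℕ => (j : ℝ) < a) ⊆ Finset.range (⌊a⌋₊ + 1) := by
    intro j hj
    rw [Finset.mem_filter] at hj
    rw [Finset.mem_range, Nat.lt_succ_iff]
    exact Nat.le_floor hj.2.le
  have h1 := Finset.card_le_card this
  rw [Finset.card_range] at h1
  have h2 : ((((Finset.range K).filter (fun j : ℕ => (j : ℝ) < a)).card : ℕ) : ℝ)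
      ≤ (⌊a⌋₊ : ℝ) + 1 := by exact_mod_cast h1
  have h3 := Nat.floor_le (show 0 ≤ a by linarith)
  linarith

open Classical in
/-- The proportion of bad positions: at the scale `2 ^ t` the positions within `(3 / 2) ^ t` of the
boundary have a proportion of the order of `(3 / 4) ^ t`, and the sum over `t ≥ r` is geometric. -/
theorem sum_not_good_le (r M : ℕ) :
    ∑ j ∈ Finset.range (2 ^ M), (if Good r M j then (0 : ℝ) else 1)
      ≤ 16 * (3 / 4 : ℝ) ^ r * 2 ^ M := by
  set χ : ℕ → ℕ → ℝ := fun t j => (if (j : ℝ) < (3 / 2 : ℝ) ^ t then (1 : ℝ) else 0)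
    + if ((2 ^ t - 1 - j : ℕ) : ℝ) < (3 / 2 : ℝ) ^ t then (1 : ℝ) else 0 with hχ
  have hχ0 : ∀ t j, 0 ≤ χ t j := fun t j => by
    simp only [hχ]; split_ifs <;> norm_num
  have h1 : ∀ j, (if Good r M j then (0 : ℝ) else 1)
      ≤ ∑ t ∈ Finset.Ico r (M + 1), χ t (j % 2 ^ t) := by
    intro j
    split_ifs with hg
    · exact Finset.sum_nonneg fun t _ => hχ0 _ _
    · unfold Good at hg
      push Not at hg
      obtain ⟨t, hrt, htM, ht⟩ := hg
      have hmem : t ∈ Finset.Ico r (M + 1) := Finset.mem_Ico.2 ⟨hrt, by omega⟩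
      refine le_trans ?_ (Finset.single_le_sum (f := fun t => χ t (j % 2 ^ t))
        (fun t _ => hχ0 _ _) hmem)
      simp only [hχ]
      by_cases hlt : ((j % 2 ^ t : ℕ) : ℝ) < (3 / 2 : ℝ) ^ t
      · rw [if_pos hlt]; split_ifs <;> norm_num
      · have h2 := ht (not_lt.1 hlt)
        have h3 : j % 2 ^ t < 2 ^ t := Nat.mod_lt _ (by positivity)
        have h4 : ((2 ^ t - 1 - j % 2 ^ t : ℕ) : ℝ) + 1 + ((j % 2 ^ t : ℕ) : ℝ) = 2 ^ t := by
          have : 2 ^ t - 1 - j % 2 ^ t + 1 + j % 2 ^ t = 2 ^ t := by omega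
          exact_mod_cast this
        rw [if_neg hlt, if_pos (by linarith)]; norm_num
  have h2 : ∀ t ∈ Finset.Ico r (M + 1), ∑ j ∈ Finset.range (2 ^ M), χ t (j % 2 ^ t)
      ≤ 4 * (3 / 4 : ℝ) ^ t * 2 ^ M := by
    intro t ht
    have htM : t ≤ M := by have := Finset.mem_Ico.1 ht; omega
    rw [sum_range_mod (χ t) htM]
    have ha : (1 : ℝ) ≤ (3 / 2 : ℝ) ^ t := one_le_pow₀ (by norm_num)
    have h3 := sum_range_lt_le (2 ^ t) ha
    have h4 : ∑ j ∈ Finset.range (2 ^ t), χ t j ≤ 4 * (3 / 2 : ℝ) ^ t := by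
      simp only [hχ]
      rw [Finset.sum_add_distrib,
        Finset.sum_range_reflect (fun j : ℕ => if (j : ℝ) < (3 / 2 : ℝ) ^ t then (1 : ℝ) else 0)]
      linarith
    calc (2 : ℝ) ^ (M - t) * ∑ j ∈ Finset.range (2 ^ t), χ t j
        ≤ 2 ^ (M - t) * (4 * (3 / 2 : ℝ) ^ t) := by gcongr
      _ = 4 * (3 / 4 : ℝ) ^ t * (2 ^ (M - t) * 2 ^ t) := by
          have : (3 / 2 : ℝ) ^ t = (3 / 4) ^ t * 2 ^ t := by rw [← mul_pow]; norm_num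
          rw [this]; ring
      _ = _ := by rw [← pow_add, Nat.sub_add_cancel htM]
  have h3 : ∑ t ∈ Finset.Ico r (M + 1), (3 / 4 : ℝ) ^ t ≤ 4 * (3 / 4 : ℝ) ^ r := by
    rw [Finset.sum_Ico_eq_sum_range]
    simp_rw [pow_add]
    rw [← Finset.mul_sum, geom_sum_eq (by norm_num), mul_comm 4]
    refine mul_le_mul_of_nonneg_left ?_ (by positivity)
    have : (0 : ℝ) ≤ (3 / 4) ^ (M + 1 - r) := by positivity
    rw [div_le_iff_of_neg (by norm_num)]
    linarith
  calc _ ≤ ∑ j ∈ Finset.range (2 ^ M), ∑ t ∈ Finset.Ico r (M + 1), χ t (j % 2 ^ t) :=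
        Finset.sum_le_sum fun j _ => h1 j
    _ = ∑ t ∈ Finset.Ico r (M + 1), ∑ j ∈ Finset.range (2 ^ M), χ t (j % 2 ^ t) :=
        Finset.sum_comm
    _ ≤ ∑ t ∈ Finset.Ico r (M + 1), 4 * (3 / 4 : ℝ) ^ t * 2 ^ M := Finset.sum_le_sum h2
    _ = 4 * 2 ^ M * ∑ t ∈ Finset.Ico r (M + 1), (3 / 4 : ℝ) ^ t := by
        rw [Finset.mul_sum]; exact Finset.sum_congr rfl fun _ _ => by ring
    _ ≤ 4 * 2 ^ M * (4 * (3 / 4 : ℝ) ^ r) := by gcongr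
    _ = _ := by ring

theorem sum_node_shift (ψ : ℕ → ℝ) (k a t : ℕ) :
    ∑ l ∈ node k (a + t), ψ l = ∑ l ∈ node k t, ψ (a * 2 ^ k + l) := by
  rw [node, node, Finset.sum_Ico_add]
  congr 2 <;> ring

/-- The martingale differences of a translate depend only on the global position of the node. -/
theorem mdiff_shift (s φ : ℕ → ℝ) (i k j l : ℕ) :
    mdiff (fun l => s (i + l)) (fun l => φ (i + l)) k (j * 2 ^ (k + 1) + l)
      = mdiff (fun l => s (i + j * 2 ^ (k + 1) + l)) (fun l => φ (i + j * 2 ^ (k + 1) + l)) k l := by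
  have e0 : j * 2 ^ (k + 1) = 2 * j * 2 ^ k := by rw [pow_succ]; ring
  have e1 : (j * 2 ^ (k + 1) + l) / 2 ^ k = 2 * j + l / 2 ^ k := by
    rw [e0, add_comm, Nat.add_mul_div_right _ _ (by positivity), add_comm]
  have e2 : (j * 2 ^ (k + 1) + l) / 2 ^ (k + 1) = j + l / 2 ^ (k + 1) := by
    rw [add_comm, Nat.add_mul_div_right _ _ (by positivity), add_comm]
  unfold mdiff nodeAvg mass
  rw [e1, e2]
  simp only [sum_node_shift, ← e0, add_assoc]

/-- The part of the squared norm carried by a node depends only on its global position. -/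
theorem nsq_mdiff_shift (s φ : ℕ → ℝ) (i k j : ℕ) :
    nsq (fun l => s (i + l)) (mdiff (fun l => s (i + l)) (fun l => φ (i + l)) k) (k + 1) j
      = nsq (fun l => s (i + j * 2 ^ (k + 1) + l)) (mdiff (fun l => s (i + j * 2 ^ (k + 1) + l))
        (fun l => φ (i + j * 2 ^ (k + 1) + l)) k) (k + 1) 0 := by
  unfold nsq
  have := sum_node_shift (fun l => mdiff (fun l => s (i + l)) (fun l => φ (i + l)) k l ^ 2
    * s (i + l)) (k + 1) j 0
  rw [add_zero] at this
  rw [this]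
  simp only [mdiff_shift, add_assoc]

/-- The average over translations of the part of the norm carried by the bad nodes is small. -/
theorem sum_badSq_le {s : ℕ → ℝ} (hs : ∀ l, 0 ≤ s l) (f : ℕ → ℝ) (m r : ℕ) :
    ∑ i ∈ Finset.Ico (2 * 2 ^ m) (3 * 2 ^ m),
        badSq (m + 1) r (fun l => s (i + l)) (fun l => f (i + l))
      ≤ 80 * (3 / 4 : ℝ) ^ r * 2 ^ m * ∑ p ∈ Finset.range (8 * 2 ^ m), f p ^ 2 * s p := by
  classical
  set M := 2 ^ m with hM
  set n := m + 1 with hn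
  set ε : ℝ := 16 * (3 / 4 : ℝ) ^ r with hε
  set Φ : ℕ → ℕ → ℝ := fun k p => nsq (fun l => s (p + l))
    (mdiff (fun l => s (p + l)) (fun l => f (p + l)) k) (k + 1) 0 with hΦ
  have hΦ0 : ∀ k p, 0 ≤ Φ k p := fun k p => nsq_nonneg (fun l => hs _) _ _ _
  have hbad : ∀ i, badSq n r (fun l => s (i + l)) (fun l => f (i + l))
      = ∑ k ∈ Finset.range n, ∑ j ∈ Finset.range (2 ^ (n - (k + 1))),
        (if Good r (n - (k + 1)) j then (0 : ℝ) else 1) * Φ k (i + j * 2 ^ (k + 1)) := by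
    intro i
    unfold badSq
    refine Finset.sum_congr rfl fun k hk => ?_
    rw [sum_range_node _ (show k + 1 ≤ n from Finset.mem_range.1 hk)]
    refine Finset.sum_congr rfl fun j _ => ?_
    simp only [hΦ]
    rw [← nsq_mdiff_shift, nsq, Finset.mul_sum]
    refine Finset.sum_congr rfl fun l hl => ?_
    rw [mem_node.1 hl]
    split_ifs <;> simp
  have hk : ∀ k ∈ Finset.range n, ∑ i ∈ Finset.Ico (2 * M) (3 * M),
      ∑ j ∈ Finset.range (2 ^ (n - (k + 1))),
        (if Good r (n - (k + 1)) j then (0 : ℝ) else 1) * Φ k (i + j * 2 ^ (k + 1))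
      ≤ ε * ∑ i ∈ Finset.range (5 * M), tsq n (fun l => s (i + l))
        (mdiff (fun l => s (i + l)) (fun l => f (i + l)) k) := by
    intro k hk
    have hkn : k + 1 ≤ n := Finset.mem_range.1 hk
    set T := ∑ p ∈ Finset.Ico (2 * M) (5 * M), Φ k p with hT
    have hj : ∀ j ∈ Finset.range (2 ^ (n - (k + 1))), j * 2 ^ (k + 1) ≤ 2 * M := by
      intro j hj
      have : j * 2 ^ (k + 1) ≤ 2 ^ (n - (k + 1)) * 2 ^ (k + 1) :=
        Nat.mul_le_mul_right _ (Finset.mem_range.1 hj).le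
      rw [← pow_add, Nat.sub_add_cancel hkn] at this
      have h2n : 2 ^ n = M * 2 := by rw [hn, pow_succ]
      linarith
    have h1 : ∀ j ∈ Finset.range (2 ^ (n - (k + 1))),
        ∑ i ∈ Finset.Ico (2 * M) (3 * M), Φ k (i + j * 2 ^ (k + 1)) ≤ T := by
      intro j hj'
      rw [Finset.sum_Ico_add']
      refine Finset.sum_le_sum_of_subset_of_nonneg (fun p hp => ?_) fun p _ _ => hΦ0 k p
      have := hj j hj'
      rw [Finset.mem_Ico] at hp ⊢
      omega
    have h2 : ∀ j ∈ Finset.range (2 ^ (n - (k + 1))),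
        T ≤ ∑ i ∈ Finset.range (5 * M), Φ k (i + j * 2 ^ (k + 1)) := by
      intro j hj'
      rw [Finset.range_eq_Ico, Finset.sum_Ico_add']
      refine Finset.sum_le_sum_of_subset_of_nonneg (fun p hp => ?_) fun p _ _ => hΦ0 k p
      have := hj j hj'
      rw [Finset.mem_Ico] at hp ⊢
      omega
    have hT0 : 0 ≤ T := Finset.sum_nonneg fun p _ => hΦ0 k p
    calc _ = ∑ j ∈ Finset.range (2 ^ (n - (k + 1))),
          (if Good r (n - (k + 1)) j then (0 : ℝ) else 1) *
            ∑ i ∈ Finset.Ico (2 * M) (3 * M), Φ k (i + j * 2 ^ (k + 1)) := by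
          rw [Finset.sum_comm]
          exact Finset.sum_congr rfl fun j _ => (Finset.mul_sum _ _ _).symm
      _ ≤ ∑ j ∈ Finset.range (2 ^ (n - (k + 1))),
          (if Good r (n - (k + 1)) j then (0 : ℝ) else 1) * T := by
          refine Finset.sum_le_sum fun j hj' => mul_le_mul_of_nonneg_left (h1 j hj') ?_
          split_ifs <;> norm_num
      _ ≤ ε * 2 ^ (n - (k + 1)) * T := by
          rw [← Finset.sum_mul]
          exact mul_le_mul_of_nonneg_right (sum_not_good_le _ _) hT0
      _ = ε * ∑ j ∈ Finset.range (2 ^ (n - (k + 1))), T := by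
          rw [Finset.sum_const, Finset.card_range, nsmul_eq_mul]; push_cast; ring
      _ ≤ ε * ∑ j ∈ Finset.range (2 ^ (n - (k + 1))),
          ∑ i ∈ Finset.range (5 * M), Φ k (i + j * 2 ^ (k + 1)) :=
          mul_le_mul_of_nonneg_left (Finset.sum_le_sum h2) (by positivity)
      _ = _ := by
          rw [Finset.sum_comm]
          congr 1
          refine Finset.sum_congr rfl fun i _ => ?_
          rw [tsq_eq_sum_nsq hkn]
          refine Finset.sum_congr rfl fun j _ => ?_
          rw [nsq_mdiff_shift]
  simp_rw [hbad]
  rw [Finset.sum_comm]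
  refine (Finset.sum_le_sum hk).trans ?_
  rw [← Finset.mul_sum, Finset.sum_comm]
  set tot := ∑ p ∈ Finset.range (8 * M), f p ^ 2 * s p with htot
  have h3 : ∀ i ∈ Finset.range (5 * M), ∑ k ∈ Finset.range n, tsq n (fun l => s (i + l))
        (mdiff (fun l => s (i + l)) (fun l => f (i + l)) k) ≤ tot := by
    intro i hi
    have h4 := tsq_eq_add (s := fun l => s (i + l)) (fun l => hs _) n (fun l => f (i + l))
    have h5 : 0 ≤ nodeAvg (fun l => s (i + l)) (fun l => f (i + l)) n 0 ^ 2
        * mass (fun l => s (i + l)) n 0 :=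
      mul_nonneg (sq_nonneg _) (mass_nonneg (fun l => hs _) _ _)
    have h6 : tsq n (fun l => s (i + l)) (fun l => f (i + l)) ≤ tot := by
      rw [tsq, htot, Finset.range_eq_Ico, Finset.sum_Ico_add (fun p => f p ^ 2 * s p) 0 (2 ^ n) i]
      refine Finset.sum_le_sum_of_subset_of_nonneg (fun p hp => ?_)
        fun p _ _ => mul_nonneg (sq_nonneg _) (hs p)
      have := Finset.mem_range.1 hi
      rw [hn, pow_succ] at hp
      rw [Finset.mem_Ico] at hp
      rw [Finset.mem_range]
      omega
    linarith
  calc _ ≤ ε * ∑ i ∈ Finset.range (5 * M), tot :=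
        mul_le_mul_of_nonneg_left (Finset.sum_le_sum h3) (by positivity)
    _ = _ := by
        rw [Finset.sum_const, Finset.card_range, nsmul_eq_mul, hε, hM]; push_cast; ring

/-- There is one translation for which the bad parts of both functions are small, since the average
over the translations of the weighted sum of the two is small. -/
theorem exists_shift_badSq_le {s v : ℕ → ℝ} (hs : ∀ l, 0 ≤ s l) (hv : ∀ l, 0 ≤ v l)
    (f g : ℕ → ℝ) (m r : ℕ) : ∃ i ∈ Finset.Ico (2 * 2 ^ m) (3 * 2 ^ m),
      badSq (m + 1) r (fun l => s (i + l)) (fun l => f (i + l))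
          * (∑ p ∈ Finset.range (8 * 2 ^ m), g p ^ 2 * v p)
        + badSq (m + 1) r (fun l => v (i + l)) (fun l => g (i + l))
          * (∑ p ∈ Finset.range (8 * 2 ^ m), f p ^ 2 * s p)
      ≤ 160 * (3 / 4 : ℝ) ^ r * ((∑ p ∈ Finset.range (8 * 2 ^ m), f p ^ 2 * s p)
          * (∑ p ∈ Finset.range (8 * 2 ^ m), g p ^ 2 * v p)) := by
  set F := ∑ p ∈ Finset.range (8 * 2 ^ m), f p ^ 2 * s p
  set G := ∑ p ∈ Finset.range (8 * 2 ^ m), g p ^ 2 * v p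
  have hF : 0 ≤ F := Finset.sum_nonneg fun p _ => mul_nonneg (sq_nonneg _) (hs p)
  have hG : 0 ≤ G := Finset.sum_nonneg fun p _ => mul_nonneg (sq_nonneg _) (hv p)
  refine Finset.exists_le_of_sum_le ?_ ?_
  · rw [Finset.nonempty_Ico]
    have : 0 < 2 ^ m := by positivity
    omega
  · rw [Finset.sum_add_distrib, ← Finset.sum_mul, ← Finset.sum_mul, Finset.sum_const, Nat.card_Ico,
      nsmul_eq_mul, show 3 * 2 ^ m - 2 * 2 ^ m = 2 ^ m by omega]
    have h1 := mul_le_mul_of_nonneg_right (sum_badSq_le hs f m r) hG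
    have h2 := mul_le_mul_of_nonneg_right (sum_badSq_le hv g m r) hF
    push_cast
    refine (add_le_add h1 h2).trans (le_of_eq ?_)
    ring

/-! ### Forms on a lattice -/

/-- The matrix of a form on `ℤ` in the window that begins at `b`. -/
def window (B : ℤ → ℤ → ℝ) (b : ℤ) (l m : ℕ) : ℝ := B (b + l) (b + m)

theorem sum_window_eq {φ : ℕ → ℝ} {M i : ℕ} (hi : 2 * M ≤ i) (hi' : i < 3 * M)
    (hφ : ∀ p, p < 3 * M ∨ 4 * M ≤ p → φ p = 0) :
    ∑ l ∈ Finset.range (2 * M), φ (i + l) = ∑ t ∈ Finset.range M, φ (3 * M + t) := by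
  rw [Finset.range_eq_Ico, Finset.range_eq_Ico, Finset.sum_Ico_add, Finset.sum_Ico_add]
  symm
  refine Finset.sum_subset (fun p hp => ?_) fun p _ hp' => hφ p ?_
  · rw [Finset.mem_Ico] at hp ⊢; omega
  · rw [Finset.mem_Ico] at hp'; omega

theorem sum_range_eight {φ : ℕ → ℝ} {M : ℕ} (hφ : ∀ p, p < 3 * M ∨ 4 * M ≤ p → φ p = 0) :
    ∑ p ∈ Finset.range (8 * M), φ p = ∑ t ∈ Finset.range M, φ (3 * M + t) := by
  rw [Finset.range_eq_Ico, Finset.range_eq_Ico, Finset.sum_Ico_add]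
  symm
  refine Finset.sum_subset (fun p hp => ?_) fun p _ hp' => hφ p ?_
  · rw [Finset.mem_Ico] at hp ⊢; omega
  · rw [Finset.mem_Ico] at hp'; omega

/-- One step of the absorption: an a-priori bound of the form on all windows is improved, by
choosing a tree in which only a small part of the functions is carried by bad nodes. -/
theorem form_window_improve {S V : ℤ → ℝ} {B : ℤ → ℤ → ℝ} {X N : ℝ} (hN0 : 0 ≤ N)
    (h : ∀ b : ℤ, Ctrl (fun l => S (b + l)) (fun l => V (b + l)) (window B b) X)
    (h' : ∀ b : ℤ, Ctrl (fun l => V (b + l)) (fun l => S (b + l)) (fun l m => window B b m l) X)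
    (hN : ∀ (b : ℤ) (n : ℕ) (φ ψ : ℕ → ℝ), |form n (window B b) φ ψ|
      ≤ N * √(tsq n (fun l => S (b + l)) φ) * √(tsq n (fun l => V (b + l)) ψ))
    (b : ℤ) (m : ℕ) (φ ψ : ℕ → ℝ) : |form m (window B b) φ ψ|
      ≤ ((2002 + (2 * (30 : ℕ) + 1) * (√(3 * 2 ^ (30 + 1)) * √(3 * 2 ^ 1) + 18)) * X + N / 2)
        * √(tsq m (fun l => S (b + l)) φ) * √(tsq m (fun l => V (b + l)) ψ) := by
  set M := 2 ^ m with hM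
  set b' : ℤ := b - 3 * M with hb'
  set s : ℕ → ℝ := fun p => S (b' + p) with hs
  set v : ℕ → ℝ := fun p => V (b' + p) with hv
  set ext : (ℕ → ℝ) → ℕ → ℝ := fun φ p => if 3 * M ≤ p ∧ p < 4 * M then φ (p - 3 * M) else 0
    with hext
  have hext0 : ∀ φ p, p < 3 * M ∨ 4 * M ≤ p → ext φ p = 0 := fun φ p hp => by
    simp only [hext]; rw [if_neg]; omega
  have hext1 : ∀ φ, ∀ t < M, ext φ (3 * M + t) = φ t := fun φ t ht => by
    simp only [hext]
    rw [if_pos (by omega), Nat.add_sub_cancel_left]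
  have hs0 : ∀ p, 0 ≤ s p := (h b').s_nonneg
  have hv0 : ∀ p, 0 ≤ v p := (h b').v_nonneg
  obtain ⟨i, hi, hbad⟩ := exists_shift_badSq_le hs0 hv0 (ext φ) (ext ψ) m 30
  rw [Finset.mem_Ico, ← hM] at hi
  have hpos : ∀ t : ℕ, b' + ((3 * M + t : ℕ) : ℤ) = b + t := fun t => by
    rw [hb']; push_cast; ring
  have hposi : ∀ l : ℕ, b' + ((i + l : ℕ) : ℤ) = b' + i + l := fun l => by push_cast; ring
  have hF8 : ∀ (W : ℤ → ℝ) (φ : ℕ → ℝ), ∑ p ∈ Finset.range (8 * 2 ^ m), ext φ p ^ 2 * W (b' + p)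
      = tsq m (fun l => W (b + l)) φ := by
    intro W φ
    rw [sum_range_eight (M := M) fun p hp => by rw [hext0 φ p hp]; ring, tsq]
    refine Finset.sum_congr rfl fun t ht => ?_
    rw [hext1 φ t (Finset.mem_range.1 ht), hpos]
  have hFi : ∀ (W : ℤ → ℝ) (φ : ℕ → ℝ), tsq (m + 1) (fun l => W (b' + i + l))
      (fun l => ext φ (i + l)) = tsq m (fun l => W (b + l)) φ := by
    intro W φ
    have := sum_window_eq (M := M) (φ := fun p => ext φ p ^ 2 * W (b' + p)) hi.1 hi.2
      fun p hp => by rw [hext0 φ p hp]; ring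
    simp only [hposi, hpos] at this
    rw [tsq, tsq, pow_succ, mul_comm (2 ^ m), ← hM, this]
    exact Finset.sum_congr rfl fun t ht => by rw [hext1 φ t (Finset.mem_range.1 ht)]
  have hform : form (m + 1) (window B (b' + i)) (fun l => ext φ (i + l)) (fun l => ext ψ (i + l))
      = form m (window B b) φ ψ := by
    have h1 : ∀ x : ℤ, ∑ q ∈ Finset.range (2 * M), B x (b' + i + q) * ext ψ (i + q)
        = ∑ t ∈ Finset.range M, B x (b + t) * ψ t := by
      intro x
      have := sum_window_eq (M := M) (φ := fun p => B x (b' + p) * ext ψ p) hi.1 hi.2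
        fun p hp => by rw [hext0 ψ p hp]; ring
      simp only [hposi, hpos] at this
      rw [this]
      exact Finset.sum_congr rfl fun t ht => by rw [hext1 ψ t (Finset.mem_range.1 ht)]
    have h2 := sum_window_eq (M := M) (φ := fun p => ext φ p * ∑ t ∈ Finset.range M, B (b' + p) (b + t) * ψ t)
      hi.1 hi.2 fun p hp => by rw [hext0 φ p hp]; ring
    simp only [hposi, hpos, ← h1] at h2
    unfold form window
    rw [pow_succ, mul_comm (2 ^ m), ← hM]
    calc _ = ∑ l ∈ Finset.range (2 * M), ext φ (i + l) *
          ∑ q ∈ Finset.range (2 * M), B (b' + i + l) (b' + i + q) * ext ψ (i + q) := by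
          refine Finset.sum_congr rfl fun l _ => ?_
          rw [Finset.mul_sum]
          exact Finset.sum_congr rfl fun q _ => by ring
      _ = _ := by
          rw [h2]
          refine Finset.sum_congr rfl fun l hl => ?_
          rw [h1, hext1 φ l (Finset.mem_range.1 hl), Finset.mul_sum]
          exact Finset.sum_congr rfl fun q _ => by ring
  have hmain := (h (b' + i)).form_le (n := m + 1) (r := 30) (h' (b' + i)) hN0
    (hN (b' + i) (m + 1)) (fun l => ext φ (i + l)) (fun l => ext ψ (i + l))
  rw [hform, hFi S, hFi V] at hmain
  simp only [hs, hv] at hbad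
  rw [hF8 S, hF8 V] at hbad
  simp only [hposi] at hbad
  set F := tsq m (fun l => S (b + l)) φ with hF
  set G := tsq m (fun l => V (b + l)) ψ with hG
  have hF0 : 0 ≤ F := tsq_nonneg (fun l => (h b).s_nonneg l) _ _
  have hG0 : 0 ≤ G := tsq_nonneg (fun l => (h b).v_nonneg l) _ _
  set βf := badSq (m + 1) 30 (fun l => S (b' + i + l)) (fun l => ext φ (i + l)) with hβf
  set βg := badSq (m + 1) 30 (fun l => V (b' + i + l)) (fun l => ext ψ (i + l)) with hβg
  have hβ0 : ∀ (W : ℤ → ℝ) (χ : ℕ → ℝ), (∀ l : ℕ, 0 ≤ W (b' + i + l)) →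
      0 ≤ badSq (m + 1) 30 (fun l => W (b' + i + l)) χ := by
    intro W χ hW
    refine Finset.sum_nonneg fun k _ => Finset.sum_nonneg fun l _ => ?_
    split_ifs
    · exact le_rfl
    · exact mul_nonneg (sq_nonneg _) (hW l)
  have hβf0 : 0 ≤ βf := hβ0 S _ (h (b' + i)).s_nonneg
  have hβg0 : 0 ≤ βg := hβ0 V _ (h (b' + i)).v_nonneg
  have hsmall : 160 * (3 / 4 : ℝ) ^ 30 ≤ (1 / 4) ^ 2 := by norm_num
  have h1 : √βf * √G ≤ 1 / 4 * (√F * √G) := by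
    rw [← Real.sqrt_mul hβf0, ← Real.sqrt_mul hF0, Real.sqrt_le_left (by positivity), mul_pow,
      Real.sq_sqrt (by positivity)]
    have := mul_le_mul_of_nonneg_right hsmall (mul_nonneg hF0 hG0)
    have : 0 ≤ βg * F := by positivity
    linarith
  have h2 : √F * √βg ≤ 1 / 4 * (√F * √G) := by
    rw [← Real.sqrt_mul hF0, ← Real.sqrt_mul hF0, Real.sqrt_le_left (by positivity), mul_pow,
      Real.sq_sqrt (by positivity)]
    have := mul_le_mul_of_nonneg_right hsmall (mul_nonneg hF0 hG0)
    have : 0 ≤ βf * G := by positivity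
    linarith
  have h3 := mul_le_mul_of_nonneg_left (add_le_add h1 h2) hN0
  refine hmain.trans ?_
  rw [add_mul, add_mul]
  linarith

/-- The bound for forms on a lattice. The a-priori bound `N` does not enter the conclusion. -/
theorem exists_form_window_le : ∃ K : ℝ, 0 ≤ K ∧ ∀ {S V : ℤ → ℝ} {B : ℤ → ℤ → ℝ} {X N : ℝ},
    0 ≤ N →
    (∀ b : ℤ, Ctrl (fun l => S (b + l)) (fun l => V (b + l)) (window B b) X) →
    (∀ b : ℤ, Ctrl (fun l => V (b + l)) (fun l => S (b + l)) (fun l m => window B b m l) X) →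
    (∀ (b : ℤ) (n : ℕ) (φ ψ : ℕ → ℝ), |form n (window B b) φ ψ|
      ≤ N * √(tsq n (fun l => S (b + l)) φ) * √(tsq n (fun l => V (b + l)) ψ)) →
    ∀ (b : ℤ) (n : ℕ) (φ ψ : ℕ → ℝ), |form n (window B b) φ ψ|
      ≤ K * X * √(tsq n (fun l => S (b + l)) φ) * √(tsq n (fun l => V (b + l)) ψ) := by
  set K₁ : ℝ := 2002 + (2 * (30 : ℕ) + 1) * (√(3 * 2 ^ (30 + 1)) * √(3 * 2 ^ 1) + 18) with hK₁
  refine ⟨2 * K₁, by positivity, ?_⟩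
  intro S V B X N hN0 h h' hN b n φ ψ
  have hX := (h 0).X_pos
  have hK0 : 0 ≤ K₁ := by positivity
  have key : ∀ t : ℕ, ∀ (b : ℤ) (n : ℕ) (φ ψ : ℕ → ℝ), |form n (window B b) φ ψ|
      ≤ (2 * K₁ * X + N * (1 / 2) ^ t) * √(tsq n (fun l => S (b + l)) φ)
        * √(tsq n (fun l => V (b + l)) ψ) := by
    intro t
    induction t with
    | zero =>
      intro b n φ ψ
      refine (hN b n φ ψ).trans ?_
      gcongr
      rw [pow_zero, mul_one]
      linarith [mul_nonneg (mul_nonneg (zero_le_two (α := ℝ)) hK0) hX.le]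
    | succ t ih =>
      intro b n φ ψ
      refine (form_window_improve (by positivity) h h' ih b n φ ψ).trans (le_of_eq ?_)
      rw [← hK₁, pow_succ]
      ring
  have hlim : Filter.Tendsto (fun t : ℕ => (2 * K₁ * X + N * (1 / 2) ^ t)
      * √(tsq n (fun l => S (b + l)) φ) * √(tsq n (fun l => V (b + l)) ψ)) Filter.atTop
      (nhds ((2 * K₁ * X + N * 0) * √(tsq n (fun l => S (b + l)) φ)
        * √(tsq n (fun l => V (b + l)) ψ))) :=
    (((tendsto_pow_atTop_nhds_zero_of_lt_one (by norm_num) (by norm_num)).const_mul N).const_add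
      _).mul_const _ |>.mul_const _
  rw [mul_zero, add_zero] at hlim
  exact ge_of_tendsto' hlim fun t => key t b n φ ψ

/-! ### Consequences of the Poisson `A₂` condition -/

theorem add_sq_le_two_mul (a b : ℝ≥0∞) : (a + b) ^ 2 ≤ 2 * (a ^ 2 + b ^ 2) := by
  have h : 2 * (a * b) ≤ a ^ 2 + b ^ 2 := by
    rcases le_total a b with h | h
    · obtain ⟨c, rfl⟩ := exists_add_of_le h
      calc 2 * (a * (a + c)) ≤ 2 * (a * (a + c)) + c ^ 2 := le_self_add
        _ = _ := by ring
    · obtain ⟨c, rfl⟩ := exists_add_of_le h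
      calc 2 * ((b + c) * b) ≤ 2 * ((b + c) * b) + c ^ 2 := le_self_add
        _ = _ := by ring
  calc (a + b) ^ 2 = 2 * (a * b) + (a ^ 2 + b ^ 2) := by ring
    _ ≤ (a ^ 2 + b ^ 2) + (a ^ 2 + b ^ 2) := by gcongr
    _ = _ := by ring

theorem sq_lintegral_mul_le {Ω : Type*} [MeasurableSpace Ω] (μ : Measure Ω) {f g : Ω → ℝ≥0∞}
    (hf : AEMeasurable f μ) (hg : AEMeasurable g μ) :
    (∫⁻ a, f a * g a ∂μ) ^ 2 ≤ (∫⁻ a, f a ^ 2 ∂μ) * ∫⁻ a, g a ^ 2 ∂μ := by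
  have h := ENNReal.lintegral_mul_le_Lp_mul_Lq μ Real.HolderConjugate.two_two hf hg
  simp only [Pi.mul_apply] at h
  calc _ ≤ _ := pow_le_pow_left₀ ((zero_le)) h 2
    _ = _ := by
      rw [mul_pow, ← ENNReal.rpow_mul_natCast, ← ENNReal.rpow_mul_natCast]
      norm_num

theorem sq_lintegral_le {Ω : Type*} [MeasurableSpace Ω] (μ : Measure Ω) {f : Ω → ℝ≥0∞}
    (hf : AEMeasurable f μ) : (∫⁻ a, f a ∂μ) ^ 2 ≤ μ univ * ∫⁻ a, f a ^ 2 ∂μ := by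
  have h := sq_lintegral_mul_le μ (f := fun _ => 1) (g := f) aemeasurable_const hf
  simpa using h

/-- One half of Hardy's inequality: the variables `r` and `r'` are the distances of the two points
to a point that separates them, and the hypothesis is the two-weight Muckenhoupt condition. -/
theorem sq_lintegral_hardy_le {μ ν : Measure ℝ} [SFinite μ] [SFinite ν] {r r' : ℝ → ℝ}
    (hr : Measurable r) (hr' : Measurable r') {A : ℝ≥0∞}
    (h : ∀ᵐ y ∂μ, μ {z | r z ≤ r y} * ∫⁻ x, (if r y ≤ r' x then ENNReal.ofReal (r' x)⁻¹ ^ 2 else 0) ∂ν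
      ≤ A) :
    (∫⁻ x, ∫⁻ y, (if r y ≤ r' x then ENNReal.ofReal (r' x)⁻¹ else 0) ∂μ ∂ν) ^ 2
      ≤ ν univ * (2 * (A * μ univ)) := by
  set M : ℝ → ℝ≥0∞ := fun y => μ {z | r z ≤ r y} with hM
  set e : ℝ → ℝ → ℝ≥0∞ := fun x y => if r y ≤ r' x then 1 else 0 with he
  set ρ : ℝ → ℝ≥0∞ := fun x => ENNReal.ofReal (r' x)⁻¹ with hρ
  have hρm : Measurable ρ := (hr'.inv).ennreal_ofReal
  have hem : Measurable fun p : ℝ × ℝ => e p.1 p.2 :=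
    Measurable.ite (measurableSet_le (hr.comp measurable_snd) (hr'.comp measurable_fst))
      measurable_const measurable_const
  have hex : ∀ x, Measurable (e x) := fun x => hem.comp measurable_prodMk_left
  have hMm : Measurable M := by
    have : MeasurableSet {p : ℝ × ℝ | r p.2 ≤ r p.1} :=
      measurableSet_le (hr.comp measurable_snd) (hr.comp measurable_fst)
    exact measurable_measure_prodMk_left this
  have hS : ∀ x, (∫⁻ y, e x y ∂μ) ^ 2 ≤ 2 * ∫⁻ y, e x y * M y ∂μ := by
    intro x
    have hex : Measurable (e x) := hex x
    set c : ℝ → ℝ → ℝ≥0∞ := fun y z => if r z ≤ r y then 1 else 0 with hc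
    have hcm : Measurable fun p : ℝ × ℝ => c p.1 p.2 :=
      Measurable.ite (measurableSet_le (hr.comp measurable_snd) (hr.comp measurable_fst))
        measurable_const measurable_const
    have hcy : ∀ y, Measurable (c y) := fun y => hcm.comp measurable_prodMk_left
    have hcM : ∀ y, ∫⁻ z, c y z ∂μ = M y := by
      intro y
      have hms : MeasurableSet {z | r z ≤ r y} := measurableSet_le hr measurable_const
      simp only [hM]
      rw [← lintegral_indicator_one hms]
      rfl
    have h1 : ∀ y z, e x y * e x z ≤ e x y * c y z + e x z * c z y := by
      intro y z
      simp only [he, hc]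
      rcases le_total (r z) (r y) with hyz | hyz
      · rw [if_pos hyz]; split_ifs <;> simp
      · rw [if_pos hyz]; split_ifs <;> simp
    have hm2 : Measurable fun p : ℝ × ℝ => e x p.1 * c p.1 p.2 :=
      (hex.comp measurable_fst).mul hcm
    have hyy : ∀ y, ∫⁻ z, e x y * c y z ∂μ = e x y * M y := fun y => by
      rw [lintegral_const_mul _ (hcy y), hcM]
    calc (∫⁻ y, e x y ∂μ) ^ 2 = ∫⁻ y, ∫⁻ z, e x y * e x z ∂μ ∂μ := by
          simp_rw [lintegral_const_mul _ hex]
          rw [lintegral_mul_const _ hex, sq]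
      _ ≤ ∫⁻ y, ∫⁻ z, (e x y * c y z + e x z * c z y) ∂μ ∂μ :=
          lintegral_mono fun y => lintegral_mono fun z => h1 y z
      _ = (∫⁻ y, ∫⁻ z, e x y * c y z ∂μ ∂μ) + ∫⁻ y, ∫⁻ z, e x z * c z y ∂μ ∂μ := by
          rw [← lintegral_add_left hm2.lintegral_prod_right]
          exact lintegral_congr fun y => lintegral_add_left (hm2.comp measurable_prodMk_left) _
      _ = 2 * ∫⁻ y, e x y * M y ∂μ := by
          rw [lintegral_lintegral_swap (f := fun y z => e x z * c z y)
            (hm2.comp measurable_swap).aemeasurable, two_mul]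
          simp_rw [hyy]
  have h0 : ∀ x, ∫⁻ y, (if r y ≤ r' x then ENNReal.ofReal (r' x)⁻¹ else 0) ∂μ
      = ρ x * ∫⁻ y, e x y ∂μ := by
    intro x
    rw [← lintegral_const_mul _ (hex x)]
    refine lintegral_congr fun y => ?_
    simp only [he, hρ]
    split_ifs <;> simp
  simp_rw [h0]
  have hSm : Measurable fun x => ∫⁻ y, e x y ∂μ := hem.lintegral_prod_right
  refine (sq_lintegral_le ν (hρm.mul hSm).aemeasurable).trans ?_
  gcongr
  have hm3 : Measurable fun p : ℝ × ℝ => ρ p.1 ^ 2 * (e p.1 p.2 * M p.2) :=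
    ((hρm.comp measurable_fst).pow_const 2).mul (hem.mul (hMm.comp measurable_snd))
  calc ∫⁻ x, (ρ x * ∫⁻ y, e x y ∂μ) ^ 2 ∂ν ≤ ∫⁻ x, 2 * ∫⁻ y, ρ x ^ 2 * (e x y * M y) ∂μ ∂ν := by
        refine lintegral_mono fun x => ?_
        rw [mul_pow, lintegral_const_mul _ (f := fun y => e x y * M y) ((hex x).mul hMm)]
        calc _ ≤ ρ x ^ 2 * (2 * ∫⁻ y, e x y * M y ∂μ) := by gcongr; exact hS x
          _ = _ := by ring
    _ = 2 * ∫⁻ y, ∫⁻ x, ρ x ^ 2 * (e x y * M y) ∂ν ∂μ := by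
        rw [lintegral_const_mul _ hm3.lintegral_prod_right,
          lintegral_lintegral_swap hm3.aemeasurable]
    _ ≤ 2 * ∫⁻ y, A ∂μ := by
        gcongr 2 * ?_
        refine lintegral_mono_ae ?_
        filter_upwards [h] with y hy
        refine le_trans (le_of_eq ?_) hy
        have hmy : Measurable fun x => if r y ≤ r' x then ENNReal.ofReal (r' x)⁻¹ ^ 2 else 0 :=
          Measurable.ite (measurableSet_le measurable_const hr') (hρm.pow_const 2)
            measurable_const
        rw [← lintegral_const_mul _ hmy]
        refine lintegral_congr fun x => ?_
        simp only [he, hρ]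
        split_ifs
        · rw [one_mul, mul_comm]
        · simp
    _ = 2 * (A * μ univ) := by rw [lintegral_const]

theorem isInterval_Icc {a b : ℝ} (h : a < b) : IsInterval (Icc a b) :=
  ⟨ordConnected_Icc, Metric.isBounded_Icc a b, by rw [interior_Icc]; exact nonempty_Ioo.2 h⟩

theorem isInterval_Ico {a b : ℝ} (h : a < b) : IsInterval (Ico a b) :=
  ⟨ordConnected_Ico, Metric.isBounded_Ico a b, by rw [interior_Ico]; exact nonempty_Ioo.2 h⟩

theorem measure_mul_le_poisson (σ : Measure ℝ) {I : Set ℝ} (hI : MeasurableSet I) :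
    ENNReal.ofReal (volume.real I)⁻¹ * σ I ≤ poisson σ I := by
  rw [← setLIntegral_const]
  refine le_trans (setLIntegral_mono' hI fun x hx => ?_) (setLIntegral_le_lintegral I _)
  rw [Metric.infDist_zero_of_mem hx, add_zero, sq, ← div_div]
  rcases eq_or_ne (volume.real I) 0 with h | h
  · simp [h]
  · rw [div_self h, one_div]

theorem measure_mul_lintegral_le {σ w : Measure ℝ} {A : ℝ≥0∞}
    (hA : ∀ I, IsInterval I → poisson σ I * poisson w I ≤ A) {c t : ℝ} (ht : 0 < t) {G : Set ℝ}
    (hG : MeasurableSet G) {ρ : ℝ → ℝ} (h1 : ∀ x ∈ G, t ≤ ρ x)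
    (h2 : ∀ x ∈ G, Metric.infDist x (Icc c (c + t)) ≤ ρ x) :
    σ (Icc c (c + t)) * ∫⁻ x in G, ENNReal.ofReal (ρ x)⁻¹ ^ 2 ∂w ≤ 4 * A := by
  have hvol : volume.real (Icc c (c + t)) = t := by
    rw [Real.volume_real_Icc_of_le (by linarith)]; ring
  have hI := hA _ (isInterval_Icc (a := c) (b := c + t) (by linarith))
  have hs := measure_mul_le_poisson σ (measurableSet_Icc (a := c) (b := c + t))
  rw [hvol] at hs
  have hw : ENNReal.ofReal (t / 4) * ∫⁻ x in G, ENNReal.ofReal (ρ x)⁻¹ ^ 2 ∂w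
      ≤ poisson w (Icc c (c + t)) := by
    rw [← lintegral_const_mul' _ _ ENNReal.ofReal_ne_top]
    refine le_trans (setLIntegral_mono' hG fun x hx => ?_) (setLIntegral_le_lintegral G _)
    have := h1 x hx
    have := h2 x hx
    have h3 : 0 ≤ Metric.infDist x (Icc c (c + t)) := Metric.infDist_nonneg
    rw [← ENNReal.ofReal_pow (by rw [inv_nonneg]; linarith), ← ENNReal.ofReal_mul (by positivity),
      hvol]
    refine ENNReal.ofReal_le_ofReal ?_
    have hρ : 0 < ρ x := by linarith
    rw [inv_pow, ← div_eq_mul_inv, div_div]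
    refine div_le_div_of_nonneg_left ht.le (by positivity) ?_
    nlinarith
  have h4 : ENNReal.ofReal t⁻¹ * ENNReal.ofReal (t / 4) = ENNReal.ofReal (4⁻¹) := by
    rw [← ENNReal.ofReal_mul (by positivity)]
    congr 1
    field_simp
  have h5 := (mul_le_mul' hs hw).trans hI
  rw [mul_mul_mul_comm, h4, mul_comm] at h5
  calc _ = (σ (Icc c (c + t)) * ∫⁻ x in G, ENNReal.ofReal (ρ x)⁻¹ ^ 2 ∂w)
        * (ENNReal.ofReal 4⁻¹ * 4) := by
        rw [show (4 : ℝ≥0∞) = ENNReal.ofReal 4 by norm_num, ← ENNReal.ofReal_mul (by positivity)]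
        norm_num
    _ ≤ A * 4 := by rw [← mul_assoc]; gcongr
    _ = 4 * A := mul_comm _ _

/-- The two-weight Hardy inequality for sets that are separated by a point. -/
theorem lintegral_inv_dist_le {σ w : Measure ℝ} [SFinite σ] [SFinite w] {A : ℝ≥0∞}
    (hA : ∀ I, IsInterval I → poisson σ I * poisson w I ≤ A) {a : ℝ} {E G : Set ℝ}
    (hE : MeasurableSet E) (hG : MeasurableSet G) (hEa : E ⊆ Iio a) (hGa : G ⊆ Ioi a) :
    (∫⁻ x in G, ∫⁻ y in E, ENNReal.ofReal |x - y|⁻¹ ∂σ ∂w) ^ 2 ≤ 32 * (A * (σ E * w G)) := by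
  have hA' : ∀ I, IsInterval I → poisson w I * poisson σ I ≤ A := fun I hI => by
    rw [mul_comm]; exact hA I hI
  set r : ℝ → ℝ := fun y => a - y with hr
  set r' : ℝ → ℝ := fun x => x - a with hr'
  have hrm : Measurable r := measurable_const.sub measurable_id
  have hrm' : Measurable r' := measurable_id.sub measurable_const
  have h1 : ∀ᵐ y ∂σ.restrict E, (σ.restrict E) {z | r z ≤ r y} *
      ∫⁻ x, (if r y ≤ r' x then ENNReal.ofReal (r' x)⁻¹ ^ 2 else 0) ∂w.restrict G ≤ 4 * A := by
    filter_upwards [ae_restrict_mem hE] with y hy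
    have hy' : y < a := hEa hy
    have := measure_mul_lintegral_le hA (c := y) (t := a - y) (sub_pos.2 hy')
      (G := Ici (a + (a - y))) measurableSet_Ici (ρ := r')
      (fun x hx => by simp only [hr', mem_Ici] at hx ⊢; linarith)
      (fun x hx => by
        simp only [mem_Ici] at hx
        refine (Metric.infDist_le_dist_of_mem (y := a) (mem_Icc.2 ⟨hy'.le, by linarith⟩)).trans ?_
        rw [Real.dist_eq, abs_of_nonneg (by linarith)])
    refine le_trans (mul_le_mul' ?_ ?_) this
    · rw [Measure.restrict_apply (measurableSet_le hrm measurable_const)]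
      refine measure_mono fun z hz => ?_
      have h1 : r z ≤ r y := hz.1
      have h2 : z < a := hEa hz.2
      simp only [hr] at h1
      constructor <;> linarith
    · rw [← lintegral_indicator measurableSet_Ici]
      refine (setLIntegral_le_lintegral G _).trans (lintegral_mono fun x => ?_)
      split_ifs with h
      · rw [indicator_of_mem]
        simp only [hr, hr'] at h
        simp only [mem_Ici]; linarith
      · exact zero_le
  have h2 : ∀ᵐ x ∂w.restrict G, (w.restrict G) {z | r' z ≤ r' x} *
      ∫⁻ y, (if r' x ≤ r y then ENNReal.ofReal (r y)⁻¹ ^ 2 else 0) ∂σ.restrict E ≤ 4 * A := by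
    filter_upwards [ae_restrict_mem hG] with x hx
    have hx' : a < x := hGa hx
    have := measure_mul_lintegral_le hA' (c := a) (t := x - a) (sub_pos.2 hx')
      (G := Iic (a - (x - a))) measurableSet_Iic (ρ := r)
      (fun y hy => by simp only [hr, mem_Iic] at hy ⊢; linarith)
      (fun y hy => by
        simp only [mem_Iic] at hy
        refine (Metric.infDist_le_dist_of_mem (y := a) (mem_Icc.2 ⟨le_rfl, by linarith⟩)).trans ?_
        rw [Real.dist_eq, abs_sub_comm, abs_of_nonneg (by linarith)])
    refine le_trans (mul_le_mul' ?_ ?_) this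
    · rw [Measure.restrict_apply (measurableSet_le hrm' measurable_const)]
      refine measure_mono fun z hz => ?_
      have h1 : r' z ≤ r' x := hz.1
      have h2 : a < z := hGa hz.2
      simp only [hr'] at h1
      constructor <;> linarith
    · rw [← lintegral_indicator measurableSet_Iic]
      refine (setLIntegral_le_lintegral E _).trans (lintegral_mono fun y => ?_)
      split_ifs with h
      · rw [indicator_of_mem]
        simp only [hr, hr'] at h
        simp only [mem_Iic]; linarith
      · exact zero_le
  have H1 := sq_lintegral_hardy_le hrm hrm' h1
  have H2 := sq_lintegral_hardy_le hrm' hrm h2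
  simp only [Measure.restrict_apply_univ] at H1 H2
  have hm1 : Measurable fun p : ℝ × ℝ =>
      if r p.2 ≤ r' p.1 then ENNReal.ofReal (r' p.1)⁻¹ else 0 :=
    Measurable.ite (measurableSet_le (hrm.comp measurable_snd) (hrm'.comp measurable_fst))
      ((hrm'.comp measurable_fst).inv.ennreal_ofReal) measurable_const
  have hm2 : Measurable fun p : ℝ × ℝ =>
      if r' p.2 ≤ r p.1 then ENNReal.ofReal (r p.1)⁻¹ else 0 :=
    Measurable.ite (measurableSet_le (hrm'.comp measurable_snd) (hrm.comp measurable_fst))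
      ((hrm.comp measurable_fst).inv.ennreal_ofReal) measurable_const
  rw [lintegral_lintegral_swap hm2.aemeasurable] at H2
  have hle : ∫⁻ x in G, ∫⁻ y in E, ENNReal.ofReal |x - y|⁻¹ ∂σ ∂w
      ≤ (∫⁻ x in G, ∫⁻ y in E, (if r y ≤ r' x then ENNReal.ofReal (r' x)⁻¹ else 0) ∂σ ∂w)
        + ∫⁻ x in G, ∫⁻ y in E, (if r' x ≤ r y then ENNReal.ofReal (r y)⁻¹ else 0) ∂σ ∂w := by
    rw [← lintegral_add_left hm1.lintegral_prod_right]
    refine setLIntegral_mono' hG fun x hx => ?_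
    have hm1x : Measurable fun y => if r y ≤ r' x then ENNReal.ofReal (r' x)⁻¹ else 0 :=
      hm1.comp measurable_prodMk_left
    rw [← lintegral_add_left hm1x]
    refine setLIntegral_mono' hE fun y hy => ?_
    have hx' : a < x := hGa hx
    have hy' : y < a := hEa hy
    rw [abs_of_nonneg (by linarith)]
    rcases le_total (r y) (r' x) with h | h
    · refine le_add_right ?_
      rw [if_pos h]
      refine ENNReal.ofReal_le_ofReal (inv_anti₀ ?_ ?_) <;> simp only [hr'] <;> linarith
    · refine le_add_left ?_
      rw [if_pos h]
      refine ENNReal.ofReal_le_ofReal (inv_anti₀ ?_ ?_) <;> simp only [hr] <;> linarith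
  refine (pow_le_pow_left₀ ((zero_le)) hle 2).trans ?_
  refine (add_sq_le_two_mul _ _).trans ?_
  calc _ ≤ 2 * (w G * (2 * (4 * A * σ E)) + σ E * (2 * (4 * A * w G))) := by gcongr
    _ = _ := by ring

theorem measure_Icc_mul_le {σ w : Measure ℝ} {A : ℝ≥0∞}
    (hA : ∀ I, IsInterval I → poisson σ I * poisson w I ≤ A) {a b : ℝ} (hab : a < b) :
    σ (Icc a b) * w (Icc a b) ≤ ENNReal.ofReal ((b - a) ^ 2) * A := by
  have h := (mul_le_mul' (measure_mul_le_poisson σ (measurableSet_Icc (a := a) (b := b)))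
    (measure_mul_le_poisson w (measurableSet_Icc (a := a) (b := b)))).trans
      (hA _ (isInterval_Icc hab))
  rw [Real.volume_real_Icc_of_le hab.le, mul_mul_mul_comm] at h
  have hpos : 0 < b - a := sub_pos.2 hab
  have h1 : ENNReal.ofReal ((b - a) ^ 2) *
      (ENNReal.ofReal (b - a)⁻¹ * ENNReal.ofReal (b - a)⁻¹) = 1 := by
    rw [← ENNReal.ofReal_mul (by positivity), ← ENNReal.ofReal_mul (by positivity),
      ← ENNReal.ofReal_one]
    congr 1
    field_simp
  calc _ = ENNReal.ofReal ((b - a) ^ 2) *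
        (ENNReal.ofReal (b - a)⁻¹ * ENNReal.ofReal (b - a)⁻¹ * (σ (Icc a b) * w (Icc a b))) := by
        rw [← mul_assoc, h1, one_mul]
    _ ≤ _ := by gcongr

/-- Averages over balls of a fixed radius are bounded by the `A₂` condition. -/
theorem lintegral_sq_average_le {σ w : Measure ℝ} [SFinite σ] [SFinite w] {A : ℝ≥0∞}
    (hA : ∀ I, IsInterval I → poisson σ I * poisson w I ≤ A) {R : ℝ} (hR : 0 < R)
    {f : ℝ → ℝ≥0∞} (hf : Measurable f) :
    ∫⁻ x, (∫⁻ y in Metric.ball x R, f y ∂σ) ^ 2 ∂w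
      ≤ ENNReal.ofReal ((4 * R) ^ 2) * A * ∫⁻ y, f y ^ 2 ∂σ := by
  set e : ℝ → ℝ → ℝ≥0∞ := fun x y => if dist x y < R then 1 else 0 with he
  have hem : Measurable fun p : ℝ × ℝ => e p.1 p.2 :=
    Measurable.ite (measurableSet_lt measurable_dist measurable_const)
      measurable_const measurable_const
  have hsm : Measurable fun x => σ (Metric.ball x R) := by
    have : MeasurableSet {p : ℝ × ℝ | dist p.2 p.1 < R} :=
      measurableSet_lt (measurable_snd.dist measurable_fst) measurable_const
    exact measurable_measure_prodMk_left this
  have hm : Measurable fun p : ℝ × ℝ => e p.1 p.2 * σ (Metric.ball p.1 R) * f p.2 ^ 2 :=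
    (hem.mul (hsm.comp measurable_fst)).mul ((hf.comp measurable_snd).pow_const 2)
  calc ∫⁻ x, (∫⁻ y in Metric.ball x R, f y ∂σ) ^ 2 ∂w
      ≤ ∫⁻ x, ∫⁻ y, e x y * σ (Metric.ball x R) * f y ^ 2 ∂σ ∂w := by
        refine lintegral_mono fun x => ?_
        refine (sq_lintegral_le _ hf.aemeasurable).trans ?_
        rw [Measure.restrict_apply_univ, ← lintegral_const_mul _ (hf.pow_const 2),
          ← lintegral_indicator Metric.isOpen_ball.measurableSet]
        refine lintegral_mono fun y => ?_
        by_cases hy : y ∈ Metric.ball x R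
        · rw [indicator_of_mem hy]
          rw [Metric.mem_ball, dist_comm] at hy
          simp only [he, if_pos hy, one_mul, le_refl]
        · rw [indicator_of_notMem hy]; exact zero_le
    _ = ∫⁻ y, ∫⁻ x, e x y * σ (Metric.ball x R) * f y ^ 2 ∂w ∂σ :=
        lintegral_lintegral_swap hm.aemeasurable
    _ ≤ ∫⁻ y, ENNReal.ofReal ((4 * R) ^ 2) * A * f y ^ 2 ∂σ := by
        refine lintegral_mono fun y => ?_
        have hey : Measurable fun x => e x y := hem.comp measurable_prodMk_right
        rw [lintegral_mul_const _ (f := fun x => e x y * σ (Metric.ball x R)) (hey.mul hsm)]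
        gcongr
        have h1 := measure_Icc_mul_le hA (a := y - 2 * R) (b := y + 2 * R) (by linarith)
        rw [show y + 2 * R - (y - 2 * R) = 4 * R by ring] at h1
        refine le_trans ?_ h1
        rw [← setLIntegral_const, ← lintegral_indicator measurableSet_Icc]
        refine lintegral_mono fun x => ?_
        by_cases hxy : dist x y < R
        · have hxy' := hxy
          rw [Real.dist_eq, abs_lt] at hxy'
          rw [indicator_of_mem (mem_Icc.2 ⟨by linarith, by linarith⟩)]
          simp only [he, if_pos hxy, one_mul]
          refine measure_mono fun z hz => ?_
          rw [Metric.mem_ball, Real.dist_eq, abs_lt] at hz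
          constructor <;> linarith
        · simp only [he, if_neg hxy, zero_mul]
          exact zero_le
    _ = _ := lintegral_const_mul _ (hf.pow_const 2)

section

/-! ### Kernels with bounded testing constants -/

/-- A continuous truncated kernel, with normalized size and regularity, together with a number `X`
that dominates the `A₂`, pivotal and testing constants of a pair of weights. The bound `M` and the
radius `R` are qualitative: they make all integrals converge and do not enter any estimate. -/
structure IsTestedKernel (σ w : Measure ℝ) (k : ℝ → ℝ → ℝ) (X : ℝ) : Prop where
  cont : Continuous fun p : ℝ × ℝ => k p.1 p.2
  bdd : ∃ M, ∀ x y, |k x y| ≤ M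
  supp : ∃ R, ∀ x y, R ≤ |x - y| → k x y = 0
  size : ∀ x y, |k x y| ≤ |x - y|⁻¹
  reg_left : ∀ D x x' y, 0 < D → D ≤ |x - y| → D ≤ |x' - y| →
    |k x y - k x' y| ≤ |x - x'| / D ^ 2
  reg_right : ∀ D x y y', 0 < D → D ≤ |x - y| → D ≤ |x - y'| →
    |k x y - k x y'| ≤ |y - y'| / D ^ 2
  X_pos : 0 < X
  a2 : ∀ I, IsInterval I → poisson σ I * poisson w I ≤ ENNReal.ofReal (X ^ 2)
  piv : PivotalIneq σ w (ENNReal.ofReal X)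
  piv' : PivotalIneq w σ (ENNReal.ofReal X)
  test : TestingIneq k σ w (ENNReal.ofReal X)
  test' : TestingIneq (adjointKernel k) w σ (ENNReal.ofReal X)

variable {σ w : Measure ℝ} {k : ℝ → ℝ → ℝ} {X : ℝ}

theorem IsTestedKernel.swap (h : IsTestedKernel σ w k X) :
    IsTestedKernel w σ (adjointKernel k) X where
  cont := h.cont.comp continuous_swap
  bdd := h.bdd.imp fun M hM x y => hM y x
  supp := h.supp.imp fun R hR x y hxy => hR y x (by rwa [abs_sub_comm])
  size x y := by rw [abs_sub_comm x y]; exact h.size y x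
  reg_left D x x' y hD h1 h2 :=
    h.reg_right D y x x' hD (by rwa [abs_sub_comm]) (by rwa [abs_sub_comm])
  reg_right D x y y' hD h1 h2 :=
    h.reg_left D y y' x hD (by rwa [abs_sub_comm]) (by rwa [abs_sub_comm])
  X_pos := h.X_pos
  a2 I hI := by rw [mul_comm]; exact h.a2 I hI
  piv := h.piv'
  piv' := h.piv
  test := h.test'
  test' := h.test

theorem IsTestedKernel.integrable_mul [IsLocallyFiniteMeasure σ] (h : IsTestedKernel σ w k X)
    {f : ℝ → ℝ} (hf : LocallyIntegrable f σ) (x : ℝ) : Integrable (fun y => k x y * f y) σ := by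
  obtain ⟨M, hM⟩ := h.bdd
  obtain ⟨R, hR⟩ := h.supp
  have h1 : IntegrableOn f (Metric.closedBall x R) σ :=
    hf.integrableOn_isCompact (isCompact_closedBall x R)
  have hc : Continuous (k x) := h.cont.comp (Continuous.prodMk_right x)
  have h2 : IntegrableOn (fun y => k x y * f y) (Metric.closedBall x R) σ :=
    Integrable.bdd_mul h1 hc.aestronglyMeasurable (Filter.Eventually.of_forall fun y => hM x y)
  refine (integrableOn_iff_integrable_of_support_subset fun y hy => ?_).1 h2
  by_contra hy'
  rw [Metric.mem_closedBall, Real.dist_eq, not_le, abs_sub_comm] at hy'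
  exact hy (by simp only [hR x y hy'.le, zero_mul])

theorem IsTestedKernel.continuous_integralOp [IsLocallyFiniteMeasure σ]
    (h : IsTestedKernel σ w k X) {f : ℝ → ℝ} (hf : LocallyIntegrable f σ) :
    Continuous (integralOp k σ f) := by
  obtain ⟨M, hM⟩ := h.bdd
  obtain ⟨R, hR⟩ := h.supp
  refine continuous_iff_continuousAt.2 fun x₀ => ?_
  have h1 : IntegrableOn f (Metric.closedBall x₀ (R + 1)) σ :=
    hf.integrableOn_isCompact (isCompact_closedBall x₀ (R + 1))
  refine continuousAt_of_dominated
    (bound := (Metric.closedBall x₀ (R + 1)).indicator fun y => M * |f y|) ?_ ?_ ?_ ?_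
  · exact Filter.Eventually.of_forall fun x => (h.integrable_mul hf x).aestronglyMeasurable
  · filter_upwards [Metric.ball_mem_nhds x₀ one_pos] with x hx
    refine Filter.Eventually.of_forall fun y => ?_
    by_cases hy : y ∈ Metric.closedBall x₀ (R + 1)
    · rw [indicator_of_mem hy, norm_mul]
      exact mul_le_mul_of_nonneg_right (hM x y) (abs_nonneg _)
    · rw [indicator_of_notMem hy, hR x y, zero_mul, norm_zero]
      rw [Metric.mem_closedBall, Real.dist_eq, not_le] at hy
      rw [Metric.mem_ball, Real.dist_eq] at hx
      have := abs_sub_le y x x₀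
      rw [abs_sub_comm y x] at this
      linarith
  · rw [integrable_indicator_iff Metric.isClosed_closedBall.measurableSet]
    exact h1.norm.const_mul M
  · refine Filter.Eventually.of_forall fun y => ContinuousAt.mul ?_ continuousAt_const
    exact (h.cont.comp (Continuous.prodMk_left y)).continuousAt

theorem integrableOn_Ico_of_continuous {μ : Measure ℝ} [IsLocallyFiniteMeasure μ] {f : ℝ → ℝ}
    (hf : Continuous f) (a b : ℝ) : IntegrableOn f (Ico a b) μ :=
  hf.integrableOn_Icc.mono_set Ico_subset_Icc_self

theorem locallyIntegrable_indicator_one [IsLocallyFiniteMeasure σ] (a b : ℝ) :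
    LocallyIntegrable ((Ico a b).indicator (1 : ℝ → ℝ)) σ :=
  ((integrable_indicator_iff measurableSet_Ico).2
    (integrableOn_Ico_of_continuous continuous_one a b)).locallyIntegrable

theorem integralOp_indicator_one (k : ℝ → ℝ → ℝ) (σ : Measure ℝ) (a b x : ℝ) :
    integralOp k σ ((Ico a b).indicator 1) x = ∫ y in Ico a b, k x y ∂σ := by
  rw [integralOp, ← integral_indicator measurableSet_Ico]
  congr 1
  ext y
  by_cases hy : y ∈ Ico a b <;> simp [hy]

theorem IsTestedKernel.integral_sq_le [IsLocallyFiniteMeasure σ]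
    (h : IsTestedKernel σ w k X) {a b : ℝ} (hab : a < b) :
    ∫ x in Ico a b, integralOp k σ ((Ico a b).indicator 1) x ^ 2 ∂w
      ≤ X ^ 2 * σ.real (Ico a b) := by
  have ht := h.test _ (isInterval_Ico hab)
  have hc := h.continuous_integralOp (locallyIntegrable_indicator_one a b)
  rw [integral_eq_lintegral_of_nonneg_ae (Filter.Eventually.of_forall fun x => sq_nonneg _)
    (hc.pow 2).aestronglyMeasurable]
  have e : ∀ x, ENNReal.ofReal (integralOp k σ ((Ico a b).indicator 1) x ^ 2)
      = ‖integralOp k σ ((Ico a b).indicator 1) x‖ₑ ^ 2 := fun x => by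
    rw [← sq_abs, ENNReal.ofReal_pow (abs_nonneg _), Real.enorm_eq_ofReal_abs]
  simp_rw [e]
  refine (ENNReal.toReal_mono ?_ ht).trans (le_of_eq ?_)
  · exact ENNReal.mul_ne_top (by finiteness) measure_Ico_lt_top.ne
  · rw [ENNReal.toReal_mul, ENNReal.toReal_pow, ENNReal.toReal_ofReal h.X_pos.le, measureReal_def]

/-- The pairing `∫_J T(σ 1_I) dw`. -/
noncomputable def pair (k : ℝ → ℝ → ℝ) (σ w : Measure ℝ) (I J : Set ℝ) : ℝ :=
  ∫ x in J, integralOp k σ (I.indicator 1) x ∂w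

variable [IsLocallyFiniteMeasure σ] [IsLocallyFiniteMeasure w]

theorem IsTestedKernel.pair_swap (h : IsTestedKernel σ w k X) (a b c d : ℝ) :
    pair (adjointKernel k) w σ (Ico c d) (Ico a b) = pair k σ w (Ico a b) (Ico c d) := by
  unfold pair
  simp_rw [integralOp_indicator_one]
  obtain ⟨M, hM⟩ := h.bdd
  have : IsFiniteMeasure (σ.restrict (Ico a b)) := ⟨by
    rw [Measure.restrict_apply_univ]; exact measure_Ico_lt_top⟩
  have : IsFiniteMeasure (w.restrict (Ico c d)) := ⟨by
    rw [Measure.restrict_apply_univ]; exact measure_Ico_lt_top⟩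
  refine integral_integral_swap (f := fun y x => k x y) ?_
  refine Integrable.mono' (integrable_const M)
    (h.cont.comp continuous_swap).aestronglyMeasurable
    (Filter.Eventually.of_forall fun p => hM p.2 p.1)

theorem setIntegral_Ico_add {μ : Measure ℝ} [IsLocallyFiniteMeasure μ] {f : ℝ → ℝ}
    (hf : Continuous f) {a b c : ℝ} (hab : a ≤ b) (hbc : b ≤ c) :
    ∫ x in Ico a c, f x ∂μ = (∫ x in Ico a b, f x ∂μ) + ∫ x in Ico b c, f x ∂μ := by
  rw [← Ico_union_Ico_eq_Ico hab hbc]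
  exact setIntegral_union (Ico_disjoint_Ico_same) measurableSet_Ico
    (integrableOn_Ico_of_continuous hf _ _) (integrableOn_Ico_of_continuous hf _ _)

theorem IsTestedKernel.pair_add_right (h : IsTestedKernel σ w k X) (a b : ℝ) {c d e : ℝ}
    (hcd : c ≤ d) (hde : d ≤ e) : pair k σ w (Ico a b) (Ico c e)
      = pair k σ w (Ico a b) (Ico c d) + pair k σ w (Ico a b) (Ico d e) :=
  setIntegral_Ico_add (h.continuous_integralOp (locallyIntegrable_indicator_one a b)) hcd hde

theorem IsTestedKernel.pair_add_left (h : IsTestedKernel σ w k X) {a b c : ℝ} (hab : a ≤ b)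
    (hbc : b ≤ c) (d e : ℝ) : pair k σ w (Ico a c) (Ico d e)
      = pair k σ w (Ico a b) (Ico d e) + pair k σ w (Ico b c) (Ico d e) := by
  rw [← h.pair_swap, ← h.pair_swap, ← h.pair_swap]
  exact h.swap.pair_add_right d e hab hbc

theorem sq_setIntegral_le {μ : Measure ℝ} [IsLocallyFiniteMeasure μ] {u : ℝ → ℝ}
    (hu : Continuous u) (a b : ℝ) :
    (∫ x in Ico a b, u x ∂μ) ^ 2 ≤ μ.real (Ico a b) * ∫ x in Ico a b, u x ^ 2 ∂μ := by
  set m := μ.real (Ico a b) with hm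
  set t := ∫ x in Ico a b, u x ∂μ with ht
  have hm0 : 0 ≤ m := measureReal_nonneg
  rcases eq_or_lt_of_le hm0 with h0 | h0
  · have : μ.restrict (Ico a b) = 0 := by
      rw [Measure.restrict_eq_zero]
      exact (measureReal_eq_zero_iff measure_Ico_lt_top.ne).1 h0.symm
    rw [ht, this]; simp
  · have h1 : 0 ≤ ∫ x in Ico a b, (m * u x - t) ^ 2 ∂μ := integral_nonneg fun x => sq_nonneg _
    have h2 : ∫ x in Ico a b, (m * u x - t) ^ 2 ∂μ
        = m ^ 2 * (∫ x in Ico a b, u x ^ 2 ∂μ) - 2 * m * t * t + t ^ 2 * m := by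
      have e : ∀ x, (m * u x - t) ^ 2 = m ^ 2 * u x ^ 2 - 2 * m * t * u x + t ^ 2 := fun x => by
        ring
      simp_rw [e]
      rw [integral_add, integral_sub, integral_const_mul, integral_const_mul, setIntegral_const,
        smul_eq_mul, mul_comm (μ.real _)]
      · exact integrableOn_Ico_of_continuous ((hu.pow 2).const_mul _) _ _
      · exact integrableOn_Ico_of_continuous (hu.const_mul _) _ _
      · exact integrableOn_Ico_of_continuous (((hu.pow 2).const_mul _).sub (hu.const_mul _)) _ _
      · exact integrableOn_Ico_of_continuous continuous_const _ _
    rw [h2] at h1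
    have : 0 ≤ m * (m * (∫ x in Ico a b, u x ^ 2 ∂μ) - t ^ 2) := by linarith
    linarith [nonneg_of_mul_nonneg_right this h0]

theorem IsTestedKernel.abs_pair_self_le (h : IsTestedKernel σ w k X) {a b : ℝ} (hab : a < b) :
    |pair k σ w (Ico a b) (Ico a b)| ≤ X * (√(σ.real (Ico a b)) * √(w.real (Ico a b))) := by
  have hX := h.X_pos
  have hc := h.continuous_integralOp (locallyIntegrable_indicator_one a b)
  have h1 := sq_setIntegral_le (μ := w) hc a b
  have h2 := h.integral_sq_le hab
  refine abs_le_of_sq_le_sq ?_ (by positivity)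
  rw [mul_pow, mul_pow, Real.sq_sqrt measureReal_nonneg, Real.sq_sqrt measureReal_nonneg]
  calc _ ≤ _ := h1
    _ ≤ w.real (Ico a b) * (X ^ 2 * σ.real (Ico a b)) := by gcongr
    _ = _ := by ring

theorem IsTestedKernel.abs_pair_right_le (h : IsTestedKernel σ w k X) {a b c d : ℝ} (hbc : b ≤ c)
    (hw : w {c} = 0) : |pair k σ w (Ico a b) (Ico c d)|
      ≤ 6 * X * (√(σ.real (Ico a b)) * √(w.real (Ico c d))) := by
  have hX := h.X_pos
  have hH := lintegral_inv_dist_le h.a2 (a := c) (E := Ico a b) (G := Ioo c d) measurableSet_Ico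
    measurableSet_Ioo (fun y hy => hy.2.trans_le hbc) fun x hx => hx.1
  have hae : Ico c d =ᵐ[w] Ioo c d := (Ioo_ae_eq_Ico' hw).symm
  rw [pair, setIntegral_congr_set hae, measureReal_congr hae]
  set H := ∫⁻ x in Ioo c d, ∫⁻ y in Ico a b, ENNReal.ofReal |x - y|⁻¹ ∂σ ∂w with hHdef
  have hpt : ∀ x, ‖integralOp k σ ((Ico a b).indicator 1) x‖ₑ
      ≤ ∫⁻ y in Ico a b, ENNReal.ofReal |x - y|⁻¹ ∂σ := by
    intro x
    rw [integralOp_indicator_one]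
    refine (enorm_integral_le_lintegral_enorm _).trans (lintegral_mono fun y => ?_)
    rw [Real.enorm_eq_ofReal_abs]
    exact ENNReal.ofReal_le_ofReal (h.size x y)
  have h1 : ‖∫ x in Ioo c d, integralOp k σ ((Ico a b).indicator 1) x ∂w‖ₑ ≤ H :=
    (enorm_integral_le_lintegral_enorm _).trans (lintegral_mono hpt)
  have hfin : 32 * (ENNReal.ofReal (X ^ 2) * (σ (Ico a b) * w (Ioo c d))) ≠ ∞ := by
    have := (measure_Ico_lt_top (μ := σ) (a := a) (b := b)).ne
    have := (measure_Ioo_lt_top (μ := w) (a := c) (b := d)).ne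
    finiteness
  have h2 := ENNReal.toReal_mono hfin ((pow_le_pow_left₀ zero_le h1 2).trans hH)
  refine abs_le_of_sq_le_sq ?_ (by positivity)
  rw [ENNReal.toReal_pow, toReal_enorm, Real.norm_eq_abs, sq_abs, ENNReal.toReal_mul,
    ENNReal.toReal_mul, ENNReal.toReal_mul, ENNReal.toReal_ofReal (by positivity)] at h2
  simp only [ENNReal.toReal_ofNat, ← measureReal_def] at h2
  refine h2.trans ?_
  rw [mul_pow, mul_pow, mul_pow, Real.sq_sqrt measureReal_nonneg, Real.sq_sqrt measureReal_nonneg]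
  have : 0 ≤ X ^ 2 * (σ.real (Ico a b) * w.real (Ioo c d)) := by positivity
  linarith

theorem IsTestedKernel.abs_pair_left_le (h : IsTestedKernel σ w k X) {a b c d : ℝ} (hda : d ≤ a)
    (hσ : σ {a} = 0) : |pair k σ w (Ico a b) (Ico c d)|
      ≤ 6 * X * (√(σ.real (Ico a b)) * √(w.real (Ico c d))) := by
  rw [← h.pair_swap, mul_comm (√_)]
  exact h.swap.abs_pair_right_le hda hσ

theorem sqrt_measureReal_mono {μ : Measure ℝ} [IsLocallyFiniteMeasure μ] {a b c d : ℝ}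
    (hca : c ≤ a) (hbd : b ≤ d) : √(μ.real (Ico a b)) ≤ √(μ.real (Ico c d)) :=
  Real.sqrt_le_sqrt (measureReal_mono (Ico_subset_Ico hca hbd) measure_Ico_lt_top.ne)

theorem IsTestedKernel.abs_pair_nested_le (h : IsTestedKernel σ w k X) {a b c d : ℝ} (hca : c ≤ a)
    (hab : a < b) (hbd : b ≤ d) (hσ : σ {a} = 0) (hw : w {b} = 0) :
    |pair k σ w (Ico a b) (Ico c d)| ≤ 13 * X * (√(σ.real (Ico a b)) * √(w.real (Ico c d))) := by
  have hX := h.X_pos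
  rw [h.pair_add_right a b hca (hab.le.trans hbd), h.pair_add_right a b hab.le hbd]
  have h1 := h.abs_pair_left_le (c := c) (b := b) le_rfl hσ
  have h2 := h.abs_pair_self_le hab
  have h3 := h.abs_pair_right_le (a := a) (d := d) le_rfl hw
  have m1 := sqrt_measureReal_mono (μ := w) (le_refl c) (hab.le.trans hbd)
  have m2 := sqrt_measureReal_mono (μ := w) hca hbd
  have m3 := sqrt_measureReal_mono (μ := w) (hca.trans hab.le) (le_refl d)
  have hs : 0 ≤ X * √(σ.real (Ico a b)) := by positivity
  have n1 := mul_le_mul_of_nonneg_left m1 hs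
  have n2 := mul_le_mul_of_nonneg_left m2 hs
  have n3 := mul_le_mul_of_nonneg_left m3 hs
  refine (abs_add_le _ _).trans ((add_le_add_right (abs_add_le _ _) _).trans ?_)
  linarith

end

section

/-! ### Discretization of the weights and of the form on a lattice -/

/-- The cell with index `t` of the lattice with mesh `ℓ` and origin `x₀`. -/
def latCell (x₀ ℓ t : ℝ) : Set ℝ := Ico (x₀ + t * ℓ) (x₀ + (t + 1) * ℓ)

/-- The mass of a cell of the lattice, divided by the mesh `ℓ`. -/
noncomputable def latMeas (μ : Measure ℝ) (x₀ ℓ t : ℝ) : ℝ := μ.real (latCell x₀ ℓ t) / ℓ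

/-- The matrix entry `ℓ⁻¹ ∫_J T(σ 1_I) dw` of a pair of cells of the lattice. With this scaling a
node of height `k` has the length `2 ^ k`, for every mesh. -/
noncomputable def latForm (k : ℝ → ℝ → ℝ) (σ w : Measure ℝ) (x₀ ℓ t u : ℝ) : ℝ :=
  pair k σ w (latCell x₀ ℓ t) (latCell x₀ ℓ u) / ℓ

theorem latCell_add (x₀ ℓ t u : ℝ) : latCell x₀ ℓ (t + u) = latCell (x₀ + t * ℓ) ℓ u := by
  unfold latCell
  congr 1 <;> ring

theorem sum_latCell {M : Type*} [AddCommMonoid M] {F : Set ℝ → M} (h0 : F ∅ = 0)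
    (hF : ∀ a b c, a ≤ b → b ≤ c → F (Ico a c) = F (Ico a b) + F (Ico b c)) (x₀ : ℝ) {ℓ : ℝ}
    (hℓ : 0 < ℓ) {m n : ℕ} (hmn : m ≤ n) :
    ∑ l ∈ Finset.Ico m n, F (latCell x₀ ℓ l) = F (Ico (x₀ + m * ℓ) (x₀ + n * ℓ)) := by
  induction n, hmn using Nat.le_induction with
  | base => simp [h0]
  | succ n hmn ih =>
    have h1 : (m : ℝ) * ℓ ≤ n * ℓ := by gcongr
    rw [Finset.sum_Ico_succ_top hmn, ih, latCell, Nat.cast_succ]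
    rw [← hF _ _ _ (by linarith) (by linarith)]

theorem latCell_pow (x₀ ℓ : ℝ) (k j : ℕ) : latCell x₀ (2 ^ k * ℓ) j
    = Ico (x₀ + (j * 2 ^ k : ℕ) * ℓ) (x₀ + ((j + 1) * 2 ^ k : ℕ) * ℓ) := by
  unfold latCell
  push_cast
  congr 1 <;> ring

theorem sum_node_latCell {M : Type*} [AddCommMonoid M] {F : Set ℝ → M} (h0 : F ∅ = 0)
    (hF : ∀ a b c, a ≤ b → b ≤ c → F (Ico a c) = F (Ico a b) + F (Ico b c)) (x₀ : ℝ) {ℓ : ℝ}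
    (hℓ : 0 < ℓ) (k j : ℕ) :
    ∑ l ∈ node k j, F (latCell x₀ ℓ l) = F (latCell x₀ (2 ^ k * ℓ) j) := by
  rw [node, sum_latCell h0 hF x₀ hℓ (Nat.mul_le_mul_right _ (Nat.le_succ j)), latCell_pow]

theorem measureReal_Ico_add (μ : Measure ℝ) [IsLocallyFiniteMeasure μ] (a b c : ℝ) (hab : a ≤ b)
    (hbc : b ≤ c) : μ.real (Ico a c) = μ.real (Ico a b) + μ.real (Ico b c) := by
  rw [← Ico_union_Ico_eq_Ico hab hbc]
  exact measureReal_union Ico_disjoint_Ico_same measurableSet_Ico measure_Ico_lt_top.ne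
    measure_Ico_lt_top.ne

theorem lintegral_Ico_add (μ : Measure ℝ) (f : ℝ → ℝ≥0∞) (a b c : ℝ) (hab : a ≤ b) (hbc : b ≤ c) :
    ∫⁻ x in Ico a c, f x ∂μ = (∫⁻ x in Ico a b, f x ∂μ) + ∫⁻ x in Ico b c, f x ∂μ := by
  rw [← Ico_union_Ico_eq_Ico hab hbc]
  exact lintegral_union measurableSet_Ico Ico_disjoint_Ico_same

theorem measure_latCell_ne_top (μ : Measure ℝ) [IsLocallyFiniteMeasure μ] (x₀ ℓ t : ℝ) :
    μ (latCell x₀ ℓ t) ≠ ∞ := measure_Ico_lt_top.ne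

theorem mass_latMeas (μ : Measure ℝ) [IsLocallyFiniteMeasure μ] (x₀ : ℝ) {ℓ : ℝ} (hℓ : 0 < ℓ)
    (k j : ℕ) : mass (fun l => latMeas μ x₀ ℓ l) k j = μ.real (latCell x₀ (2 ^ k * ℓ) j) / ℓ := by
  unfold mass latMeas
  rw [← Finset.sum_div, sum_node_latCell (F := μ.real) (by simp)
    (measureReal_Ico_add μ) x₀ hℓ]

theorem latMeas_nonneg (μ : Measure ℝ) (x₀ : ℝ) {ℓ : ℝ} (hℓ : 0 < ℓ) (t : ℝ) :
    0 ≤ latMeas μ x₀ ℓ t := div_nonneg measureReal_nonneg hℓ.le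

theorem latCell_lt (x₀ : ℝ) {ℓ : ℝ} (hℓ : 0 < ℓ) (t : ℝ) : x₀ + t * ℓ < x₀ + (t + 1) * ℓ := by
  linarith

theorem isInterval_latCell (x₀ : ℝ) {ℓ : ℝ} (hℓ : 0 < ℓ) (t : ℝ) :
    IsInterval (latCell x₀ ℓ t) := isInterval_Ico (latCell_lt x₀ hℓ t)

theorem volume_real_latCell (x₀ : ℝ) {ℓ : ℝ} (hℓ : 0 < ℓ) (t : ℝ) :
    volume.real (latCell x₀ ℓ t) = ℓ := by
  rw [latCell, Real.volume_real_Ico_of_le (latCell_lt x₀ hℓ t).le]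
  ring

theorem infDist_Ico_le {a b e : ℝ} (hab : a < b) (he : e ∈ Icc a b) (y : ℝ) :
    Metric.infDist y (Ico a b) ≤ |y - e| := by
  rw [← Metric.infDist_closure, closure_Ico hab.ne, ← Real.dist_eq]
  exact Metric.infDist_le_dist_of_mem he

theorem mem_latCell_iff {x₀ ℓ x : ℝ} (hℓ : 0 < ℓ) (k j : ℕ) :
    x ∈ latCell x₀ (2 ^ k * ℓ) j ↔ x₀ ≤ x ∧ ⌊(x - x₀) / ℓ⌋₊ ∈ node k j := by
  rw [latCell_pow, mem_Ico, node, Finset.mem_Ico]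
  constructor
  · rintro ⟨h1, h2⟩
    have h0 : x₀ ≤ x := by
      have : 0 ≤ ((j * 2 ^ k : ℕ) : ℝ) * ℓ := by positivity
      linarith
    have h3 : 0 ≤ (x - x₀) / ℓ := div_nonneg (by linarith) hℓ.le
    refine ⟨h0, (Nat.le_floor_iff h3).2 ?_, (Nat.floor_lt h3).2 ?_⟩
    · rw [le_div_iff₀ hℓ]; linarith
    · rw [div_lt_iff₀ hℓ]; linarith
  · rintro ⟨h0, h1, h2⟩
    have h3 : 0 ≤ (x - x₀) / ℓ := div_nonneg (by linarith) hℓ.le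
    rw [Nat.le_floor_iff h3, le_div_iff₀ hℓ] at h1
    rw [Nat.floor_lt h3, div_lt_iff₀ hℓ] at h2
    constructor <;> linarith

theorem gap_mul_le_abs_sub {x₀ ℓ x y : ℝ} {k j l : ℕ}
    (hx : x ∈ latCell x₀ (2 ^ k * ℓ) j) (hy : y ∈ latCell x₀ ℓ l) :
    (gap l k j : ℝ) * ℓ ≤ |x - y| := by
  rw [latCell_pow] at hx
  obtain ⟨hx1, hx2⟩ := hx
  obtain ⟨hy1, hy2⟩ := hy
  unfold gap
  set a := j * 2 ^ k with ha
  set b := (j + 1) * 2 ^ k with hb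
  have hab : a ≤ b := Nat.mul_le_mul_right _ (Nat.le_succ j)
  rcases le_or_gt (l + 1) a with h | h
  · rw [show a - (l + 1) + (l - b) = a - (l + 1) by omega, Nat.cast_sub h]
    push_cast
    exact le_trans (by linarith) (le_abs_self _)
  · rcases le_or_gt b l with h' | h'
    · rw [show a - (l + 1) + (l - b) = l - b by omega, Nat.cast_sub h']
      exact le_trans (by linarith) (neg_le_abs _)
    · rw [show a - (l + 1) + (l - b) = 0 by omega, Nat.cast_zero, zero_mul]
      exact abs_nonneg _

theorem infDist_latCell_le {x₀ ℓ y : ℝ} (hℓ : 0 < ℓ) {k j l : ℕ} (hy : y ∈ latCell x₀ ℓ l) :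
    Metric.infDist y (latCell x₀ (2 ^ k * ℓ) j) ≤ (gap l k j + 1) * ℓ := by
  obtain ⟨hy1, hy2⟩ := hy
  have hlt := latCell_lt x₀ (show 0 < 2 ^ k * ℓ by positivity) j
  have hP := latCell_pow x₀ ℓ k j
  rw [latCell] at hP ⊢
  unfold gap
  set a := j * 2 ^ k with ha
  set b := (j + 1) * 2 ^ k with hb
  have hab : a < b := Nat.mul_lt_mul_of_pos_right (Nat.lt_succ_self j) (by positivity)
  have habℓ : (a : ℝ) * ℓ < b * ℓ := by gcongr
  rw [hP]
  rcases le_or_gt (l + 1) a with h | h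
  · refine (infDist_Ico_le (by linarith) (left_mem_Icc.2 (by linarith)) y).trans ?_
    rw [show a - (l + 1) + (l - b) = a - (l + 1) by omega, Nat.cast_sub h]
    have h' : ((l + 1 : ℕ) : ℝ) * ℓ ≤ a * ℓ := by gcongr
    push_cast at h' ⊢
    rw [abs_sub_comm, abs_of_nonneg] <;> linarith
  · rcases le_or_gt b l with h' | h'
    · refine (infDist_Ico_le (by linarith) (right_mem_Icc.2 (by linarith)) y).trans ?_
      rw [show a - (l + 1) + (l - b) = l - b by omega, Nat.cast_sub h']
      have h' : (b : ℝ) * ℓ ≤ l * ℓ := by gcongr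
      rw [abs_of_nonneg] <;> linarith
    · have h1 : (a : ℝ) * ℓ ≤ l * ℓ := by gcongr; omega
      have h2 : ((l + 1 : ℕ) : ℝ) * ℓ ≤ b * ℓ := by gcongr; omega
      push_cast at h2
      rw [Metric.infDist_zero_of_mem]
      · positivity
      · constructor <;> linarith

variable {σ w : Measure ℝ} {k : ℝ → ℝ → ℝ} {X : ℝ}

theorem IsTestedKernel.abs_integralOp_sub_le [IsLocallyFiniteMeasure σ]
    (h : IsTestedKernel σ w k X) {x₀ ℓ : ℝ}
    (hℓ : 0 < ℓ) {n j l : ℕ} (hg : 0 < gap l n j) {x c : ℝ} (hx : x ∈ latCell x₀ (2 ^ n * ℓ) j)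
    (hc : c ∈ latCell x₀ (2 ^ n * ℓ) j) :
    |integralOp k σ ((latCell x₀ ℓ l).indicator 1) x
      - integralOp k σ ((latCell x₀ ℓ l).indicator 1) c|
      ≤ 2 ^ n * ℓ / (gap l n j * ℓ) ^ 2 * σ.real (latCell x₀ ℓ l) := by
  have hg' : 0 < (gap l n j : ℝ) * ℓ := by positivity
  have hk : ∀ x, Continuous (k x) := fun x => h.cont.comp (Continuous.prodMk_right x)
  rw [latCell, integralOp_indicator_one, integralOp_indicator_one,
    ← integral_sub (integrableOn_Ico_of_continuous (hk x) _ _)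
      (integrableOn_Ico_of_continuous (hk c) _ _)]
  refine norm_setIntegral_le_of_norm_le_const (f := fun y => k x y - k c y)
    measure_Ico_lt_top fun y hy => ?_
  refine (h.reg_left _ x c y hg' (gap_mul_le_abs_sub hx hy)
    (gap_mul_le_abs_sub hc hy)).trans ?_
  gcongr
  obtain ⟨hx1, hx2⟩ := hx
  obtain ⟨hc1, hc2⟩ := hc
  rw [abs_le]
  constructor <;> linarith

variable [IsLocallyFiniteMeasure σ] [IsLocallyFiniteMeasure w]

theorem pair_empty_left (k : ℝ → ℝ → ℝ) (σ w : Measure ℝ) (J : Set ℝ) : pair k σ w ∅ J = 0 := by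
  simp [pair, integralOp]

theorem pair_empty_right (k : ℝ → ℝ → ℝ) (σ w : Measure ℝ) (I : Set ℝ) : pair k σ w I ∅ = 0 := by
  simp [pair]

theorem IsTestedKernel.sum_pair_left (h : IsTestedKernel σ w k X) (x₀ : ℝ) {ℓ : ℝ} (hℓ : 0 < ℓ)
    (n j : ℕ) (c d : ℝ) : ∑ l ∈ node n j, pair k σ w (latCell x₀ ℓ l) (Ico c d)
      = pair k σ w (latCell x₀ (2 ^ n * ℓ) j) (Ico c d) :=
  sum_node_latCell (F := fun I => pair k σ w I (Ico c d)) (pair_empty_left _ _ _ _)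
    (fun _ _ _ hab hbc => h.pair_add_left hab hbc c d) x₀ hℓ n j

theorem IsTestedKernel.sum_pair_right (h : IsTestedKernel σ w k X) (x₀ : ℝ) {ℓ : ℝ} (hℓ : 0 < ℓ)
    (n j : ℕ) (a b : ℝ) : ∑ l ∈ node n j, pair k σ w (Ico a b) (latCell x₀ ℓ l)
      = pair k σ w (Ico a b) (latCell x₀ (2 ^ n * ℓ) j) :=
  sum_node_latCell (F := fun I => pair k σ w (Ico a b) I) (pair_empty_right _ _ _ _)
    (fun _ _ _ hab hbc => h.pair_add_right a b hab hbc) x₀ hℓ n j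

theorem IsTestedKernel.lattice_test (h : IsTestedKernel σ w k X) (x₀ : ℝ) {ℓ : ℝ} (hℓ : 0 < ℓ)
    (n j : ℕ) (ψ : ℕ → ℝ) :
    |∑ m ∈ node n j, (∑ l ∈ node n j, latForm k σ w x₀ ℓ l m) * ψ m|
      ≤ X * √(mass (fun l => latMeas σ x₀ ℓ l) n j) * √(nsq (fun l => latMeas w x₀ ℓ l) ψ n j) := by
  have hX := h.X_pos
  have hL : 0 < 2 ^ n * ℓ := by positivity
  set N := latCell x₀ (2 ^ n * ℓ) j with hN
  have hc : Continuous (integralOp k σ (N.indicator 1)) :=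
    h.continuous_integralOp (locallyIntegrable_indicator_one _ _)
  have e : ∀ m : ℕ, ∑ l ∈ node n j, latForm k σ w x₀ ℓ l m
      = pair k σ w N (latCell x₀ ℓ m) / ℓ := fun m => by
    unfold latForm
    rw [← Finset.sum_div]
    congr 1
    exact h.sum_pair_left x₀ hℓ n j _ _
  simp_rw [e]
  set t : ℕ → ℝ := fun m => ∫ x in latCell x₀ ℓ m, integralOp k σ (N.indicator 1) x ^ 2 ∂w with ht
  have ht0 : ∀ m, 0 ≤ t m := fun m => integral_nonneg fun x => sq_nonneg _
  have hsum : ∑ m ∈ node n j, t m ≤ X ^ 2 * σ.real N := by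
    rw [sum_node_latCell (F := fun I => ∫ x in I, integralOp k σ (N.indicator 1) x ^ 2 ∂w)
      (by simp) (fun _ _ _ hab hbc => setIntegral_Ico_add (hc.pow 2) hab hbc) x₀ hℓ]
    exact h.integral_sq_le (latCell_lt x₀ hL j)
  have hcs := Finset.sum_sq_le_sum_mul_sum_of_sq_le_mul (node n j)
    (r := fun m => pair k σ w N (latCell x₀ ℓ m) / ℓ * ψ m)
    (f := fun m => t m / ℓ) (g := fun m => ψ m ^ 2 * latMeas w x₀ ℓ m)
    (fun m _ => div_nonneg (ht0 m) hℓ.le)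
    (fun m _ => mul_nonneg (sq_nonneg _) (latMeas_nonneg w x₀ hℓ m))
    (fun m _ => by
      have := sq_setIntegral_le (μ := w) hc (x₀ + m * ℓ) (x₀ + (m + 1) * ℓ)
      have h1 : 0 ≤ ψ m ^ 2 / ℓ ^ 2 := by positivity
      have h2 := mul_le_mul_of_nonneg_right this h1
      refine le_trans (le_of_eq ?_) (h2.trans (le_of_eq ?_))
      · simp only [pair, latCell]; field_simp
      · simp only [ht, latMeas, latCell]; field_simp)
  refine abs_le_of_sq_le_sq ?_ (by positivity)
  rw [mul_pow, mul_pow, Real.sq_sqrt (mass_nonneg (latMeas_nonneg σ x₀ hℓ ·) _ _),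
    Real.sq_sqrt (nsq_nonneg (latMeas_nonneg w x₀ hℓ ·) _ _ _), mass_latMeas σ x₀ hℓ]
  refine hcs.trans (mul_le_mul_of_nonneg_right ?_
    (nsq_nonneg (latMeas_nonneg w x₀ hℓ ·) _ _ _))
  rw [← Finset.sum_div, ← mul_div_assoc]
  gcongr

/-- Two dyadic nodes are separated or nested. -/
theorem node_separated_or_nested {i k : ℕ} (hik : i ≤ k) (p q : ℕ) :
    (p + 1) * 2 ^ i ≤ q * 2 ^ k ∨ (q + 1) * 2 ^ k ≤ p * 2 ^ i ∨
      (q * 2 ^ k ≤ p * 2 ^ i ∧ (p + 1) * 2 ^ i ≤ (q + 1) * 2 ^ k) := by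
  obtain ⟨s, rfl⟩ := Nat.exists_eq_add_of_le hik
  rw [pow_add, mul_comm (2 ^ i), ← mul_assoc, ← mul_assoc]
  rcases le_or_gt (p + 1) (q * 2 ^ s) with h1 | h1
  · exact Or.inl (Nat.mul_le_mul_right _ h1)
  · rcases le_or_gt ((q + 1) * 2 ^ s) p with h2 | h2
    · exact Or.inr (Or.inl (Nat.mul_le_mul_right _ h2))
    · exact Or.inr (Or.inr ⟨Nat.mul_le_mul_right _ (by omega), Nat.mul_le_mul_right _ (by omega)⟩)

theorem IsTestedKernel.abs_pair_latCell_le_of_le (h : IsTestedKernel σ w k X) {x₀ ℓ : ℝ}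
    (hℓ : 0 < ℓ) (hσ : ∀ n : ℕ, σ {x₀ + n * ℓ} = 0) (hw : ∀ n : ℕ, w {x₀ + n * ℓ} = 0)
    {i n : ℕ} (hin : i ≤ n) (p q : ℕ) :
    |pair k σ w (latCell x₀ (2 ^ i * ℓ) p) (latCell x₀ (2 ^ n * ℓ) q)|
      ≤ 13 * X * (√(σ.real (latCell x₀ (2 ^ i * ℓ) p))
        * √(w.real (latCell x₀ (2 ^ n * ℓ) q))) := by
  have hX := h.X_pos
  rw [latCell_pow, latCell_pow]
  have h613 : ∀ a : ℝ, 0 ≤ a → 6 * X * a ≤ 13 * X * a := fun a ha => by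
    have := mul_nonneg hX.le ha
    linarith
  rcases node_separated_or_nested hin p q with h1 | h1 | ⟨h1, h2⟩
  · exact (h.abs_pair_right_le (by gcongr) (hw _)).trans (h613 _ (by positivity))
  · exact (h.abs_pair_left_le (by gcongr) (hσ _)).trans (h613 _ (by positivity))
  · refine h.abs_pair_nested_le (by gcongr) ?_ (by gcongr) (hσ _) (hw _)
    have : p * 2 ^ i < (p + 1) * 2 ^ i :=
      Nat.mul_lt_mul_of_pos_right (Nat.lt_succ_self p) (by positivity)
    gcongr

theorem IsTestedKernel.lattice_wb (h : IsTestedKernel σ w k X) {x₀ ℓ : ℝ} (hℓ : 0 < ℓ)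
    (hσ : ∀ n : ℕ, σ {x₀ + n * ℓ} = 0) (hw : ∀ n : ℕ, w {x₀ + n * ℓ} = 0) (i p n q : ℕ) :
    |∑ l ∈ node i p, ∑ m ∈ node n q, latForm k σ w x₀ ℓ l m|
      ≤ 13 * X * √(mass (fun l => latMeas σ x₀ ℓ l) i p)
        * √(mass (fun l => latMeas w x₀ ℓ l) n q) := by
  have e : ∑ l ∈ node i p, ∑ m ∈ node n q, latForm k σ w x₀ ℓ l m
      = pair k σ w (latCell x₀ (2 ^ i * ℓ) p) (latCell x₀ (2 ^ n * ℓ) q) / ℓ := by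
    have e1 : ∀ l : ℕ, ∑ m ∈ node n q, latForm k σ w x₀ ℓ l m
        = pair k σ w (latCell x₀ ℓ l) (latCell x₀ (2 ^ n * ℓ) q) / ℓ := fun l => by
      unfold latForm
      rw [← Finset.sum_div]
      congr 1
      exact h.sum_pair_right x₀ hℓ n q _ _
    simp_rw [e1]
    rw [← Finset.sum_div]
    congr 1
    exact h.sum_pair_left x₀ hℓ i p _ _
  have key : |pair k σ w (latCell x₀ (2 ^ i * ℓ) p) (latCell x₀ (2 ^ n * ℓ) q)|
      ≤ 13 * X * (√(σ.real (latCell x₀ (2 ^ i * ℓ) p))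
        * √(w.real (latCell x₀ (2 ^ n * ℓ) q))) := by
    rcases le_total i n with hin | hin
    · exact h.abs_pair_latCell_le_of_le hℓ hσ hw hin p q
    · rw [latCell, latCell, ← h.pair_swap, mul_comm (√_)]
      exact h.swap.abs_pair_latCell_le_of_le hℓ hw hσ hin q p
  rw [e, mass_latMeas σ x₀ hℓ, mass_latMeas w x₀ hℓ, abs_div, abs_of_pos hℓ,
    Real.sqrt_div measureReal_nonneg, Real.sqrt_div measureReal_nonneg]
  calc _ ≤ 13 * X * (√(σ.real (latCell x₀ (2 ^ i * ℓ) p))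
        * √(w.real (latCell x₀ (2 ^ n * ℓ) q))) / (√ℓ * √ℓ) := by
        rw [Real.mul_self_sqrt hℓ.le]; gcongr
    _ = _ := by field_simp

theorem IsTestedKernel.lattice_reg (h : IsTestedKernel σ w k X) (x₀ : ℝ) {ℓ : ℝ} (hℓ : 0 < ℓ)
    (n j l : ℕ) (ψ : ℕ → ℝ) (hg : 0 < gap l n j)
    (hψ : ∑ m ∈ node n j, ψ m * latMeas w x₀ ℓ m = 0) :
    |∑ m ∈ node n j, latForm k σ w x₀ ℓ l m * ψ m|
      ≤ latMeas σ x₀ ℓ l * (2 ^ n / (gap l n j : ℝ) ^ 2)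
        * ∑ m ∈ node n j, |ψ m| * latMeas w x₀ ℓ m := by
  set u := integralOp k σ ((latCell x₀ ℓ l).indicator 1) with hu
  have huc : Continuous u := h.continuous_integralOp (locallyIntegrable_indicator_one _ _)
  set c := x₀ + j * (2 ^ n * ℓ) with hc
  have hcm : c ∈ latCell x₀ (2 ^ n * ℓ) j :=
    left_mem_Ico.2 (latCell_lt x₀ (show 0 < 2 ^ n * ℓ by positivity) j)
  -- the mean value of `ψ` vanishes, so that a constant may be subtracted
  have e : ∑ m ∈ node n j, latForm k σ w x₀ ℓ l m * ψ m
      = ∑ m ∈ node n j, (latForm k σ w x₀ ℓ l m - u c * latMeas w x₀ ℓ m) * ψ m := by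
    have : ∀ m : ℕ, (latForm k σ w x₀ ℓ l m - u c * latMeas w x₀ ℓ m) * ψ m
        = latForm k σ w x₀ ℓ l m * ψ m - u c * (ψ m * latMeas w x₀ ℓ m) := fun m => by ring
    simp_rw [this]
    rw [Finset.sum_sub_distrib, ← Finset.mul_sum, hψ, mul_zero, sub_zero]
  rw [e, Finset.mul_sum]
  refine (Finset.abs_sum_le_sum_abs _ _).trans (Finset.sum_le_sum fun m hm => ?_)
  have hsub : latCell x₀ ℓ m ⊆ latCell x₀ (2 ^ n * ℓ) j := by
    intro x hx
    have h1 : x ∈ latCell x₀ (2 ^ 0 * ℓ) m := by rwa [pow_zero, one_mul]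
    rw [mem_latCell_iff hℓ, node_zero, Finset.mem_singleton] at h1
    rw [mem_latCell_iff hℓ, h1.2]
    exact ⟨h1.1, hm⟩
  have h1 : latForm k σ w x₀ ℓ l m - u c * latMeas w x₀ ℓ m
      = (∫ x in latCell x₀ ℓ m, (u x - u c) ∂w) / ℓ := by
    rw [latCell, integral_sub (integrableOn_Ico_of_continuous huc _ _)
      (integrableOn_Ico_of_continuous continuous_const _ _), setIntegral_const, smul_eq_mul,
      latForm, latMeas, pair, sub_div, mul_div_assoc', mul_comm (w.real _)]
    rfl
  have h2 : |∫ x in latCell x₀ ℓ m, (u x - u c) ∂w|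
      ≤ 2 ^ n * ℓ / (gap l n j * ℓ) ^ 2 * σ.real (latCell x₀ ℓ l) * w.real (latCell x₀ ℓ m) :=
    norm_setIntegral_le_of_norm_le_const (f := fun x => u x - u c) measure_Ico_lt_top
      fun x hx => h.abs_integralOp_sub_le hℓ hg (hsub hx) hcm
  have hg' : 0 < (gap l n j : ℝ) := by exact_mod_cast hg
  rw [abs_mul, h1, abs_div, abs_of_pos hℓ]
  calc _ ≤ 2 ^ n * ℓ / (gap l n j * ℓ) ^ 2 * σ.real (latCell x₀ ℓ l) * w.real (latCell x₀ ℓ m)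
        / ℓ * |ψ m| := by gcongr
    _ = _ := by
      unfold latMeas
      field_simp

theorem IsTestedKernel.lattice_a2 (h : IsTestedKernel σ w k X) (x₀ : ℝ) {ℓ : ℝ} (hℓ : 0 < ℓ)
    (n j M : ℕ) : (∑ q ∈ Finset.range M, mass (fun l => latMeas w x₀ ℓ l) n q
      * (1 / (2 ^ n * (1 + |(j : ℝ) - q|) ^ 2))) * (mass (fun l => latMeas σ x₀ ℓ l) n j / 2 ^ n)
      ≤ X ^ 2 := by
  set L := 2 ^ n * ℓ with hLdef
  have hL : 0 < L := by positivity
  set I := latCell x₀ L j with hI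
  have hvol : volume.real I = L := volume_real_latCell x₀ hL j
  have h2 := h.a2 I (isInterval_latCell x₀ hL j)
  have hσ := measure_mul_le_poisson σ (I := I) measurableSet_Ico
  rw [hvol] at hσ
  have hw : ∑ q ∈ Finset.range M, ENNReal.ofReal (1 / (L * (1 + |(j : ℝ) - q|) ^ 2))
      * w (latCell x₀ L q) ≤ poisson w I := by
    refine le_trans ?_ (setLIntegral_le_lintegral (Ico (x₀ + (0 : ℕ) * L) (x₀ + M * L)) _)
    rw [← sum_latCell (F := fun J => ∫⁻ x in J, ENNReal.ofReal
      (volume.real I / (volume.real I + Metric.infDist x I) ^ 2) ∂w) (by simp)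
      (lintegral_Ico_add w _) x₀ hL (Nat.zero_le M), ← Finset.range_eq_Ico]
    refine Finset.sum_le_sum fun q _ => ?_
    rw [← setLIntegral_const]
    refine setLIntegral_mono' measurableSet_Ico fun x hx => ENNReal.ofReal_le_ofReal ?_
    obtain ⟨hx1, hx2⟩ := hx
    have hd : Metric.infDist x I ≤ |(j : ℝ) - q| * L := by
      rcases lt_trichotomy q j with hqj | hqj | hqj
      · have : (q : ℝ) + 1 ≤ j := by exact_mod_cast hqj
        have h3 := mul_le_mul_of_nonneg_right this hL.le
        refine (infDist_Ico_le (latCell_lt x₀ hL j)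
          (left_mem_Icc.2 (latCell_lt x₀ hL j).le) x).trans ?_
        rw [abs_of_nonneg (show (0 : ℝ) ≤ j - q by linarith), abs_sub_comm, abs_of_nonneg] <;>
          linarith
      · rw [← hqj] at hI
        rw [Metric.infDist_zero_of_mem (by rw [hI]; exact ⟨hx1, hx2⟩)]
        positivity
      · have : (j : ℝ) + 1 ≤ q := by exact_mod_cast hqj
        have h3 := mul_le_mul_of_nonneg_right this hL.le
        refine (infDist_Ico_le (latCell_lt x₀ hL j)
          (right_mem_Icc.2 (latCell_lt x₀ hL j).le) x).trans ?_
        rw [abs_of_nonpos (show (j : ℝ) - q ≤ 0 by linarith), abs_of_nonneg] <;> linarith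
    have hd0 : 0 ≤ Metric.infDist x I := Metric.infDist_nonneg
    rw [hvol, div_le_div_iff₀ (by positivity) (by positivity), one_mul]
    calc (L + Metric.infDist x I) ^ 2 ≤ (L + |(j : ℝ) - q| * L) ^ 2 := by gcongr
      _ = _ := by ring
  have h3 := (mul_le_mul' hσ hw).trans h2
  have e1 : ∀ q : ℕ, ENNReal.ofReal (1 / (L * (1 + |(j : ℝ) - q|) ^ 2)) * w (latCell x₀ L q)
      = ENNReal.ofReal (1 / (L * (1 + |(j : ℝ) - q|) ^ 2) * w.real (latCell x₀ L q)) := fun q => by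
    rw [ENNReal.ofReal_mul (by positivity), ofReal_measureReal (measure_latCell_ne_top w x₀ L q)]
  simp_rw [e1] at h3
  rw [← ENNReal.ofReal_sum_of_nonneg fun q _ => by positivity,
    ← ofReal_measureReal (μ := σ) (s := I) (measure_latCell_ne_top σ x₀ L j),
    ← ENNReal.ofReal_mul (by positivity), ← ENNReal.ofReal_mul (by positivity),
    ENNReal.ofReal_le_ofReal_iff (sq_nonneg X)] at h3
  refine le_trans (le_of_eq ?_) h3
  rw [mass_latMeas σ x₀ hℓ, mul_comm]
  simp_rw [mass_latMeas w x₀ hℓ]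
  congr 1
  · rw [← hLdef, ← hI, hLdef, mul_inv]; field_simp
  · refine Finset.sum_congr rfl fun q _ => ?_
    rw [hLdef]; field_simp

theorem IsTestedKernel.lattice_piv (h : IsTestedKernel σ w k X) {x₀ ℓ : ℝ} (hℓ : 0 < ℓ)
    (hσ : ∀ n : ℕ, σ {x₀ + n * ℓ} = 0) (hw : ∀ n : ℕ, w {x₀ + n * ℓ} = 0) (n j : ℕ)
    (𝒬 : Finset (ℕ × ℕ)) (hsub : ∀ p ∈ 𝒬, node p.1 p.2 ⊆ node n j)
    (hdisj : ∀ p ∈ 𝒬, ∀ p' ∈ 𝒬, p ≠ p' → Disjoint (node p.1 p.2) (node p'.1 p'.2)) :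
    ∑ p ∈ 𝒬, pois (fun l => latMeas σ x₀ ℓ l) (node n j) p.1 p.2 ^ 2
      * mass (fun l => latMeas w x₀ ℓ l) p.1 p.2
      ≤ (4 * X) ^ 2 * mass (fun l => latMeas σ x₀ ℓ l) n j := by
  classical
  have hX := h.X_pos
  set N : ℕ × ℕ → Set ℝ := fun p => latCell x₀ (2 ^ p.1 * ℓ) p.2 with hN
  have hNL : ∀ p : ℕ × ℕ, 0 < 2 ^ p.1 * ℓ := fun p => by positivity
  have hNI : ∀ p, IsInterval (N p) := fun p => isInterval_latCell x₀ (hNL p) _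
  have hNf : ∀ p, NoEndpointMass σ w (N p) := by
    intro p x hx
    have hlt := latCell_lt x₀ (hNL p) p.2
    simp only [hN] at hx
    have e := latCell_pow x₀ ℓ p.1 p.2
    rw [e, frontier_Ico] at hx
    · rcases hx with rfl | rfl
      · exact ⟨hσ _, hw _⟩
      · exact ⟨hσ _, hw _⟩
    · have : p.2 * 2 ^ p.1 < (p.2 + 1) * 2 ^ p.1 :=
        Nat.mul_lt_mul_of_pos_right (Nat.lt_succ_self _) (by positivity)
      gcongr
  -- the family is completed to a partition by the leaves that it does not cover
  set 𝒬' : Finset (ℕ × ℕ) := 𝒬 ∪ ((node n j).filter fun l => ∀ p ∈ 𝒬, l ∉ node p.1 p.2).image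
    (fun l => (0, l)) with h𝒬'
  have hcov : ∀ l ∈ node n j, ∃ p ∈ 𝒬', l ∈ node p.1 p.2 := by
    intro l hl
    by_cases hp : ∃ p ∈ 𝒬, l ∈ node p.1 p.2
    · obtain ⟨p, hp, hlp⟩ := hp
      exact ⟨p, Finset.mem_union_left _ hp, hlp⟩
    · push Not at hp
      refine ⟨(0, l), Finset.mem_union_right _ (Finset.mem_image_of_mem _
        (Finset.mem_filter.2 ⟨hl, hp⟩)), ?_⟩
      rw [node_zero]; exact Finset.mem_singleton_self l
  have hsub' : ∀ p ∈ 𝒬', node p.1 p.2 ⊆ node n j := by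
    intro p hp
    rcases Finset.mem_union.1 hp with hp | hp
    · exact hsub p hp
    · obtain ⟨l, hl, rfl⟩ := Finset.mem_image.1 hp
      rw [node_zero, Finset.singleton_subset_iff]
      exact (Finset.mem_filter.1 hl).1
  have hdisj' : ∀ p ∈ 𝒬', ∀ p' ∈ 𝒬', p ≠ p' → Disjoint (node p.1 p.2) (node p'.1 p'.2) := by
    intro p hp p' hp' hne
    rcases Finset.mem_union.1 hp with hp | hp <;> rcases Finset.mem_union.1 hp' with hp' | hp'
    · exact hdisj p hp p' hp' hne
    · obtain ⟨l, hl, rfl⟩ := Finset.mem_image.1 hp'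
      rw [node_zero, Finset.disjoint_singleton_right]
      exact (Finset.mem_filter.1 hl).2 p hp
    · obtain ⟨l, hl, rfl⟩ := Finset.mem_image.1 hp
      rw [node_zero, Finset.disjoint_singleton_left]
      exact (Finset.mem_filter.1 hl).2 p' hp'
    · obtain ⟨l, hl, rfl⟩ := Finset.mem_image.1 hp
      obtain ⟨l', hl', rfl⟩ := Finset.mem_image.1 hp'
      rw [node_zero, node_zero, Finset.disjoint_singleton]
      rintro rfl
      exact hne rfl
  have hND : ∀ p ∈ 𝒬', ∀ p' ∈ 𝒬', p ≠ p' → Disjoint (N p) (N p') := by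
    intro p hp p' hp' hne
    refine Set.disjoint_left.2 fun x hx hx' => ?_
    simp only [hN] at hx hx'
    exact Finset.disjoint_left.1 (hdisj' p hp p' hp' hne) ((mem_latCell_iff hℓ _ _).1 hx).2
      ((mem_latCell_iff hℓ _ _).1 hx').2
  have hpart : IsIntervalPartition (N '' (𝒬' : Set (ℕ × ℕ))) (N (n, j)) := by
    refine ⟨?_, ?_, ?_⟩
    · rintro _ ⟨p, _, rfl⟩; exact hNI p
    · rintro _ ⟨p, hp, rfl⟩ _ ⟨p', hp', rfl⟩ hne
      exact hND p hp p' hp' fun hpp => hne (by rw [hpp])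
    · ext x
      simp only [mem_sUnion, mem_image, exists_exists_and_eq_and, Finset.mem_coe]
      simp only [hN, mem_latCell_iff hℓ]
      constructor
      · rintro ⟨p, hp, hx0, hx⟩; exact ⟨hx0, hsub' p hp hx⟩
      · rintro ⟨hx0, hx⟩
        obtain ⟨p, hp, hxp⟩ := hcov _ hx
        exact ⟨p, hp, hx0, hxp⟩
  have hpiv := h.piv (N (n, j)) _ (hNI _) hpart (hNf _) (by rintro _ ⟨p, _, rfl⟩; exact hNf p)
  have hinj : Function.Injective (fun p : (𝒬 : Set (ℕ × ℕ)) =>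
      (⟨N p, p, Finset.mem_union_left _ p.2, rfl⟩ : ↥(N '' (𝒬' : Set (ℕ × ℕ))))) := by
    intro p p' hpp
    by_contra hne
    have h1 := hND p (Finset.mem_union_left _ p.2) p' (Finset.mem_union_left _ p'.2)
      fun hc => hne (Subtype.ext hc)
    have h2 : N p = N p' := congrArg Subtype.val hpp
    rw [h2, disjoint_self] at h1
    have h3 : (N p').Nonempty := nonempty_Ico.2 (latCell_lt x₀ (hNL p') _)
    exact h3.ne_empty h1
  have hle := (ENNReal.tsum_comp_le_tsum_of_injective hinj fun I =>
    poisson (σ.restrict (N (n, j))) (I : Set ℝ) ^ 2 * w (I : Set ℝ)).trans hpiv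
  simp only at hle
  rw [Finset.tsum_subtype' 𝒬 fun p => poisson (σ.restrict (N (n, j))) (N p) ^ 2 * w (N p)] at hle
  have hpois : ∀ p, ENNReal.ofReal (pois (fun l => latMeas σ x₀ ℓ l) (node n j) p.1 p.2 / 4)
      ≤ poisson (σ.restrict (N (n, j))) (N p) := by
    intro p
    have hvol : volume.real (N p) = 2 ^ p.1 * ℓ := volume_real_latCell x₀ (hNL p) _
    have e : poisson (σ.restrict (N (n, j))) (N p) = ∑ l ∈ node n j, ∫⁻ x in latCell x₀ ℓ l,
        ENNReal.ofReal (volume.real (N p) / (volume.real (N p) + Metric.infDist x (N p)) ^ 2) ∂σ :=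
      (sum_node_latCell (F := fun J => ∫⁻ x in J, ENNReal.ofReal
        (volume.real (N p) / (volume.real (N p) + Metric.infDist x (N p)) ^ 2) ∂σ) (by simp)
        (lintegral_Ico_add σ _) x₀ hℓ n j).symm
    rw [e, pois, Finset.sum_div, ENNReal.ofReal_sum_of_nonneg fun l _ => by
      have := latMeas_nonneg σ x₀ hℓ l
      positivity]
    refine Finset.sum_le_sum fun l _ => ?_
    have e2 : latMeas σ x₀ ℓ l * (2 ^ p.1 / (2 ^ p.1 + (gap l p.1 p.2 : ℝ)) ^ 2) / 4
        = 2 ^ p.1 / (4 * ℓ * (2 ^ p.1 + (gap l p.1 p.2 : ℝ)) ^ 2) * σ.real (latCell x₀ ℓ l) := by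
      unfold latMeas
      field_simp
    rw [e2, ENNReal.ofReal_mul (by positivity), ofReal_measureReal (measure_latCell_ne_top _ _ _ _),
      ← setLIntegral_const]
    refine setLIntegral_mono' measurableSet_Ico fun x hx => ENNReal.ofReal_le_ofReal ?_
    have hd : Metric.infDist x (N p) ≤ (gap l p.1 p.2 + 1) * ℓ := infDist_latCell_le hℓ hx
    have hd0 : 0 ≤ Metric.infDist x (N p) := Metric.infDist_nonneg
    rw [hvol, div_le_div_iff₀ (by positivity) (by positivity)]
    have h1 : (1 : ℝ) ≤ 2 ^ p.1 := one_le_pow₀ one_le_two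
    have h2 : 2 ^ p.1 * ℓ + Metric.infDist x (N p) ≤ 2 * ℓ * (2 ^ p.1 + gap l p.1 p.2) := by
      have := mul_le_mul_of_nonneg_right h1 hℓ.le
      have : 0 ≤ (gap l p.1 p.2 : ℝ) * ℓ := by positivity
      linarith
    calc 2 ^ p.1 * (2 ^ p.1 * ℓ + Metric.infDist x (N p)) ^ 2
        ≤ 2 ^ p.1 * (2 * ℓ * (2 ^ p.1 + gap l p.1 p.2)) ^ 2 := by gcongr
      _ = _ := by ring
  have hnn : ∀ p : ℕ × ℕ, 0 ≤ pois (fun l => latMeas σ x₀ ℓ l) (node n j) p.1 p.2 := fun p =>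
    Finset.sum_nonneg fun l _ => by
      have := latMeas_nonneg σ x₀ hℓ l
      positivity
  have hle2 : ∑ p ∈ 𝒬, ENNReal.ofReal ((pois (fun l => latMeas σ x₀ ℓ l) (node n j) p.1 p.2 / 4) ^ 2
      * w.real (N p)) ≤ ENNReal.ofReal (X ^ 2 * σ.real (N (n, j))) := by
    refine le_trans (Finset.sum_le_sum fun p _ => ?_) (hle.trans (le_of_eq ?_))
    · rw [ENNReal.ofReal_mul (by positivity), ofReal_measureReal (measure_latCell_ne_top _ _ _ _),
        ENNReal.ofReal_pow (by have := hnn p; positivity)]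
      gcongr
      exact hpois p
    · rw [ENNReal.ofReal_mul (by positivity), ofReal_measureReal (measure_latCell_ne_top _ _ _ _),
        ENNReal.ofReal_pow hX.le]
  rw [← ENNReal.ofReal_sum_of_nonneg (fun p _ => by positivity),
    ENNReal.ofReal_le_ofReal_iff (by positivity)] at hle2
  rw [mass_latMeas σ x₀ hℓ]
  simp_rw [mass_latMeas w x₀ hℓ]
  calc _ = 16 / ℓ * ∑ p ∈ 𝒬, (pois (fun l => latMeas σ x₀ ℓ l) (node n j) p.1 p.2 / 4) ^ 2
        * w.real (N p) := by
        rw [Finset.mul_sum]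
        refine Finset.sum_congr rfl fun p _ => ?_
        simp only [hN]
        ring
    _ ≤ 16 / ℓ * (X ^ 2 * σ.real (N (n, j))) := by gcongr
    _ = _ := by simp only [hN]; ring

/-- The discretization of a tested kernel satisfies the hypotheses of the bound for forms on a
lattice, if the lattice avoids the point masses. -/
theorem IsTestedKernel.ctrl (h : IsTestedKernel σ w k X) {x₀ ℓ : ℝ} (hℓ : 0 < ℓ)
    (hσ : ∀ n : ℕ, σ {x₀ + n * ℓ} = 0) (hw : ∀ n : ℕ, w {x₀ + n * ℓ} = 0) :
    Ctrl (fun l => latMeas σ x₀ ℓ l) (fun l => latMeas w x₀ ℓ l)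
      (fun l m => latForm k σ w x₀ ℓ l m) (13 * X) where
  s_nonneg l := latMeas_nonneg σ x₀ hℓ l
  v_nonneg l := latMeas_nonneg w x₀ hℓ l
  X_pos := by have := h.X_pos; positivity
  test n j ψ := (h.lattice_test x₀ hℓ n j ψ).trans (by
    have := h.X_pos
    gcongr
    linarith)
  wb := h.lattice_wb hℓ hσ hw
  reg := h.lattice_reg x₀ hℓ
  a2 n j M := (h.lattice_a2 x₀ hℓ n j M).trans (by
    have := h.X_pos
    gcongr
    linarith)
  piv n j 𝒬 hsub hdisj := (h.lattice_piv hℓ hσ hw n j 𝒬 hsub hdisj).trans (by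
    have := h.X_pos
    gcongr
    · exact mass_nonneg (latMeas_nonneg σ x₀ hℓ ·) _ _
    · linarith)

end

section

/-! ### Step functions -/

/-- The step function on the first `2 ^ n` cells of the lattice with the values `φ`. -/
noncomputable def step (x₀ ℓ : ℝ) (n : ℕ) (φ : ℕ → ℝ) (x : ℝ) : ℝ :=
  ∑ l ∈ Finset.range (2 ^ n), φ l * (latCell x₀ ℓ l).indicator 1 x

theorem mem_latCell_iff_floor {x₀ ℓ x : ℝ} (hℓ : 0 < ℓ) (l : ℕ) :
    x ∈ latCell x₀ ℓ l ↔ x₀ ≤ x ∧ ⌊(x - x₀) / ℓ⌋₊ = l := by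
  have := mem_latCell_iff (x₀ := x₀) (x := x) hℓ 0 l
  rwa [pow_zero, one_mul, node_zero, Finset.mem_singleton] at this

theorem step_eq_ite (x₀ : ℝ) {ℓ : ℝ} (hℓ : 0 < ℓ) (n : ℕ) (φ : ℕ → ℝ) (x : ℝ) : step x₀ ℓ n φ x
    = if x₀ ≤ x ∧ ⌊(x - x₀) / ℓ⌋₊ < 2 ^ n then φ ⌊(x - x₀) / ℓ⌋₊ else 0 := by
  unfold step
  split_ifs with h
  · rw [Finset.sum_eq_single_of_mem _ (Finset.mem_range.2 h.2)]
    · rw [indicator_of_mem ((mem_latCell_iff_floor hℓ _).2 ⟨h.1, rfl⟩), Pi.one_apply, mul_one]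
    · intro l _ hne
      rw [indicator_of_notMem, mul_zero]
      exact fun hx => hne ((mem_latCell_iff_floor hℓ _).1 hx).2.symm
  · refine Finset.sum_eq_zero fun l hl => ?_
    rw [indicator_of_notMem, mul_zero]
    intro hx
    rw [mem_latCell_iff_floor hℓ] at hx
    exact h ⟨hx.1, by rw [hx.2]; exact Finset.mem_range.1 hl⟩

theorem step_sq (x₀ : ℝ) {ℓ : ℝ} (hℓ : 0 < ℓ) (n : ℕ) (φ : ℕ → ℝ) (x : ℝ) :
    step x₀ ℓ n φ x ^ 2 = step x₀ ℓ n (fun l => φ l ^ 2) x := by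
  rw [step_eq_ite x₀ hℓ, step_eq_ite x₀ hℓ]
  split_ifs <;> simp

/-- The step function that samples `f` takes at each point a value of `f` at a nearby point. -/
theorem exists_step_eq (x₀ : ℝ) {ℓ : ℝ} (hℓ : 0 < ℓ) (n : ℕ) {f : ℝ → ℝ}
    (hf : ∀ x, x < x₀ ∨ x₀ + 2 ^ n * ℓ ≤ x → f x = 0) (x : ℝ) :
    ∃ z, |z - x| ≤ ℓ ∧ step x₀ ℓ n (fun l => f (x₀ + l * ℓ)) x = f z := by
  rw [step_eq_ite x₀ hℓ]
  split_ifs with h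
  · have h3 : 0 ≤ (x - x₀) / ℓ := div_nonneg (by linarith) hℓ.le
    refine ⟨_, ?_, rfl⟩
    have h1 := Nat.floor_le h3
    have h2 := Nat.lt_floor_add_one ((x - x₀) / ℓ)
    rw [le_div_iff₀ hℓ] at h1
    rw [div_lt_iff₀ hℓ] at h2
    rw [abs_le]
    constructor <;> linarith
  · refine ⟨x, by simpa using hℓ.le, (hf x ?_).symm⟩
    by_contra hx
    push Not at hx
    have h3 : 0 ≤ (x - x₀) / ℓ := div_nonneg (by linarith) hℓ.le
    refine h ⟨hx.1, (Nat.floor_lt h3).2 ?_⟩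
    rw [div_lt_iff₀ hℓ]
    push_cast
    linarith

theorem integrable_latCell_indicator (μ : Measure ℝ) [IsLocallyFiniteMeasure μ] (x₀ ℓ t : ℝ) :
    Integrable ((latCell x₀ ℓ t).indicator (1 : ℝ → ℝ)) μ :=
  (integrable_indicator_iff measurableSet_Ico).2
    (integrableOn_Ico_of_continuous continuous_one _ _)

theorem integrable_step (μ : Measure ℝ) [IsLocallyFiniteMeasure μ] (x₀ ℓ : ℝ) (n : ℕ)
    (φ : ℕ → ℝ) : Integrable (step x₀ ℓ n φ) μ :=
  integrable_finsetSum _ fun l _ => (integrable_latCell_indicator μ x₀ ℓ l).const_mul (φ l)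

theorem integral_step (μ : Measure ℝ) [IsLocallyFiniteMeasure μ] (x₀ : ℝ) {ℓ : ℝ} (hℓ : 0 < ℓ)
    (n : ℕ) (φ : ℕ → ℝ) : ∫ x, step x₀ ℓ n φ x ∂μ
      = ℓ * ∑ l ∈ Finset.range (2 ^ n), φ l * latMeas μ x₀ ℓ l := by
  unfold step
  rw [integral_finsetSum _ fun (l : ℕ) _ =>
    (integrable_latCell_indicator μ x₀ ℓ (l : ℝ)).const_mul (φ l), Finset.mul_sum]
  refine Finset.sum_congr rfl fun l _ => ?_
  rw [integral_const_mul, integral_indicator_one (by exact measurableSet_Ico), latMeas]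
  field_simp

theorem integral_step_sq (μ : Measure ℝ) [IsLocallyFiniteMeasure μ] (x₀ : ℝ) {ℓ : ℝ} (hℓ : 0 < ℓ)
    (n : ℕ) (φ : ℕ → ℝ) : ∫ x, step x₀ ℓ n φ x ^ 2 ∂μ
      = ℓ * tsq n (fun l => latMeas μ x₀ ℓ l) φ := by
  simp_rw [step_sq x₀ hℓ]
  exact integral_step μ x₀ hℓ n _

theorem memLp_step (μ : Measure ℝ) [IsLocallyFiniteMeasure μ] (x₀ : ℝ) {ℓ : ℝ} (hℓ : 0 < ℓ)
    (n : ℕ) (φ : ℕ → ℝ) : MemLp (step x₀ ℓ n φ) 2 μ := by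
  rw [memLp_two_iff_integrable_sq (integrable_step μ x₀ ℓ n φ).aestronglyMeasurable]
  simp_rw [step_sq x₀ hℓ]
  exact integrable_step μ x₀ ℓ n _

/-! ### Norms and pairings -/

theorem eLpNorm_two_sq {μ : Measure ℝ} (f : ℝ → ℝ) : eLpNorm f 2 μ ^ 2 = ∫⁻ x, ‖f x‖ₑ ^ 2 ∂μ := by
  rw [eLpNorm_eq_lintegral_rpow_enorm_toReal two_ne_zero ENNReal.ofNat_ne_top]
  simp only [ENNReal.toReal_ofNat, ENNReal.rpow_ofNat, one_div]
  rw [← ENNReal.rpow_mul_natCast]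
  norm_num

theorem eLpNorm_two_sq_eq_ofReal {μ : Measure ℝ} {f : ℝ → ℝ} (hf : MemLp f 2 μ) :
    eLpNorm f 2 μ ^ 2 = ENNReal.ofReal (∫ x, f x ^ 2 ∂μ) := by
  rw [eLpNorm_two_sq, ofReal_integral_eq_lintegral_ofReal hf.integrable_sq
    (Filter.Eventually.of_forall fun x => sq_nonneg _)]
  refine lintegral_congr fun x => ?_
  rw [← sq_abs, ENNReal.ofReal_pow (abs_nonneg _), Real.enorm_eq_ofReal_abs]

/-- A function that is dominated by averages over balls is controlled by the `A₂` condition. -/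
theorem eLpNorm_le_of_le_average {σ w : Measure ℝ} [SFinite σ] [SFinite w] {X : ℝ} (hX : 0 ≤ X)
    (hA : ∀ I, IsInterval I → poisson σ I * poisson w I ≤ ENNReal.ofReal (X ^ 2)) {R c : ℝ}
    (hR : 0 < R) {f u : ℝ → ℝ} (hf : AEStronglyMeasurable f σ)
    (hu : ∀ x, ‖u x‖ₑ ≤ ENNReal.ofReal c * ∫⁻ y in Metric.ball x R, ‖f y‖ₑ ∂σ) :
    eLpNorm u 2 w ≤ ENNReal.ofReal (c * (4 * R * X)) * eLpNorm f 2 σ := by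
  rw [← ENNReal.pow_le_pow_left_iff two_ne_zero, mul_pow, eLpNorm_two_sq, eLpNorm_two_sq]
  have hg := hf.enorm
  set g := hg.mk _ with hgdef
  have hgm : Measurable g := hg.measurable_mk
  have hfg : (fun y => ‖f y‖ₑ) =ᵐ[σ] g := hg.ae_eq_mk
  have h1 : ∫⁻ y, ‖f y‖ₑ ^ 2 ∂σ = ∫⁻ y, g y ^ 2 ∂σ :=
    lintegral_congr_ae (hfg.mono fun y hy => by simp only [hy])
  have h2 : ∀ x, ∫⁻ y in Metric.ball x R, ‖f y‖ₑ ∂σ = ∫⁻ y in Metric.ball x R, g y ∂σ :=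
    fun x => lintegral_congr_ae (ae_restrict_of_ae hfg)
  rw [h1]
  calc ∫⁻ x, ‖u x‖ₑ ^ 2 ∂w
      ≤ ∫⁻ x, ENNReal.ofReal c ^ 2 * (∫⁻ y in Metric.ball x R, g y ∂σ) ^ 2 ∂w := by
        refine lintegral_mono fun x => ?_
        rw [← mul_pow, ← h2]
        exact pow_le_pow_left₀ zero_le (hu x) 2
    _ = ENNReal.ofReal c ^ 2 * ∫⁻ x, (∫⁻ y in Metric.ball x R, g y ∂σ) ^ 2 ∂w :=
        lintegral_const_mul' _ _ (by finiteness)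
    _ ≤ ENNReal.ofReal c ^ 2 * (ENNReal.ofReal ((4 * R) ^ 2) * ENNReal.ofReal (X ^ 2)
        * ∫⁻ y, g y ^ 2 ∂σ) := by
        gcongr
        exact lintegral_sq_average_le hA hR hgm
    _ = _ := by
        rw [ENNReal.ofReal_mul' (p := c) (by positivity), mul_pow (ENNReal.ofReal c),
          ENNReal.ofReal_mul (p := 4 * R) (by positivity), mul_pow (ENNReal.ofReal (4 * R)),
          ENNReal.ofReal_pow (by positivity), ENNReal.ofReal_pow hX]
        ring

variable {σ w : Measure ℝ} {k : ℝ → ℝ → ℝ} {X : ℝ}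

theorem locallyIntegrable_of_memLp_two [IsLocallyFiniteMeasure σ] {f : ℝ → ℝ} (hf : MemLp f 2 σ) :
    LocallyIntegrable f σ :=
  hf.locallyIntegrable (by norm_num)

/-- The operator of a tested kernel is bounded, with a norm that depends on the truncation. -/
theorem IsTestedKernel.exists_eLpNorm_le [IsLocallyFiniteMeasure σ] [IsLocallyFiniteMeasure w]
    (h : IsTestedKernel σ w k X) : ∃ N : ℝ, 0 ≤ N ∧ ∀ f, MemLp f 2 σ →
      eLpNorm (integralOp k σ f) 2 w ≤ ENNReal.ofReal N * eLpNorm f 2 σ := by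
  obtain ⟨M, hM⟩ := h.bdd
  obtain ⟨R, hR⟩ := h.supp
  have hM0 : 0 ≤ M := (abs_nonneg _).trans (hM 0 0)
  have hX := h.X_pos
  have hR' : 0 < max R 1 := lt_max_of_lt_right one_pos
  refine ⟨M * (4 * max R 1 * X), by positivity, fun f hf => ?_⟩
  refine eLpNorm_le_of_le_average hX.le h.a2 hR' hf.1 fun x => ?_
  refine (enorm_integral_le_lintegral_enorm _).trans ?_
  rw [← lintegral_const_mul' _ _ ENNReal.ofReal_ne_top,
    ← lintegral_indicator Metric.isOpen_ball.measurableSet]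
  refine lintegral_mono fun y => ?_
  by_cases hy : y ∈ Metric.ball x (max R 1)
  · rw [indicator_of_mem hy, enorm_mul]
    gcongr
    rw [Real.enorm_eq_ofReal_abs]
    exact ENNReal.ofReal_le_ofReal (hM x y)
  · rw [indicator_of_notMem hy, hR x y, zero_mul, enorm_zero]
    rw [Metric.mem_ball, not_lt, dist_comm, Real.dist_eq] at hy
    exact (le_max_left _ _).trans hy

theorem enorm_integral_mul_le {μ : Measure ℝ} {u v : ℝ → ℝ} (hu : AEStronglyMeasurable u μ)
    (hv : AEStronglyMeasurable v μ) :
    ‖∫ x, u x * v x ∂μ‖ₑ ≤ eLpNorm u 2 μ * eLpNorm v 2 μ := by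
  rw [← ENNReal.pow_le_pow_left_iff two_ne_zero, mul_pow, eLpNorm_two_sq, eLpNorm_two_sq]
  refine le_trans ?_ (sq_lintegral_mul_le μ hu.enorm hv.enorm)
  refine pow_le_pow_left₀ zero_le ((enorm_integral_le_lintegral_enorm _).trans (le_of_eq ?_)) 2
  exact lintegral_congr fun x => enorm_mul _ _

theorem ofReal_sqrt_integral_sq {μ : Measure ℝ} {f : ℝ → ℝ} (hf : MemLp f 2 μ) :
    ENNReal.ofReal √(∫ x, f x ^ 2 ∂μ) = eLpNorm f 2 μ := by
  refine (ENNReal.pow_right_strictMono two_ne_zero).injective ?_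
  rw [eLpNorm_two_sq_eq_ofReal hf,
    ← ENNReal.ofReal_pow (Real.sqrt_nonneg _), Real.sq_sqrt (integral_nonneg fun x => sq_nonneg _)]

theorem abs_pairing_le {N : ℝ} (hN0 : 0 ≤ N) {f g u : ℝ → ℝ} (hf : MemLp f 2 σ) (hg : MemLp g 2 w)
    (hu : AEStronglyMeasurable u w)
    (hN : eLpNorm u 2 w ≤ ENNReal.ofReal N * eLpNorm f 2 σ) :
    |∫ x, u x * g x ∂w| ≤ N * √(∫ x, f x ^ 2 ∂σ) * √(∫ x, g x ^ 2 ∂w) := by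
  rw [← ENNReal.ofReal_le_ofReal_iff (by positivity), ENNReal.ofReal_mul (by positivity),
    ENNReal.ofReal_mul hN0, ofReal_sqrt_integral_sq hf, ofReal_sqrt_integral_sq hg,
    ← Real.enorm_eq_ofReal_abs]
  exact (enorm_integral_mul_le hu hg.1).trans (by gcongr)

variable [IsLocallyFiniteMeasure σ] [IsLocallyFiniteMeasure w]

theorem IsTestedKernel.integral_step_mul (h : IsTestedKernel σ w k X) (x₀ : ℝ) {ℓ : ℝ}
    (hℓ : 0 < ℓ) (n : ℕ) (φ ψ : ℕ → ℝ) :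
    ∫ x, integralOp k σ (step x₀ ℓ n φ) x * step x₀ ℓ n ψ x ∂w
      = ℓ * form n (fun l m => latForm k σ w x₀ ℓ l m) φ ψ := by
  have h1 : ∀ x, integralOp k σ (step x₀ ℓ n φ) x
      = ∑ l ∈ Finset.range (2 ^ n), φ l * integralOp k σ ((latCell x₀ ℓ l).indicator 1) x := by
    intro x
    unfold integralOp step
    simp_rw [Finset.mul_sum]
    rw [integral_finsetSum]
    · refine Finset.sum_congr rfl fun l _ => ?_
      rw [← integral_const_mul]
      congr 1; ext y; ring
    · intro l _
      have := (h.integrable_mul (locallyIntegrable_indicator_one (x₀ + l * ℓ)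
        (x₀ + (l + 1) * ℓ)) x).const_mul (φ l)
      refine this.congr (Filter.Eventually.of_forall fun y => ?_)
      simp only [latCell]; ring
  have hc : ∀ l : ℕ, Continuous (integralOp k σ ((latCell x₀ ℓ l).indicator 1)) := fun l =>
    h.continuous_integralOp (locallyIntegrable_indicator_one _ _)
  have hind : ∀ (l m : ℕ) (x : ℝ), φ l * integralOp k σ ((latCell x₀ ℓ l).indicator 1) x
      * (ψ m * (latCell x₀ ℓ m).indicator 1 x) = (latCell x₀ ℓ m).indicator (fun x =>
        φ l * ψ m * integralOp k σ ((latCell x₀ ℓ l).indicator 1) x) x := by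
    intro l m x
    by_cases hx : x ∈ latCell x₀ ℓ m
    · rw [indicator_of_mem hx, indicator_of_mem hx, Pi.one_apply]; ring
    · rw [indicator_of_notMem hx, indicator_of_notMem hx]; ring
  have hint : ∀ l m : ℕ, Integrable ((latCell x₀ ℓ m).indicator (fun x =>
        φ l * ψ m * integralOp k σ ((latCell x₀ ℓ l).indicator 1) x)) w := fun l m =>
    (integrable_indicator_iff measurableSet_Ico).2
      (integrableOn_Ico_of_continuous ((hc l).const_mul _) _ _)
  simp_rw [h1, step, Finset.sum_mul_sum, hind]
  rw [integral_finsetSum _ fun l _ => integrable_finsetSum _ fun m _ => hint l m, form,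
    Finset.mul_sum]
  refine Finset.sum_congr rfl fun l _ => ?_
  rw [integral_finsetSum _ fun m _ => hint l m, Finset.mul_sum]
  refine Finset.sum_congr rfl fun m _ => ?_
  rw [integral_indicator (by exact measurableSet_Ico), integral_const_mul, latForm, pair]
  field_simp

/-- The bound for step functions on a lattice that avoids the point masses. -/
theorem exists_step_le : ∃ K : ℝ, 0 ≤ K ∧ ∀ {σ w : Measure ℝ} {k : ℝ → ℝ → ℝ} {X : ℝ}
    [IsLocallyFiniteMeasure σ] [IsLocallyFiniteMeasure w], IsTestedKernel σ w k X →
    ∀ {x₀ ℓ : ℝ}, 0 < ℓ → (∀ n : ℤ, σ {x₀ + n * ℓ} = 0) → (∀ n : ℤ, w {x₀ + n * ℓ} = 0) →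
    ∀ (b : ℤ) (n : ℕ) (φ ψ : ℕ → ℝ),
      |∫ x, integralOp k σ (step (x₀ + b * ℓ) ℓ n φ) x * step (x₀ + b * ℓ) ℓ n ψ x ∂w|
        ≤ K * X * √(∫ x, step (x₀ + b * ℓ) ℓ n φ x ^ 2 ∂σ)
          * √(∫ x, step (x₀ + b * ℓ) ℓ n ψ x ^ 2 ∂w) := by
  obtain ⟨K, hK0, hK⟩ := exists_form_window_le
  refine ⟨13 * K, by positivity, ?_⟩
  intro σ w k X _ _ h x₀ ℓ hℓ hσ hw
  have hX := h.X_pos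
  have hcell : ∀ (b : ℤ) (l : ℕ), latCell x₀ ℓ ((b + l : ℤ) : ℝ) = latCell (x₀ + b * ℓ) ℓ l :=
    fun b l => by rw [← latCell_add]; push_cast; rfl
  have hmeas : ∀ (μ : Measure ℝ) (b : ℤ), (fun l : ℕ => latMeas μ x₀ ℓ ((b + l : ℤ) : ℝ))
      = fun l : ℕ => latMeas μ (x₀ + b * ℓ) ℓ l := fun μ b => by
    funext l; rw [latMeas, hcell, latMeas]
  have hwin : ∀ b : ℤ, window (fun p q : ℤ => latForm k σ w x₀ ℓ p q) b
      = fun l m : ℕ => latForm k σ w (x₀ + b * ℓ) ℓ l m := fun b => by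
    funext l m; rw [window, latForm, hcell, hcell, latForm]
  have hatom : ∀ {μ : Measure ℝ}, (∀ n : ℤ, μ {x₀ + n * ℓ} = 0) → ∀ (b : ℤ) (n : ℕ),
      μ {x₀ + b * ℓ + n * ℓ} = 0 := fun hμ b n => by
    have := hμ (b + n)
    push_cast at this
    rwa [add_mul, ← add_assoc] at this
  obtain ⟨N, hN0, hN⟩ := h.exists_eLpNorm_le
  have hpair : ∀ {C : ℝ} (b : ℤ) (n : ℕ) (φ ψ : ℕ → ℝ),
      |∫ x, integralOp k σ (step (x₀ + b * ℓ) ℓ n φ) x * step (x₀ + b * ℓ) ℓ n ψ x ∂w|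
        ≤ C * √(∫ x, step (x₀ + b * ℓ) ℓ n φ x ^ 2 ∂σ)
          * √(∫ x, step (x₀ + b * ℓ) ℓ n ψ x ^ 2 ∂w) ↔
      |form n (fun l m => latForm k σ w (x₀ + b * ℓ) ℓ l m) φ ψ|
        ≤ C * √(tsq n (fun l => latMeas σ (x₀ + b * ℓ) ℓ l) φ)
          * √(tsq n (fun l => latMeas w (x₀ + b * ℓ) ℓ l) ψ) := by
    intro C b n φ ψ
    have e : ∀ s t : ℝ, C * (√ℓ * s) * (√ℓ * t) = ℓ * (C * s * t) := fun s t => by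
      calc _ = √ℓ * √ℓ * (C * s * t) := by ring
        _ = _ := by rw [Real.mul_self_sqrt hℓ.le]
    rw [h.integral_step_mul _ hℓ, integral_step_sq σ _ hℓ, integral_step_sq w _ hℓ, abs_mul,
      abs_of_pos hℓ, Real.sqrt_mul hℓ.le, Real.sqrt_mul hℓ.le, e, mul_le_mul_iff_right₀ hℓ]
  intro b n φ ψ
  rw [hpair]
  have key := hK (S := fun p => latMeas σ x₀ ℓ p) (V := fun p => latMeas w x₀ ℓ p)
    (B := fun p q => latForm k σ w x₀ ℓ p q) (X := 13 * X) (N := N) hN0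
    (fun b => by
      rw [hmeas σ, hmeas w, hwin]
      exact h.ctrl hℓ (hatom hσ b) (hatom hw b))
    (fun b => by
      rw [hmeas σ, hmeas w, hwin]
      have e : (fun l m : ℕ => latForm k σ w (x₀ + b * ℓ) ℓ m l)
          = fun l m : ℕ => latForm (adjointKernel k) w σ (x₀ + b * ℓ) ℓ l m := by
        funext l m
        unfold latForm
        congr 1
        exact (h.pair_swap _ _ _ _).symm
      have := h.swap.ctrl hℓ (hatom hw b) (hatom hσ b)
      rwa [← e] at this)
    (fun b n φ ψ => by
      rw [hmeas σ, hmeas w, hwin, ← hpair]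
      exact abs_pairing_le hN0 (memLp_step σ _ hℓ n φ) (memLp_step w _ hℓ n ψ)
        (h.continuous_integralOp
          (integrable_step σ _ ℓ n φ).locallyIntegrable).aestronglyMeasurable
        (hN _ (memLp_step σ _ hℓ n φ)))
    b n φ ψ
  rw [hmeas σ, hmeas w, hwin] at key
  refine key.trans (le_of_eq ?_)
  ring

end

section

/-! ### From step functions to square integrable functions -/

theorem countable_atoms (μ : Measure ℝ) [SFinite μ] : {x | μ {x} ≠ 0}.Countable := by
  have := Measure.countable_meas_level_set_pos (μ := μ) (g := fun x : ℝ => x) measurable_id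
  simpa [pos_iff_ne_zero] using this

theorem exists_lattice_origin (σ w : Measure ℝ) [SFinite σ] [SFinite w] (ℓ : ℕ → ℝ) :
    ∃ x₀ : ℝ, ∀ (m : ℕ) (n : ℤ), σ {x₀ + n * ℓ m} = 0 ∧ w {x₀ + n * ℓ m} = 0 := by
  set D : Set ℝ := {x | σ {x} ≠ 0} ∪ {x | w {x} ≠ 0} with hD
  have hDc : D.Countable := (countable_atoms σ).union (countable_atoms w)
  have hc : (⋃ p : ℕ × ℤ, (fun x => x - p.2 * ℓ p.1) '' D).Countable :=
    countable_iUnion fun p => hDc.image _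
  obtain ⟨x₀, hx₀⟩ := hc.dense_compl ℝ |>.nonempty
  refine ⟨x₀, fun m n => ?_⟩
  have : x₀ + n * ℓ m ∉ D := fun h => hx₀ (mem_iUnion.2 ⟨(m, n), _, h, by simp⟩)
  rw [hD, mem_union, not_or] at this
  simpa using this

theorem tendsto_integral_of_bounded {μ : Measure ℝ} [IsLocallyFiniteMeasure μ] {F : ℕ → ℝ → ℝ}
    {f : ℝ → ℝ} {C r : ℝ} (hm : ∀ n, AEStronglyMeasurable (F n) μ) (hb : ∀ n x, |F n x| ≤ C)
    (hs : ∀ n x, r < |x| → F n x = 0)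
    (hl : ∀ x, Filter.Tendsto (fun n => F n x) Filter.atTop (nhds (f x))) :
    Filter.Tendsto (fun n => ∫ x, F n x ∂μ) Filter.atTop (nhds (∫ x, f x ∂μ)) := by
  refine tendsto_integral_of_dominated_convergence ((Icc (-r) r).indicator fun _ => C) hm ?_ ?_
    (Filter.Eventually.of_forall hl)
  · exact (integrable_indicator_iff measurableSet_Icc).2 continuous_const.integrableOn_Icc
  · refine fun n => Filter.Eventually.of_forall fun x => ?_
    by_cases hx : x ∈ Icc (-r) r
    · rw [indicator_of_mem hx]; exact hb n x
    · rw [indicator_of_notMem hx, hs n x, norm_zero]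
      rw [mem_Icc, ← abs_le] at hx
      exact not_le.1 hx

theorem exists_radius_of_hasCompactSupport {f : ℝ → ℝ} (hf : HasCompactSupport f) :
    ∃ r, 0 ≤ r ∧ ∀ x, r < |x| → f x = 0 := by
  obtain ⟨r, hr⟩ := hf.isCompact.isBounded.subset_closedBall 0
  refine ⟨max r 0, le_max_right _ _, fun x hx => image_eq_zero_of_notMem_tsupport fun hx' => ?_⟩
  have := hr hx'
  rw [Metric.mem_closedBall, dist_zero_right, Real.norm_eq_abs] at this
  exact absurd (this.trans (le_max_left r 0)) (not_le.2 hx)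

theorem IsTestedKernel.hasCompactSupport_integralOp {σ w : Measure ℝ} {k : ℝ → ℝ → ℝ} {X : ℝ}
    (h : IsTestedKernel σ w k X) {f : ℝ → ℝ} (hf : HasCompactSupport f) :
    HasCompactSupport (integralOp k σ f) := by
  obtain ⟨R, hR⟩ := h.supp
  obtain ⟨r, hr0, hr⟩ := exists_radius_of_hasCompactSupport hf
  refine HasCompactSupport.of_support_subset_isCompact (isCompact_Icc (a := -(r + R))
    (b := r + R)) fun x hx => ?_
  by_contra hx'
  rw [mem_Icc, ← abs_le, not_le] at hx'
  refine hx (integral_eq_zero_of_ae (Filter.Eventually.of_forall fun y => ?_))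
  rcases lt_or_ge r |y| with hy | hy
  · simp only [hr y hy, mul_zero, Pi.zero_apply]
  · have : R ≤ |x - y| := by
      have := abs_sub_abs_le_abs_sub x y
      linarith
    simp only [hR x y this, zero_mul, Pi.zero_apply]

/-- The bound for the bilinear form on continuous functions with compact support: the functions are
sampled on finer and finer lattices. -/
theorem exists_pairing_le : ∃ K : ℝ, 0 ≤ K ∧ ∀ {σ w : Measure ℝ} {k : ℝ → ℝ → ℝ} {X : ℝ}
    [IsLocallyFiniteMeasure σ] [IsLocallyFiniteMeasure w], IsTestedKernel σ w k X →
    ∀ {f g : ℝ → ℝ}, Continuous f → HasCompactSupport f → Continuous g → HasCompactSupport g →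
      |∫ x, integralOp k σ f x * g x ∂w|
        ≤ K * X * √(∫ x, f x ^ 2 ∂σ) * √(∫ x, g x ^ 2 ∂w) := by
  obtain ⟨K, hK0, hK⟩ := exists_step_le
  refine ⟨K, hK0, ?_⟩
  intro σ w k X _ _ h f g hf hfs hg hgs
  obtain ⟨M, hM⟩ := h.bdd
  have hM0 : 0 ≤ M := (abs_nonneg _).trans (hM 0 0)
  obtain ⟨rf, hrf0, hrf⟩ := exists_radius_of_hasCompactSupport hfs
  obtain ⟨rg, hrg0, hrg⟩ := exists_radius_of_hasCompactSupport hgs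
  obtain ⟨Cf, hCf⟩ := hfs.exists_bound_of_continuous hf
  obtain ⟨Cg, hCg⟩ := hgs.exists_bound_of_continuous hg
  set r := max rf rg with hr
  set ℓ : ℕ → ℝ := fun m => 1 / ((m : ℝ) + 1) with hℓdef
  have hℓ : ∀ m, 0 < ℓ m := fun m => by simp only [hℓdef]; positivity
  have hℓ1 : ∀ m, ℓ m ≤ 1 := fun m => by
    simp only [hℓdef]
    rw [div_le_one (by positivity)]
    linarith [Nat.cast_nonneg (α := ℝ) m]
  have hℓ0 : Filter.Tendsto ℓ Filter.atTop (nhds 0) := tendsto_one_div_add_atTop_nhds_zero_nat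
  obtain ⟨x₀, hx₀⟩ := exists_lattice_origin σ w ℓ
  have hb : ∀ m, ∃ b : ℤ, x₀ + b * ℓ m ≤ -r := fun m => by
    refine ⟨⌊(-r - x₀) / ℓ m⌋, ?_⟩
    have := Int.floor_le ((-r - x₀) / ℓ m)
    rw [le_div_iff₀ (hℓ m)] at this
    linarith
  choose b hb using hb
  set o : ℕ → ℝ := fun m => x₀ + b m * ℓ m with ho
  have hn : ∀ m, ∃ n : ℕ, r < o m + 2 ^ n * ℓ m := fun m => by
    obtain ⟨n, hn⟩ := pow_unbounded_of_one_lt ((r - o m) / ℓ m) (one_lt_two (α := ℝ))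
    refine ⟨n, ?_⟩
    rw [div_lt_iff₀ (hℓ m)] at hn
    linarith
  choose n hn using hn
  set S : (ℝ → ℝ) → ℕ → ℝ → ℝ := fun f m => step (o m) (ℓ m) (n m) fun l => f (o m + l * ℓ m)
    with hS
  have hz : ∀ f : ℝ → ℝ, (∀ x, r < |x| → f x = 0) → ∀ m x, ∃ z, |z - x| ≤ ℓ m ∧ S f m x = f z := by
    intro f hf m x
    refine exists_step_eq (o m) (hℓ m) (n m) (fun x hx => hf x ?_) x
    rcases hx with hx | hx
    · have := neg_le_abs x
      have := hb m
      simp only [ho] at hx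
      linarith
    · exact (hn m).trans_le (hx.trans (le_abs_self x))
  have hSb : ∀ {f : ℝ → ℝ} {C : ℝ}, (∀ x, r < |x| → f x = 0) → (∀ x, ‖f x‖ ≤ C) →
      ∀ m x, |S f m x| ≤ C := by
    intro f C hf hC m x
    obtain ⟨z, _, hz⟩ := hz f hf m x
    rw [hz]; exact hC z
  have hSs : ∀ {f : ℝ → ℝ}, (∀ x, r < |x| → f x = 0) → ∀ m x, r + 1 < |x| → S f m x = 0 := by
    intro f hf m x hx
    obtain ⟨z, hz1, hz⟩ := hz f hf m x
    rw [hz]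
    refine hf z ?_
    have := abs_sub_abs_le_abs_sub x z
    rw [abs_sub_comm x z] at this
    have := hℓ1 m
    linarith
  have hSl : ∀ {f : ℝ → ℝ}, (∀ x, r < |x| → f x = 0) → Continuous f → ∀ x,
      Filter.Tendsto (fun m => S f m x) Filter.atTop (nhds (f x)) := by
    intro f hf hfc x
    choose z hz1 hz using fun m => hz f hf m x
    simp_rw [hz]
    refine (hfc.tendsto x).comp ?_
    rw [tendsto_iff_dist_tendsto_zero]
    exact squeeze_zero (fun _ => dist_nonneg) hz1 hℓ0
  have hSi : ∀ (μ : Measure ℝ) [IsLocallyFiniteMeasure μ] (f : ℝ → ℝ) (m : ℕ),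
      Integrable (S f m) μ := fun μ _ f m => integrable_step μ _ _ _ _
  have hf0 : ∀ x, r < |x| → f x = 0 := fun x hx => hrf x ((le_max_left _ _).trans_lt hx)
  have hg0 : ∀ x, r < |x| → g x = 0 := fun x hx => hrg x ((le_max_right _ _).trans_lt hx)
  have hCf0 : 0 ≤ Cf := (norm_nonneg _).trans (hCf 0)
  have hsq : ∀ (μ : Measure ℝ) [IsLocallyFiniteMeasure μ] {f : ℝ → ℝ} {C : ℝ},
      (∀ x, r < |x| → f x = 0) → (∀ x, ‖f x‖ ≤ C) → Continuous f →
      Filter.Tendsto (fun m => ∫ x, S f m x ^ 2 ∂μ) Filter.atTop (nhds (∫ x, f x ^ 2 ∂μ)) := by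
    intro μ _ f C hf hC hfc
    refine tendsto_integral_of_bounded (C := C ^ 2) (r := r + 1)
      (fun m => (hSi μ f m).aestronglyMeasurable.pow 2) (fun m x => ?_) (fun m x hx => ?_)
      fun x => (hSl hf hfc x).pow 2
    · rw [abs_pow]
      exact pow_le_pow_left₀ (abs_nonneg _) (hSb hf hC m x) 2
    · rw [hSs hf m x hx]; ring
  have hk : ∀ x, Continuous (k x) := fun x => h.cont.comp (Continuous.prodMk_right x)
  have hTl : ∀ x, Filter.Tendsto (fun m => integralOp k σ (S f m) x) Filter.atTop
      (nhds (integralOp k σ f x)) := by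
    intro x
    refine tendsto_integral_of_bounded (μ := σ) (F := fun m y => k x y * S f m y)
      (C := M * Cf) (r := r + 1)
      (fun m => (hk x).aestronglyMeasurable.mul (hSi σ f m).aestronglyMeasurable)
      (fun m y => ?_) (fun m y hy => ?_) fun y => (hSl hf0 hf y).const_mul _
    · rw [abs_mul]
      exact mul_le_mul (hM x y) (hSb hf0 hCf m y) (abs_nonneg _) hM0
    · rw [hSs hf0 m y hy, mul_zero]
  have hTb : ∀ m x, |integralOp k σ (S f m) x| ≤ M * Cf * σ.real (Icc (-(r + 1)) (r + 1)) := by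
    intro m x
    have e : ∫ y in Icc (-(r + 1)) (r + 1), k x y * S f m y ∂σ = ∫ y, k x y * S f m y ∂σ := by
      refine setIntegral_eq_integral_of_forall_compl_eq_zero fun y hy => ?_
      rw [mem_Icc, ← abs_le, not_le] at hy
      rw [hSs hf0 m y hy, mul_zero]
    rw [integralOp, ← e]
    refine norm_setIntegral_le_of_norm_le_const (f := fun y => k x y * S f m y) (μ := σ)
      measure_Icc_lt_top fun y _ => ?_
    rw [norm_mul]
    exact mul_le_mul (hM x y) (hSb hf0 hCf m y) (abs_nonneg _) hM0
  have hlim : Filter.Tendsto (fun m => ∫ x, integralOp k σ (S f m) x * S g m x ∂w) Filter.atTop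
      (nhds (∫ x, integralOp k σ f x * g x ∂w)) := by
    refine tendsto_integral_of_bounded (C := M * Cf * σ.real (Icc (-(r + 1)) (r + 1)) * Cg)
      (r := r + 1)
      (fun m => (h.continuous_integralOp (hSi σ f m).locallyIntegrable).aestronglyMeasurable.mul
        (hSi w g m).aestronglyMeasurable) (fun m x => ?_) (fun m x hx => ?_)
      fun x => (hTl x).mul (hSl hg0 hg x)
    · rw [abs_mul]
      exact mul_le_mul (hTb m x) (hSb hg0 hCg m x) (abs_nonneg _) (by positivity)
    · rw [hSs hg0 m x hx, mul_zero]
  refine le_of_tendsto_of_tendsto' hlim.abs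
    (((hsq σ hf0 hCf hf).sqrt.const_mul (K * X)).mul (hsq w hg0 hCg hg).sqrt) fun m => ?_
  exact hK h (hℓ m) (fun n => (hx₀ m n).1) (fun n => (hx₀ m n).2) (b m) (n m) _ _

/-- The operator of a tested kernel is bounded, with a norm that depends only on the number `X`. -/
theorem exists_integralOp_le : ∃ K : ℝ, 0 ≤ K ∧ ∀ {σ w : Measure ℝ} {k : ℝ → ℝ → ℝ} {X : ℝ}
    [IsLocallyFiniteMeasure σ] [IsLocallyFiniteMeasure w], IsTestedKernel σ w k X →
    ∀ f, MemLp f 2 σ →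
      eLpNorm (integralOp k σ f) 2 w ≤ ENNReal.ofReal (K * X) * eLpNorm f 2 σ := by
  obtain ⟨K, hK0, hK⟩ := exists_pairing_le
  refine ⟨K, hK0, ?_⟩
  intro σ w k X _ _ h f hf
  have hX := h.X_pos
  have hsmooth : ∀ g, Continuous g → HasCompactSupport g →
      eLpNorm (integralOp k σ g) 2 w ≤ ENNReal.ofReal (K * X) * eLpNorm g 2 σ := by
    intro g hg hgs
    have hg2 : MemLp g 2 σ := hg.memLp_of_hasCompactSupport hgs
    have huc := h.continuous_integralOp (locallyIntegrable_of_memLp_two hg2)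
    have hus := h.hasCompactSupport_integralOp hgs
    have hu2 : MemLp (integralOp k σ g) 2 w := huc.memLp_of_hasCompactSupport hus
    -- the form is tested with `g` and its image
    have h1 := hK h hg hgs huc hus
    simp_rw [← sq] at h1
    rw [← ofReal_sqrt_integral_sq hg2, ← ofReal_sqrt_integral_sq hu2,
      ← ENNReal.ofReal_mul (by positivity)]
    refine ENNReal.ofReal_le_ofReal ?_
    set a := ∫ x, integralOp k σ g x ^ 2 ∂w with ha
    have ha0 : 0 ≤ a := integral_nonneg fun x => sq_nonneg _
    rw [abs_of_nonneg ha0] at h1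
    rcases eq_or_lt_of_le (Real.sqrt_nonneg a) with h0 | h0
    · rw [← h0]; positivity
    · refine le_of_mul_le_mul_right ?_ h0
      rwa [Real.mul_self_sqrt ha0]
  obtain ⟨N, hN0, hN⟩ := h.exists_eLpNorm_le
  refine ENNReal.le_of_forall_pos_le_add fun ε hε _ => ?_
  set δ : ℝ := ε / (K * X + N + 1) with hδ
  have hδ0 : 0 < δ := by positivity
  obtain ⟨g, hgs, hfg, hg, hg2⟩ := hf.exists_hasCompactSupport_eLpNorm_sub_le
    ENNReal.ofNat_ne_top (ε := ENNReal.ofReal δ) (by simpa using hδ0)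
  have hfg2 : MemLp (f - g) 2 σ := hf.sub hg2
  have e : integralOp k σ f = integralOp k σ (f - g) + integralOp k σ g := by
    funext x
    have h1 := h.integrable_mul (locallyIntegrable_of_memLp_two hfg2) x
    have h2 := h.integrable_mul (locallyIntegrable_of_memLp_two hg2) x
    simp only [integralOp, Pi.add_apply]
    rw [← integral_add h1 h2]
    congr 1; ext y
    simp only [Pi.sub_apply]; ring
  have hc1 := h.continuous_integralOp (locallyIntegrable_of_memLp_two hfg2)
  have hc2 := h.continuous_integralOp (locallyIntegrable_of_memLp_two hg2)
  have hgf : eLpNorm g 2 σ ≤ eLpNorm f 2 σ + ENNReal.ofReal δ := by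
    calc eLpNorm g 2 σ = eLpNorm (f - (f - g)) 2 σ := by rw [sub_sub_cancel]
      _ ≤ eLpNorm f 2 σ + eLpNorm (f - g) 2 σ := eLpNorm_sub_le hf.1 hfg2.1 (by norm_num)
      _ ≤ _ := by gcongr
  rw [e]
  calc _ ≤ eLpNorm (integralOp k σ (f - g)) 2 w + eLpNorm (integralOp k σ g) 2 w :=
        eLpNorm_add_le hc1.aestronglyMeasurable hc2.aestronglyMeasurable (by norm_num)
    _ ≤ ENNReal.ofReal N * ENNReal.ofReal δ
        + ENNReal.ofReal (K * X) * (eLpNorm f 2 σ + ENNReal.ofReal δ) := by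
        gcongr
        · exact (hN _ hfg2).trans (by gcongr)
        · exact (hsmooth g hg hgs).trans (by gcongr)
    _ = ENNReal.ofReal (K * X) * eLpNorm f 2 σ + ENNReal.ofReal ((K * X + N) * δ) := by
        rw [ENNReal.ofReal_mul (p := K * X + N) (by positivity),
          ENNReal.ofReal_add (by positivity) hN0]
        ring
    _ ≤ _ := by
        gcongr
        rw [← ENNReal.ofReal_coe_nnreal]
        refine ENNReal.ofReal_le_ofReal ?_
        rw [hδ, mul_div_assoc', div_le_iff₀ (by positivity), mul_comm]
        exact mul_le_mul_of_nonneg_left (by linarith) ε.2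

end

section

/-! ### Continuous truncations -/

/-- The projection of the real line onto the unit interval. -/
def clamp (u : ℝ) : ℝ := max 0 (min 1 u)

theorem clamp_nonneg (u : ℝ) : 0 ≤ clamp u := le_max_left _ _

theorem clamp_le_one (u : ℝ) : clamp u ≤ 1 := max_le zero_le_one (min_le_left _ _)

theorem clamp_of_nonpos {u : ℝ} (h : u ≤ 0) : clamp u = 0 :=
  max_eq_left ((min_le_right _ _).trans h)

theorem clamp_of_one_le {u : ℝ} (h : 1 ≤ u) : clamp u = 1 := by
  rw [clamp, min_eq_left h, max_eq_right zero_le_one]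

theorem clamp_le_of_nonneg {u : ℝ} (h : 0 ≤ u) : clamp u ≤ u := max_le h (min_le_right _ _)

theorem abs_clamp_sub_le (u v : ℝ) : |clamp u - clamp v| ≤ |u - v| :=
  (abs_max_sub_max_le_max _ _ _ _).trans (max_le (by simp)
    ((abs_min_sub_min_le_max _ _ _ _).trans (max_le (by simp) le_rfl)))

theorem continuous_clamp : Continuous clamp :=
  continuous_const.max (continuous_const.min continuous_id)

/-- The cutoff to `α ≤ |t| ≤ 2 β`, which is one for `2 α ≤ |t| ≤ β`. -/
noncomputable def cutoff (α β t : ℝ) : ℝ := clamp (|t| / α - 1) * clamp (2 - |t| / β)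

variable {α β : ℝ}

theorem cutoff_nonneg (t : ℝ) : 0 ≤ cutoff α β t := mul_nonneg (clamp_nonneg _) (clamp_nonneg _)

theorem cutoff_le_one (t : ℝ) : cutoff α β t ≤ 1 :=
  mul_le_one₀ (clamp_le_one _) (clamp_nonneg _) (clamp_le_one _)

theorem cutoff_of_le (hα : 0 < α) {t : ℝ} (ht : |t| ≤ α) : cutoff α β t = 0 := by
  rw [cutoff, clamp_of_nonpos, zero_mul]
  rw [sub_nonpos, div_le_one hα]
  exact ht

theorem cutoff_of_ge (hβ : 0 < β) {t : ℝ} (ht : 2 * β ≤ |t|) : cutoff α β t = 0 := by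
  rw [cutoff, clamp_of_nonpos (u := 2 - |t| / β), mul_zero]
  rw [sub_nonpos, le_div_iff₀ hβ]
  exact ht

theorem cutoff_of_mem (hα : 0 < α) (hβ : 0 < β) {t : ℝ} (h1 : 2 * α ≤ |t|) (h2 : |t| ≤ β) :
    cutoff α β t = 1 := by
  rw [cutoff, clamp_of_one_le, clamp_of_one_le, one_mul]
  · rw [le_sub_comm, div_le_iff₀ hβ]; linarith
  · rw [le_sub_iff_add_le, le_div_iff₀ hα]; linarith

theorem cutoff_neg (t : ℝ) : cutoff α β (-t) = cutoff α β t := by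
  rw [cutoff, abs_neg, cutoff]

theorem continuous_cutoff : Continuous (cutoff α β) :=
  (continuous_clamp.comp ((continuous_abs.div_const _).sub continuous_const)).mul
    (continuous_clamp.comp (continuous_const.sub (continuous_abs.div_const _)))

theorem abs_cutoff_sub_le (hα : 0 < α) (hβ : 0 < β) {D t t' : ℝ} (hD : 0 < D) (ht : D ≤ |t|)
    (ht' : D ≤ |t'|) (h2 : |t| < 2 * β) :
    |cutoff α β t - cutoff α β t'| ≤ 4 * |t - t'| / D := by
  have habs := abs_abs_sub_abs_le t t'
  have h1 : |clamp (|t| / α - 1) - clamp (|t'| / α - 1)| ≤ 2 * |t - t'| / D := by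
    by_cases hc : 2 * α ≤ |t| ∧ 2 * α ≤ |t'|
    · rw [clamp_of_one_le, clamp_of_one_le, sub_self, abs_zero]
      · positivity
      · rw [le_sub_iff_add_le, le_div_iff₀ hα]; linarith [hc.2]
      · rw [le_sub_iff_add_le, le_div_iff₀ hα]; linarith [hc.1]
    · have hDα : D ≤ 2 * α := by
        by_contra hD'
        exact hc ⟨by linarith, by linarith⟩
      refine (abs_clamp_sub_le _ _).trans ?_
      rw [sub_sub_sub_cancel_right, ← sub_div, abs_div, abs_of_pos hα,
        div_le_div_iff₀ hα hD]
      calc _ ≤ |t - t'| * (2 * α) := by gcongr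
        _ = _ := by ring
  have h2 : |clamp (2 - |t| / β) - clamp (2 - |t'| / β)| ≤ 2 * |t - t'| / D := by
    refine (abs_clamp_sub_le _ _).trans ?_
    rw [sub_sub_sub_cancel_left, ← sub_div, abs_div, abs_of_pos hβ, abs_sub_comm,
      div_le_div_iff₀ hβ hD]
    calc _ ≤ |t - t'| * (2 * β) := by gcongr; linarith
      _ = _ := by ring
  calc |cutoff α β t - cutoff α β t'|
      = |(clamp (|t| / α - 1) - clamp (|t'| / α - 1)) * clamp (2 - |t| / β)
        + clamp (|t'| / α - 1) * (clamp (2 - |t| / β) - clamp (2 - |t'| / β))| := by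
        unfold cutoff; congr 1; ring
    _ ≤ 2 * |t - t'| / D * 1 + 1 * (2 * |t - t'| / D) := by
        refine (abs_add_le _ _).trans ?_
        rw [abs_mul, abs_mul, abs_of_nonneg (clamp_nonneg _), abs_of_nonneg (clamp_nonneg _)]
        gcongr
        · exact clamp_nonneg _
        · exact clamp_le_one _
        · exact clamp_le_one _
    _ = _ := by ring

/-- The regularity of a truncated kernel, as a function of one of its variables. It holds also
across the points `t = ± 2 β`, where the kernel itself may have a jump, and across the origin. -/
theorem abs_mul_cutoff_sub_le {F : ℝ → ℝ} {C : ℝ} (hα : 0 < α) (hβ : 0 < β) (hC : 0 ≤ C)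
    (hd : ∀ t, 0 < |t| → |t| < 2 * β → DifferentiableAt ℝ F t)
    (hF : ∀ t, 0 < |t| → |t| < 2 * β → |F t| ≤ C / |t|)
    (hF' : ∀ t, 0 < |t| → |t| < 2 * β → |deriv F t| ≤ C / |t| ^ 2) {D t t' : ℝ} (hD : 0 < D)
    (ht : D ≤ |t|) (ht' : D ≤ |t'|) :
    |F t * cutoff α β t - F t' * cutoff α β t'| ≤ 5 * C * |t - t'| / D ^ 2 := by
  have hFD : ∀ t, D ≤ |t| → |t| < 2 * β → |F t| ≤ C / D := fun t h1 h2 =>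
    (hF t (hD.trans_le h1) h2).trans (by gcongr)
  have hFb : ∀ t, D ≤ |t| → |F t * cutoff α β t| ≤ C / D := by
    intro t h1
    rcases lt_or_ge |t| (2 * β) with h2 | h2
    · rw [abs_mul, abs_of_nonneg (cutoff_nonneg t)]
      exact mul_le_of_le_one_right (abs_nonneg _) (cutoff_le_one t) |>.trans (hFD t h1 h2)
    · rw [cutoff_of_ge hβ h2, mul_zero, abs_zero]; positivity
  -- the case in which one of the points is outside of the support
  have hout : ∀ t t', D ≤ |t| → |t| < 2 * β → 2 * β ≤ |t'| →
      |F t * cutoff α β t| ≤ 5 * C * |t - t'| / D ^ 2 := by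
    intro t t' h1 h2 h3
    have habs := abs_sub_abs_le_abs_sub t' t
    rw [abs_sub_comm] at habs
    have hc : cutoff α β t ≤ 2 * |t - t'| / D := by
      refine (mul_le_of_le_one_left (clamp_nonneg _) (clamp_le_one _)).trans ?_
      have h4 : 2 - |t| / β = (2 * β - |t|) / β := by field_simp
      rw [h4]
      refine (clamp_le_of_nonneg (div_nonneg (by linarith) hβ.le)).trans ?_
      rw [div_le_div_iff₀ hβ hD]
      calc (2 * β - |t|) * D ≤ |t - t'| * (2 * β) := by
            gcongr
            · linarith
            · linarith
        _ = _ := by ring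
    rw [abs_mul, abs_of_nonneg (cutoff_nonneg t)]
    calc _ ≤ C / D * (2 * |t - t'| / D) := mul_le_mul (hFD t h1 h2) hc (cutoff_nonneg t)
          (by positivity)
      _ = 2 * C * |t - t'| / D ^ 2 := by field_simp
      _ ≤ _ := by gcongr; norm_num
  rcases lt_or_ge |t| (2 * β) with h | h
  · rcases lt_or_ge |t'| (2 * β) with h' | h'
    · by_cases hs : 2 * D ≤ |t - t'|
      · refine (abs_sub _ _).trans ((add_le_add (hFb t ht) (hFb t' ht')).trans ?_)
        calc C / D + C / D = C * (2 * D) / D ^ 2 := by field_simp; norm_num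
          _ ≤ 5 * C * |t - t'| / D ^ 2 := by
            gcongr
            linarith
      · -- the two points are on the same side of the origin
        have hmv : |F t - F t'| ≤ C / D ^ 2 * |t - t'| := by
          push Not at hs
          have hder : ∀ s, D ≤ |s| → |s| < 2 * β → ‖deriv F s‖ ≤ C / D ^ 2 := fun s h1 h2 =>
            (hF' s (hD.trans_le h1) h2).trans (by gcongr)
          rcases le_abs.1 ht with h1 | h1
          · have h1' : D ≤ t' := by
              rcases le_abs.1 ht' with h2 | h2
              · exact h2
              · have := le_abs_self (t - t'); linarith
            have hmem : ∀ s ∈ Ico D (2 * β), D ≤ |s| ∧ |s| < 2 * β := fun s hs => by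
              rw [abs_of_pos (hD.trans_le hs.1)]; exact hs
            exact (convex_Ico D (2 * β)).norm_image_sub_le_of_norm_deriv_le
              (fun s hs => hd s (hD.trans_le (hmem s hs).1) (hmem s hs).2)
              (fun s hs => hder s (hmem s hs).1 (hmem s hs).2)
              ⟨h1', (le_abs_self _).trans_lt h'⟩ ⟨h1, (le_abs_self _).trans_lt h⟩
          · have h1' : t' ≤ -D := by
              rcases le_abs.1 ht' with h2 | h2
              · have := neg_le_abs (t - t'); linarith
              · linarith
            have hmem : ∀ s ∈ Ioc (-(2 * β)) (-D), D ≤ |s| ∧ |s| < 2 * β := fun s hs => by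
              rw [abs_of_neg (by linarith [hs.2])]
              constructor <;> linarith [hs.1, hs.2]
            exact (convex_Ioc (-(2 * β)) (-D)).norm_image_sub_le_of_norm_deriv_le
              (fun s hs => hd s (hD.trans_le (hmem s hs).1) (hmem s hs).2)
              (fun s hs => hder s (hmem s hs).1 (hmem s hs).2)
              ⟨by linarith [neg_le_abs t'], h1'⟩ ⟨by linarith [neg_le_abs t], by linarith⟩
        calc |F t * cutoff α β t - F t' * cutoff α β t'|
            = |(F t - F t') * cutoff α β t + F t' * (cutoff α β t - cutoff α β t')| := by
              congr 1; ring
          _ ≤ C / D ^ 2 * |t - t'| * 1 + C / D * (4 * |t - t'| / D) := by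
              refine (abs_add_le _ _).trans ?_
              rw [abs_mul, abs_mul, abs_of_nonneg (cutoff_nonneg t)]
              exact add_le_add
                (mul_le_mul hmv (cutoff_le_one t) (cutoff_nonneg t) (by positivity))
                (mul_le_mul (hFD t' ht' h') (abs_cutoff_sub_le hα hβ hD ht ht' h)
                  (abs_nonneg _) (by positivity))
          _ = _ := by field_simp; ring
    · rw [cutoff_of_ge hβ h', mul_zero, sub_zero]
      exact hout t t' ht h h'
  · rcases lt_or_ge |t'| (2 * β) with h' | h'
    · rw [cutoff_of_ge hβ h, mul_zero, zero_sub, abs_neg, abs_sub_comm]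
      exact hout t' t ht' h' h
    · rw [cutoff_of_ge hβ h, cutoff_of_ge hβ h', mul_zero, mul_zero, sub_zero, abs_zero]
      positivity

variable {C : ℝ} {K k : ℝ → ℝ → ℝ}

theorem gradNorm_adjointKernel (k : ℝ → ℝ → ℝ) (x y : ℝ) :
    gradNorm (adjointKernel k) x y = gradNorm k y x := by
  unfold gradNorm adjointKernel
  rw [add_comm]

theorem IsSmoothTruncation.adjoint (h : IsSmoothTruncation C K α β k) :
    IsSmoothTruncation C (adjointKernel K) α β (adjointKernel k) := by
  obtain ⟨h1, h2, h3⟩ := h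
  refine ⟨fun x y h0 h => ?_, fun x y => ?_, fun x y h0 h => ?_⟩
  · rw [abs_sub_comm] at h0 h
    exact (h1 y x h0 h).comp (x, y) (f := fun p : ℝ × ℝ => (p.2, p.1))
      (differentiableAt_snd.prodMk differentiableAt_fst)
  · rw [gradNorm_adjointKernel, abs_sub_comm x y]
    exact h2 y x
  · rw [abs_sub_comm] at h0 h
    exact h3 y x h0 h

theorem IsSmoothTruncation.nonneg (h : IsSmoothTruncation C K α β k) (hα : 0 < α) (hβ : 0 < β) :
    0 ≤ C := by
  have := h.2.1 0 0
  rw [sub_self, abs_zero, if_pos (by positivity)] at this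
  refine le_trans ?_ (this.trans_eq (mul_one C))
  have : 0 ≤ |k 0 0| := abs_nonneg _
  rw [zero_mul, add_zero, add_zero]
  positivity

theorem gradNorm_nonneg (k : ℝ → ℝ → ℝ) (x y : ℝ) : 0 ≤ gradNorm k x y := Real.sqrt_nonneg _

theorem IsSmoothTruncation.add_mul_abs_le (h : IsSmoothTruncation C K α β k) (hα : 0 < α)
    (hβ : 0 < β) (x y : ℝ) : (α + |x - y|) * |k x y| ≤ C := by
  have hC := h.nonneg hα hβ
  have := h.2.1 x y
  have h0 : 0 ≤ (α + |x - y|) * (|x - y| * gradNorm k x y) := by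
    have := gradNorm_nonneg k x y
    positivity
  rw [mul_add] at this
  split_ifs at this <;> linarith

theorem IsSmoothTruncation.eq_zero (h : IsSmoothTruncation C K α β k) (hα : 0 < α) {x y : ℝ}
    (hxy : 2 * β ≤ |x - y|) : k x y = 0 := by
  have h1 := h.2.1 x y
  rw [if_neg (not_lt.2 hxy), mul_zero] at h1
  have h0 : 0 ≤ (α + |x - y|) * (|x - y| * gradNorm k x y) := by
    have := gradNorm_nonneg k x y
    positivity
  rw [mul_add] at h1
  have h2 : (α + |x - y|) * |k x y| ≤ 0 := by linarith
  have h3 : 0 < α + |x - y| := by positivity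
  have h4 : |k x y| ≤ 0 := nonpos_of_mul_nonpos_right h2 h3
  exact abs_nonpos_iff.1 h4

theorem IsSmoothTruncation.abs_le_div (h : IsSmoothTruncation C K α β k) (hα : 0 < α)
    (hβ : 0 < β) {x y : ℝ} (hxy : 0 < |x - y|) : |k x y| ≤ C / |x - y| := by
  have := h.add_mul_abs_le hα hβ x y
  rw [le_div_iff₀ hxy]
  have : 0 ≤ α * |k x y| := by positivity
  linarith

theorem IsSmoothTruncation.abs_le (h : IsSmoothTruncation C K α β k) (hα : 0 < α)
    (hβ : 0 < β) (x y : ℝ) : |k x y| ≤ C / α := by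
  have := h.add_mul_abs_le hα hβ x y
  rw [le_div_iff₀ hα]
  have : 0 ≤ |x - y| * |k x y| := by positivity
  linarith

theorem IsSmoothTruncation.abs_deriv_le (h : IsSmoothTruncation C K α β k) (hα : 0 < α) {x y : ℝ}
    (hxy : 0 < |x - y|) (hxy' : |x - y| < 2 * β) :
    |deriv (fun s => k s y) x| ≤ C / |x - y| ^ 2 := by
  have h1 : |deriv (fun s => k s y) x| ≤ gradNorm k x y :=
    Real.abs_le_sqrt (le_add_of_nonneg_right (sq_nonneg _))
  have h2 := h.2.1 x y
  rw [if_pos hxy', mul_one] at h2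
  have h3 : 0 ≤ (α + |x - y|) * |k x y| := by positivity
  have h4 : 0 ≤ α * (|x - y| * gradNorm k x y) := by
    have := gradNorm_nonneg k x y
    positivity
  refine h1.trans ?_
  rw [le_div_iff₀ (by positivity)]
  linarith

/-- The normalized continuous truncation of a kernel. -/
noncomputable def cutKernel (c α β : ℝ) (k : ℝ → ℝ → ℝ) (x y : ℝ) : ℝ :=
  c⁻¹ * (k x y * cutoff α β (x - y))

theorem adjointKernel_cutKernel (c : ℝ) (k : ℝ → ℝ → ℝ) :
    adjointKernel (cutKernel c α β k) = cutKernel c α β (adjointKernel k) := by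
  funext x y
  unfold adjointKernel cutKernel
  rw [← cutoff_neg, neg_sub]

theorem IsSmoothTruncation.cutKernel_reg (h : IsSmoothTruncation C K α β k) (hα : 0 < α)
    (hβ : 0 < β) {c : ℝ} (hc : 0 < c) (hCc : 5 * C ≤ c) {D x x' y : ℝ} (hD : 0 < D)
    (h1 : D ≤ |x - y|) (h2 : D ≤ |x' - y|) :
    |cutKernel c α β k x y - cutKernel c α β k x' y| ≤ |x - x'| / D ^ 2 := by
  have hC := h.nonneg hα hβ
  have key := abs_mul_cutoff_sub_le (F := fun t => k (y + t) y) hα hβ hC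
    (fun t h0 h3 => by
      have := h.1 (y + t) y (by simpa using h0) (by simpa using h3)
      exact this.comp t (f := fun t => (y + t, y))
        ((differentiableAt_id.const_add y).prodMk (differentiableAt_const y)))
    (fun t h0 h3 => by
      have := h.abs_le_div hα hβ (x := y + t) (y := y) (by simpa using h0)
      simpa using this)
    (fun t h0 h3 => by
      have := h.abs_deriv_le hα (x := y + t) (y := y) (by simpa using h0) (by simpa using h3)
      rw [deriv_comp_const_add (f := fun s => k s y)]
      simpa using this) hD h1 h2
  simp only [add_sub_cancel, sub_sub_sub_cancel_right] at key
  unfold cutKernel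
  rw [← mul_sub, abs_mul, abs_of_pos (inv_pos.2 hc), ← div_eq_inv_mul, div_le_iff₀ hc]
  refine key.trans ?_
  calc 5 * C * |x - x'| / D ^ 2 ≤ c * |x - x'| / D ^ 2 := by gcongr
    _ = _ := by ring

theorem IsSmoothTruncation.continuous_cutKernel (h : IsSmoothTruncation C K α β k) (hα : 0 < α)
    (hβ : 0 < β) (c : ℝ) : Continuous fun p : ℝ × ℝ => cutKernel c α β k p.1 p.2 := by
  unfold cutKernel
  refine Continuous.mul continuous_const ?_
  have hdist : Continuous fun p : ℝ × ℝ => |p.1 - p.2| :=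
    (continuous_fst.sub continuous_snd).abs
  have hcut : Continuous fun p : ℝ × ℝ => cutoff α β (p.1 - p.2) :=
    continuous_cutoff.comp (continuous_fst.sub continuous_snd)
  refine continuous_iff_continuousAt.2 fun p => ?_
  by_cases h0 : cutoff α β (p.1 - p.2) = 0
  · -- the kernel is bounded and the cutoff is continuous
    have h2 : Filter.Tendsto (fun q : ℝ × ℝ => C / α * cutoff α β (q.1 - q.2)) (nhds p) (nhds 0) := by
      have := (hcut.tendsto p).const_mul (C / α)
      simpa only [h0, mul_zero] using this
    unfold ContinuousAt
    simp only [h0, mul_zero]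
    refine squeeze_zero_norm (fun q => ?_) h2
    rw [norm_mul, Real.norm_eq_abs, Real.norm_eq_abs, abs_of_nonneg (cutoff_nonneg _)]
    exact mul_le_mul_of_nonneg_right (h.abs_le hα hβ _ _) (cutoff_nonneg _)
  · have h1 : 0 < |p.1 - p.2| := by
      by_contra h1
      exact h0 (cutoff_of_le hα ((not_lt.1 h1).trans hα.le))
    have h2 : |p.1 - p.2| < 2 * β := by
      by_contra h2
      exact h0 (cutoff_of_ge hβ (not_lt.1 h2))
    exact (h.1 p.1 p.2 h1 h2).continuousAt.mul hcut.continuousAt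

theorem IsSmoothTruncation.abs_sub_cutKernel_le (h : IsSmoothTruncation C K α β k) (hα : 0 < α)
    (hβ : 0 < β) {c : ℝ} (hc : 0 < c) (x y : ℝ) :
    |k x y - c * cutKernel c α β k x y| ≤
      (if dist y x < 2 * α then C / α else 0) + if dist y x < 2 * β then C / β else 0 := by
  have hC := h.nonneg hα hβ
  rw [dist_comm, Real.dist_eq, cutKernel, mul_inv_cancel_left₀ hc.ne']
  have h1 : |k x y - k x y * cutoff α β (x - y)| ≤ |k x y| := by
    rw [← mul_one_sub, abs_mul]
    refine mul_le_of_le_one_right (abs_nonneg _) ?_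
    have := cutoff_nonneg (α := α) (β := β) (x - y)
    have := cutoff_le_one (α := α) (β := β) (x - y)
    rw [abs_of_nonneg] <;> linarith
  have hnn : ∀ (P : Prop) [Decidable P] (γ : ℝ), 0 < γ → 0 ≤ if P then C / γ else 0 := by
    intro P _ γ hγ
    split_ifs <;> positivity
  rcases lt_or_ge |x - y| (2 * α) with h2 | h2
  · rw [if_pos h2]
    exact (h1.trans (h.abs_le hα hβ x y)).trans (le_add_of_nonneg_right (hnn _ β hβ))
  · rcases lt_or_ge |x - y| (2 * β) with h3 | h3
    · rcases le_or_gt |x - y| β with h4 | h4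
      · rw [cutoff_of_mem hα hβ h2 h4, mul_one, sub_self, abs_zero]
        exact add_nonneg (hnn _ α hα) (hnn _ β hβ)
      · rw [if_pos h3]
        refine h1.trans ((h.abs_le_div hα hβ (hβ.trans h4)).trans ?_)
        refine le_trans ?_ (le_add_of_nonneg_left (hnn _ α hα))
        gcongr
    · rw [h.eq_zero hα h3, zero_mul, sub_self, abs_zero]
      exact add_nonneg (hnn _ α hα) (hnn _ β hβ)

theorem IsSmoothTruncation.integrable_mul {σ : Measure ℝ} [IsLocallyFiniteMeasure σ]
    (h : IsSmoothTruncation C K α β k) (hα : 0 < α) (hβ : 0 < β) {f : ℝ → ℝ}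
    (hf : LocallyIntegrable f σ) (x : ℝ) : Integrable (fun y => k x y * f y) σ := by
  have hm : AEStronglyMeasurable (k x) σ := by
    set U : Set ℝ := {y | 0 < |x - y| ∧ |x - y| < 2 * β} with hU
    have hc : Continuous fun y => |x - y| := (continuous_const.sub continuous_id).abs
    have hUo : IsOpen U := (isOpen_lt continuous_const hc).inter (isOpen_lt hc continuous_const)
    have hcU : ContinuousOn (k x) U := fun y hy =>
      ((h.1 x y hy.1 hy.2).continuousAt.comp (f := fun y => (x, y))
        (Continuous.prodMk_right x).continuousAt).continuousWithinAt
    have e : k x = U.indicator (k x) + ({x} : Set ℝ).indicator (fun _ => k x x) := by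
      funext y
      rw [Pi.add_apply]
      rcases eq_or_ne y x with rfl | hne
      · rw [indicator_of_notMem, indicator_of_mem (mem_singleton y), zero_add]
        simp [hU]
      · rw [indicator_of_notMem (s := {x}) hne, add_zero]
        by_cases hy : y ∈ U
        · rw [indicator_of_mem hy]
        · rw [indicator_of_notMem hy]
          have h0 : 0 < |x - y| := abs_pos.2 (sub_ne_zero.2 hne.symm)
          exact h.eq_zero hα (not_lt.1 fun h2 => hy ⟨h0, h2⟩)
    rw [e]
    exact ((aestronglyMeasurable_indicator_iff hUo.measurableSet).2
      (hcU.aestronglyMeasurable hUo.measurableSet)).add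
      (stronglyMeasurable_const.indicator (measurableSet_singleton x)).aestronglyMeasurable
  have h1 : IntegrableOn f (Metric.closedBall x (2 * β)) σ :=
    hf.integrableOn_isCompact (isCompact_closedBall x _)
  have h2 : IntegrableOn (fun y => k x y * f y) (Metric.closedBall x (2 * β)) σ :=
    Integrable.bdd_mul h1 hm.restrict (Filter.Eventually.of_forall fun y => h.abs_le hα hβ x y)
  refine (integrableOn_iff_integrable_of_support_subset fun y hy => ?_).1 h2
  by_contra hy'
  rw [Metric.mem_closedBall, Real.dist_eq, not_le, abs_sub_comm] at hy'
  exact hy (by simp only [h.eq_zero hα hy'.le, zero_mul])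

end

section

variable {σ w : Measure ℝ} {α β C : ℝ} {K k : ℝ → ℝ → ℝ}

/-! ### The best constants -/

theorem TestingIneq.mono {T T' : ℝ≥0∞} (h : TestingIneq k σ w T) (hT : T ≤ T') :
    TestingIneq k σ w T' := fun I hI => (h I hI).trans (by gcongr)

theorem PivotalIneq.mono {P P' : ℝ≥0∞} (h : PivotalIneq σ w P) (hP : P ≤ P') :
    PivotalIneq σ w P' := fun I₀ 𝒬 h1 h2 h3 h4 => (h I₀ 𝒬 h1 h2 h3 h4).trans (by gcongr)

theorem poisson_mul_poisson_le_A2Const (σ w : Measure ℝ) {I : Set ℝ} (hI : IsInterval I) :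
    poisson σ I * poisson w I ≤ A2Const σ w := le_sInf fun _ hA => hA I hI

/-! ### Comparison of the two truncations -/

theorem measurable_lintegral_ball [SFinite σ] (R : ℝ) {f : ℝ → ℝ≥0∞} (hf : Measurable f) :
    Measurable fun x => ∫⁻ y in Metric.ball x R, f y ∂σ := by
  have h1 : MeasurableSet {p : ℝ × ℝ | dist p.2 p.1 < R} :=
    measurableSet_lt (measurable_snd.dist measurable_fst) measurable_const
  have h2 : Measurable fun p : ℝ × ℝ =>
      {p : ℝ × ℝ | dist p.2 p.1 < R}.indicator (fun p => f p.2) p :=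
    (hf.comp measurable_snd).indicator h1
  have h3 : Measurable fun x => ∫⁻ y, {p : ℝ × ℝ | dist p.2 p.1 < R}.indicator
      (fun p => f p.2) (x, y) ∂σ := h2.lintegral_prod_right
  have e : (fun x => ∫⁻ y in Metric.ball x R, f y ∂σ) = fun x =>
      ∫⁻ y, {p : ℝ × ℝ | dist p.2 p.1 < R}.indicator (fun p => f p.2) (x, y) ∂σ := by
    funext x
    rw [← lintegral_indicator Metric.isOpen_ball.measurableSet]
    rfl
  rw [e]
  exact h3

/-- An error that is dominated by averages over balls of the radii `2α` and `2β` contributes, by the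
`A₂` condition, a multiple of the norm of `f`. -/
theorem lintegral_sq_le_of_le_add_average [SFinite σ] [SFinite w] {X : ℝ}
    (hA : ∀ I, IsInterval I → poisson σ I * poisson w I ≤ ENNReal.ofReal (X ^ 2))
    (hα : 0 < α) (hβ : 0 < β) (hC : 0 ≤ C) {f u v : ℝ → ℝ} (hf : Measurable f)
    (h : ∀ x, ‖u x‖ₑ ≤ ‖v x‖ₑ
      + (ENNReal.ofReal (C / α) * (∫⁻ y in Metric.ball x (2 * α), ‖f y‖ₑ ∂σ)
        + ENNReal.ofReal (C / β) * ∫⁻ y in Metric.ball x (2 * β), ‖f y‖ₑ ∂σ)) (S : Set ℝ) :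
    ∫⁻ x in S, ‖u x‖ₑ ^ 2 ∂w ≤ 2 * (∫⁻ x in S, ‖v x‖ₑ ^ 2 ∂w)
      + ENNReal.ofReal (512 * C ^ 2 * X ^ 2) * ∫⁻ y, ‖f y‖ₑ ^ 2 ∂σ := by
  set E : ℝ → ℝ → ℝ≥0∞ := fun γ x =>
    ENNReal.ofReal (C / γ) * ∫⁻ y in Metric.ball x (2 * γ), ‖f y‖ₑ ∂σ with hE
  have hEm : ∀ γ, Measurable (E γ) := fun γ =>
    (measurable_lintegral_ball (2 * γ) hf.enorm).const_mul _
  have hEi : ∀ γ, 0 < γ → ∫⁻ x in S, E γ x ^ 2 ∂w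
      ≤ ENNReal.ofReal (64 * C ^ 2 * X ^ 2) * ∫⁻ y, ‖f y‖ₑ ^ 2 ∂σ := by
    intro γ hγ
    refine (setLIntegral_le_lintegral S _).trans ?_
    simp only [hE, mul_pow]
    rw [lintegral_const_mul' _ _ (by finiteness)]
    refine (mul_le_mul_right (lintegral_sq_average_le hA (R := 2 * γ) (by positivity) hf.enorm)
      _).trans (le_of_eq ?_)
    rw [← mul_assoc, ← ENNReal.ofReal_pow (by positivity), ← ENNReal.ofReal_mul (by positivity),
      ← ENNReal.ofReal_mul (by positivity)]
    congr 2
    field_simp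
    ring
  calc ∫⁻ x in S, ‖u x‖ₑ ^ 2 ∂w
      ≤ ∫⁻ x in S, (2 * ‖v x‖ₑ ^ 2 + 4 * (E α x ^ 2 + E β x ^ 2)) ∂w := by
        refine lintegral_mono fun x => ?_
        refine (pow_le_pow_left₀ zero_le (h x) 2).trans ((add_sq_le_two_mul _ _).trans ?_)
        calc _ ≤ 2 * (‖v x‖ₑ ^ 2 + 2 * (E α x ^ 2 + E β x ^ 2)) := by
              gcongr
              exact add_sq_le_two_mul _ _
          _ = _ := by ring
    _ = 2 * (∫⁻ x in S, ‖v x‖ₑ ^ 2 ∂w)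
        + 4 * ((∫⁻ x in S, E α x ^ 2 ∂w) + ∫⁻ x in S, E β x ^ 2 ∂w) := by
        have hm : Measurable fun x => 4 * (E α x ^ 2 + E β x ^ 2) :=
          (((hEm α).pow_const 2).add ((hEm β).pow_const 2)).const_mul 4
        rw [lintegral_add_right _ hm,
          lintegral_const_mul' _ _ (by finiteness), lintegral_const_mul' _ _ (by finiteness),
          lintegral_add_left ((hEm α).pow_const 2)]
    _ ≤ 2 * (∫⁻ x in S, ‖v x‖ₑ ^ 2 ∂w)
        + 4 * (ENNReal.ofReal (64 * C ^ 2 * X ^ 2) * (∫⁻ y, ‖f y‖ₑ ^ 2 ∂σ)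
          + ENNReal.ofReal (64 * C ^ 2 * X ^ 2) * ∫⁻ y, ‖f y‖ₑ ^ 2 ∂σ) := by
        gcongr
        · exact hEi α hα
        · exact hEi β hβ
    _ = _ := by
        rw [← add_mul, ← ENNReal.ofReal_add (by positivity) (by positivity), ← mul_assoc,
          show (4 : ℝ≥0∞) = ENNReal.ofReal 4 by norm_num, ← ENNReal.ofReal_mul (by norm_num)]
        congr 3
        ring

variable [IsLocallyFiniteMeasure σ]

theorem IsSmoothTruncation.integrable_cutKernel_mul (h : IsSmoothTruncation C K α β k) (hα : 0 < α)
    (hβ : 0 < β) (c : ℝ) {f : ℝ → ℝ} (hf : LocallyIntegrable f σ) (x : ℝ) :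
    Integrable (fun y => cutKernel c α β k x y * f y) σ := by
  have h1 := h.integrable_mul hα hβ hf x
  have h2 : Continuous fun y => c⁻¹ * cutoff α β (x - y) :=
    continuous_const.mul (continuous_cutoff.comp (continuous_const.sub continuous_id))
  have h3 := h1.bdd_mul h2.aestronglyMeasurable (c := |c⁻¹|)
    (Filter.Eventually.of_forall fun y => by
      rw [norm_mul, Real.norm_eq_abs, Real.norm_eq_abs, abs_of_nonneg (cutoff_nonneg _)]
      exact mul_le_of_le_one_right (abs_nonneg _) (cutoff_le_one _))
  refine h3.congr (Filter.Eventually.of_forall fun y => ?_)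
  simp only [cutKernel]
  ring

theorem IsSmoothTruncation.enorm_integralOp_sub_le (h : IsSmoothTruncation C K α β k) (hα : 0 < α)
    (hβ : 0 < β) {c : ℝ} (hc : 0 < c) {f : ℝ → ℝ} (hf : LocallyIntegrable f σ) (hfm : Measurable f)
    (x : ℝ) : ‖integralOp k σ f x - c * integralOp (cutKernel c α β k) σ f x‖ₑ
      ≤ ENNReal.ofReal (C / α) * (∫⁻ y in Metric.ball x (2 * α), ‖f y‖ₑ ∂σ)
        + ENNReal.ofReal (C / β) * ∫⁻ y in Metric.ball x (2 * β), ‖f y‖ₑ ∂σ := by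
  have hC := h.nonneg hα hβ
  have h1 := h.integrable_mul hα hβ hf x
  have h2 := (h.integrable_cutKernel_mul hα hβ c hf x).const_mul c
  rw [integralOp, integralOp, ← integral_const_mul, ← integral_sub h1 h2]
  refine (enorm_integral_le_lintegral_enorm _).trans ?_
  rw [← lintegral_const_mul _ hfm.enorm, ← lintegral_const_mul _ hfm.enorm,
    ← lintegral_indicator Metric.isOpen_ball.measurableSet,
    ← lintegral_indicator Metric.isOpen_ball.measurableSet,
    ← lintegral_add_left ((hfm.enorm.const_mul _).indicator Metric.isOpen_ball.measurableSet)]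
  refine lintegral_mono fun y => ?_
  have e : k x y * f y - c * (cutKernel c α β k x y * f y)
      = (k x y - c * cutKernel c α β k x y) * f y := by ring
  have h3 := ENNReal.ofReal_le_ofReal (h.abs_sub_cutKernel_le hα hβ hc x y)
  rw [e, enorm_mul, Real.enorm_eq_ofReal_abs]
  refine (mul_le_mul_left h3 _).trans (le_of_eq ?_)
  have hite : ∀ γ, 0 < γ → 0 ≤ if dist y x < 2 * γ then C / γ else 0 := fun γ hγ => by
    split_ifs <;> positivity
  rw [ENNReal.ofReal_add (hite α hα) (hite β hβ), add_mul]
  congr 1 <;>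
  · simp only [indicator, Metric.mem_ball]
    split_ifs <;> simp

variable [IsLocallyFiniteMeasure w]

/-- The testing inequality passes to the truncated kernel. The condition on `c` lets the normalization
absorb the constants that are lost. -/
theorem IsSmoothTruncation.testingIneq_cutKernel (h : IsSmoothTruncation C K α β k)
    (hα : 0 < α) (hβ : 0 < β) {X : ℝ} (hX : 0 ≤ X)
    (hA : ∀ I, IsInterval I → poisson σ I * poisson w I ≤ ENNReal.ofReal (X ^ 2))
    (hT : TestingIneq k σ w (ENNReal.ofReal X)) {c : ℝ} (hc : 0 < c)
    (hc' : 2 + 512 * C ^ 2 ≤ c ^ 2) :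
    TestingIneq (cutKernel c α β k) σ w (ENNReal.ofReal X) := by
  intro I hI
  have hIm : MeasurableSet I := hI.1.measurableSet
  have hfin : σ I ≠ ∞ := hI.2.1.measure_lt_top.ne
  have hC := h.nonneg hα hβ
  have hfm : Measurable (I.indicator (1 : ℝ → ℝ)) := measurable_one.indicator hIm
  have hfl : LocallyIntegrable (I.indicator (1 : ℝ → ℝ)) σ :=
    ((integrable_indicator_iff hIm).2 (integrableOn_const hfin)).locallyIntegrable
  have key := lintegral_sq_le_of_le_add_average hA hα hβ hC hfm
    (u := fun x => c * integralOp (cutKernel c α β k) σ (I.indicator 1) x)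
    (v := integralOp k σ (I.indicator 1)) (fun x => by
      refine le_trans ?_ (add_le_add_right (h.enorm_integralOp_sub_le hα hβ hc hfl hfm x) _)
      refine le_trans (le_of_eq ?_) (enorm_sub_le (a := integralOp k σ (I.indicator 1) x))
      rw [sub_sub_cancel]) I
  have h1 : ∫⁻ y, ‖I.indicator (1 : ℝ → ℝ) y‖ₑ ^ 2 ∂σ = σ I := by
    rw [← lintegral_indicator_one hIm]
    refine lintegral_congr fun y => ?_
    by_cases hy : y ∈ I <;> simp [hy]
  have h2 : ∫⁻ x in I, ‖c * integralOp (cutKernel c α β k) σ (I.indicator 1) x‖ₑ ^ 2 ∂w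
      = ENNReal.ofReal (c ^ 2)
        * ∫⁻ x in I, ‖integralOp (cutKernel c α β k) σ (I.indicator 1) x‖ₑ ^ 2 ∂w := by
    rw [← lintegral_const_mul' _ _ ENNReal.ofReal_ne_top]
    refine lintegral_congr fun x => ?_
    rw [enorm_mul, mul_pow, Real.enorm_eq_ofReal_abs c, abs_of_pos hc, ENNReal.ofReal_pow hc.le]
  rw [h1, h2] at key
  have h3 : ENNReal.ofReal (c ^ 2)
      * (∫⁻ x in I, ‖integralOp (cutKernel c α β k) σ (I.indicator 1) x‖ₑ ^ 2 ∂w)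
      ≤ ENNReal.ofReal (c ^ 2) * (ENNReal.ofReal X ^ 2 * σ I) := by
    refine key.trans ?_
    calc _ ≤ 2 * (ENNReal.ofReal X ^ 2 * σ I) + ENNReal.ofReal (512 * C ^ 2 * X ^ 2) * σ I := by
          gcongr
          exact hT I hI
      _ = ENNReal.ofReal ((2 + 512 * C ^ 2) * X ^ 2) * σ I := by
          rw [add_mul, ENNReal.ofReal_add (by positivity) (by positivity), add_mul,
            ENNReal.ofReal_mul (p := 2) (by positivity), ENNReal.ofReal_pow hX]
          norm_num [mul_assoc]
      _ ≤ ENNReal.ofReal (c ^ 2 * X ^ 2) * σ I := by gcongr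
      _ = _ := by rw [ENNReal.ofReal_mul (by positivity), ENNReal.ofReal_pow hX, mul_assoc]
  have hc0 : ENNReal.ofReal (c ^ 2) ≠ 0 := by
    rw [Ne, ENNReal.ofReal_eq_zero, not_le]; positivity
  exact (ENNReal.mul_le_mul_iff_right hc0 ENNReal.ofReal_ne_top).1 h3

/-- The normalized continuous truncation of a kernel with bounded testing constants is a tested
kernel. The factor `30 * C + 2` dominates `5 * C`, for the regularity, and its square dominates
`2 + 512 * C ^ 2`, for the testing inequality. -/
theorem IsSmoothTruncation.isTestedKernel (h : IsSmoothTruncation C K α β k) (hα : 0 < α)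
    (hβ : 0 < β) {X : ℝ} (hX : 0 < X)
    (hA : ∀ I, IsInterval I → poisson σ I * poisson w I ≤ ENNReal.ofReal (X ^ 2))
    (hP : PivotalIneq σ w (ENNReal.ofReal X)) (hP' : PivotalIneq w σ (ENNReal.ofReal X))
    (hT : TestingIneq k σ w (ENNReal.ofReal X))
    (hT' : TestingIneq (adjointKernel k) w σ (ENNReal.ofReal X)) :
    IsTestedKernel σ w (cutKernel (30 * C + 2) α β k) X := by
  have hC := h.nonneg hα hβ
  have hc : 0 < 30 * C + 2 := by positivity
  have hc5 : 5 * C ≤ 30 * C + 2 := by linarith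
  have hc2 : 2 + 512 * C ^ 2 ≤ (30 * C + 2) ^ 2 := by nlinarith
  have hA' : ∀ I, IsInterval I → poisson w I * poisson σ I ≤ ENNReal.ofReal (X ^ 2) :=
    fun I hI => by rw [mul_comm]; exact hA I hI
  have hle : ∀ x y, |cutKernel (30 * C + 2) α β k x y|
      = (30 * C + 2)⁻¹ * (|k x y| * cutoff α β (x - y)) := fun x y => by
    rw [cutKernel, abs_mul, abs_mul, abs_of_pos (inv_pos.2 hc), abs_of_nonneg (cutoff_nonneg _)]
  refine ⟨h.continuous_cutKernel hα hβ _, ⟨C / α, fun x y => ?_⟩, ⟨2 * β, fun x y hxy => ?_⟩,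
    fun x y => ?_, fun D x x' y hD h1 h2 => h.cutKernel_reg hα hβ hc hc5 hD h1 h2,
    fun D x y y' hD h1 h2 => ?_, hX, hA, hP, hP',
    h.testingIneq_cutKernel hα hβ hX.le hA hT hc hc2, ?_⟩
  · rw [hle]
    refine (mul_le_of_le_one_left (mul_nonneg (abs_nonneg _) (cutoff_nonneg _))
      (inv_le_one_of_one_le₀ (by linarith))).trans ?_
    exact (mul_le_of_le_one_right (abs_nonneg _) (cutoff_le_one _)).trans (h.abs_le hα hβ x y)
  · rw [cutKernel, h.eq_zero hα hxy, zero_mul, mul_zero]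
  · rw [hle]
    rcases eq_or_lt_of_le (abs_nonneg (x - y)) with h0 | h0
    · rw [cutoff_of_le hα (by rw [← h0]; exact hα.le), mul_zero, mul_zero]
      positivity
    · calc _ ≤ (30 * C + 2)⁻¹ * (C / |x - y| * 1) := by
            gcongr
            · exact cutoff_nonneg _
            · exact h.abs_le_div hα hβ h0
            · exact cutoff_le_one _
        _ = C / (30 * C + 2) * |x - y|⁻¹ := by field_simp
        _ ≤ 1 * |x - y|⁻¹ := by
            gcongr
            rw [div_le_one hc]
            linarith
        _ = _ := one_mul _
  · have := h.adjoint.cutKernel_reg hα hβ hc hc5 (x := y) (x' := y') (y := x) hD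
      (by rwa [abs_sub_comm]) (by rwa [abs_sub_comm])
    rwa [← adjointKernel_cutKernel] at this
  · rw [adjointKernel_cutKernel]
    exact h.adjoint.testingIneq_cutKernel hα hβ hX.le hA' hT' hc hc2

/-- The norm inequality passes back from the truncated kernel. -/
theorem IsSmoothTruncation.eLpNorm_integralOp_le (h : IsSmoothTruncation C K α β k) (hα : 0 < α)
    (hβ : 0 < β) {X B c : ℝ} (hX : 0 ≤ X) (hB : 0 ≤ B) (hc : 0 < c)
    (hA : ∀ I, IsInterval I → poisson σ I * poisson w I ≤ ENNReal.ofReal (X ^ 2))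
    (hcut : ∀ f, MemLp f 2 σ → eLpNorm (integralOp (cutKernel c α β k) σ f) 2 w
      ≤ ENNReal.ofReal (B * X) * eLpNorm f 2 σ) {f : ℝ → ℝ} (hf : MemLp f 2 σ) :
    eLpNorm (integralOp k σ f) 2 w
      ≤ ENNReal.ofReal ((2 * c * B + 32 * C) * X) * eLpNorm f 2 σ := by
  have hC := h.nonneg hα hβ
  -- a measurable representative
  wlog hfm : Measurable f generalizing f
  · obtain ⟨g, hg, hae⟩ : ∃ g, Measurable g ∧ f =ᵐ[σ] g :=
      ⟨hf.1.mk f, hf.1.stronglyMeasurable_mk.measurable, hf.1.ae_eq_mk⟩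
    have e : integralOp k σ f = integralOp k σ g := by
      funext x
      exact integral_congr_ae (hae.mono fun y hy => by simp only [hy])
    rw [e, eLpNorm_congr_ae hae]
    exact this ((memLp_congr_ae hae).1 hf) hg
  have key := lintegral_sq_le_of_le_add_average hA hα hβ hC hfm
    (u := integralOp k σ f)
    (v := fun x => c * integralOp (cutKernel c α β k) σ f x) (fun x => by
      refine le_trans ?_ (add_le_add_right (h.enorm_integralOp_sub_le hα hβ hc
        (locallyIntegrable_of_memLp_two hf) hfm x) _)
      refine le_trans (le_of_eq ?_) (enorm_add_le _ _)
      rw [add_sub_cancel]) univ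
  rw [Measure.restrict_univ, ← eLpNorm_two_sq, ← eLpNorm_two_sq, ← eLpNorm_two_sq] at key
  have h1 : eLpNorm (fun x => c * integralOp (cutKernel c α β k) σ f x) 2 w
      ≤ ENNReal.ofReal (c * (B * X)) * eLpNorm f 2 σ := by
    have e := eLpNorm_const_smul c (integralOp (cutKernel c α β k) σ f) 2 w
    rw [Real.enorm_eq_ofReal_abs, abs_of_pos hc] at e
    rw [ENNReal.ofReal_mul hc.le, mul_assoc]
    exact (le_of_eq e).trans (mul_le_mul_right (hcut f hf) _)
  rw [← ENNReal.pow_le_pow_left_iff two_ne_zero]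
  calc _ ≤ _ := key
    _ ≤ 2 * (ENNReal.ofReal (c * (B * X)) * eLpNorm f 2 σ) ^ 2
        + ENNReal.ofReal (512 * C ^ 2 * X ^ 2) * eLpNorm f 2 σ ^ 2 := by gcongr
    _ = ENNReal.ofReal (2 * (c * (B * X)) ^ 2 + 512 * C ^ 2 * X ^ 2) * eLpNorm f 2 σ ^ 2 := by
        rw [ENNReal.ofReal_add (by positivity) (by positivity), add_mul,
          ENNReal.ofReal_mul (p := 2) (by positivity), ENNReal.ofReal_pow (by positivity), mul_pow]
        norm_num [mul_assoc]
    _ ≤ ENNReal.ofReal (((2 * c * B + 32 * C) * X) ^ 2) * eLpNorm f 2 σ ^ 2 := by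
        gcongr
        have h1 : 0 ≤ (c * B) * C * X ^ 2 := by positivity
        have h2 : 0 ≤ (c * (B * X)) ^ 2 := by positivity
        have h3 : 0 ≤ C ^ 2 * X ^ 2 := by positivity
        nlinarith
    _ = _ := by rw [ENNReal.ofReal_pow (by positivity), mul_pow]

/-- The bound in terms of any finite number `X` above the sum of the three constants. The infima that
define them need not be attained for `X`, but each is exceeded by `X`. -/
theorem normConst_le {k : ℝ → ℝ → ℝ → ℝ → ℝ} {B X : ℝ} (hB : 0 ≤ B)
    (hK : ∀ {k : ℝ → ℝ → ℝ}, IsTestedKernel σ w k X → ∀ f, MemLp f 2 σ →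
      eLpNorm (integralOp k σ f) 2 w ≤ ENNReal.ofReal (B * X) * eLpNorm f 2 σ)
    (hk : ∀ α β, 0 < α → α < β → IsSmoothTruncation C K α β (k α β))
    (hS : testingConst k σ w + A2Const σ w ^ (1 / 2 : ℝ) + pivotalConst σ w < ENNReal.ofReal X) :
    normConst k σ w ≤ ENNReal.ofReal ((2 * (30 * C + 2) * B + 32 * C) * X) := by
  have hX : 0 < X := ENNReal.ofReal_pos.1 (zero_le.trans_lt hS)
  have hA : ∀ I, IsInterval I → poisson σ I * poisson w I ≤ ENNReal.ofReal (X ^ 2) := by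
    intro I hI
    refine (poisson_mul_poisson_le_A2Const σ w hI).trans ?_
    have h1 : A2Const σ w ^ (1 / 2 : ℝ) ≤ ENNReal.ofReal X :=
      ((le_add_self.trans le_self_add).trans_lt hS).le
    have h2 := pow_le_pow_left₀ zero_le h1 2
    rw [← ENNReal.rpow_mul_natCast] at h2
    norm_num at h2
    rwa [ENNReal.ofReal_pow hX.le]
  obtain ⟨P, ⟨hP1, hP2⟩, hP⟩ := sInf_lt_iff.1 (le_add_self.trans_lt hS)
  obtain ⟨T, hT1, hT⟩ := sInf_lt_iff.1 ((le_self_add.trans le_self_add).trans_lt hS)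
  refine sInf_le fun f hf α β hα hαβ => ?_
  have hβ := hα.trans hαβ
  have h := hk α β hα hαβ
  have hC := h.nonneg hα hβ
  have ht := h.isTestedKernel hα hβ hX hA (hP1.mono hP.le) (hP2.mono hP.le)
    ((hT1 α β hα hαβ).1.mono hT.le) ((hT1 α β hα hαβ).2.mono hT.le)
  exact h.eLpNorm_integralOp_le hα hβ hX.le hB (by positivity) hA (hK ht) hf

end

end TwoWeight

theorem theoremt (C₀ : ℝ) :
    ∃ C : ℝ≥0, ∀ (σ w : Measure ℝ) [IsLocallyFiniteMeasure σ] [IsLocallyFiniteMeasure w]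
      (K : ℝ → ℝ → ℝ) (k : ℝ → ℝ → ℝ → ℝ → ℝ),
      TwoWeight.IsCZKernel K →
      (∀ α β : ℝ, 0 < α → α < β → TwoWeight.IsSmoothTruncation C₀ K α β (k α β)) →
      (∀ x : ℝ, σ {x} * w {x} = 0) →
      TwoWeight.A2Const σ w < ∞ →
      TwoWeight.pivotalConst σ w < ∞ →
      TwoWeight.normConst k σ w ≤
        (C : ℝ≥0∞) * (TwoWeight.testingConst k σ w + TwoWeight.A2Const σ w ^ (1 / 2 : ℝ)
          + TwoWeight.pivotalConst σ w) := by
  obtain ⟨B, hB, hK⟩ := TwoWeight.exists_integralOp_le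
  set A : ℝ := 2 * (30 * C₀ + 2) * B + 32 * C₀ with hA
  refine ⟨A.toNNReal + 1, fun σ w _ _ K k _ hk _ _ _ => ?_⟩
  have hC : 0 ≤ C₀ := (hk 1 2 one_pos one_lt_two).nonneg one_pos two_pos
  have hA0 : 0 ≤ A := by positivity
  set D : ℝ≥0∞ := ((A.toNNReal + 1 : ℝ≥0) : ℝ≥0∞) with hD
  have hD0 : D ≠ 0 := by simp [hD]
  have hDt : D ≠ ∞ := ENNReal.coe_ne_top
  by_contra hlt
  rw [not_le, mul_comm, ← ENNReal.lt_div_iff_mul_lt (Or.inl hD0) (Or.inl hDt)] at hlt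
  obtain ⟨b, hb1, hb2⟩ := exists_between hlt
  have hbt : b ≠ ∞ := hb2.ne_top
  rw [ENNReal.lt_div_iff_mul_lt (Or.inl hD0) (Or.inl hDt)] at hb2
  refine absurd hb2 (not_lt.2 ?_)
  rw [← ENNReal.ofReal_toReal hbt] at hb1 ⊢
  refine (TwoWeight.normConst_le hB hK hk hb1).trans ?_
  rw [← hA, ENNReal.ofReal_mul hA0, mul_comm]
  gcongr
  rw [hD, ENNReal.coe_add]
  exact le_self_add
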